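/- **Notation.** Let $\eta,\lambda,z\in\mathbb C$ and $q=e^{2\pi \mathrm i\eta}$, $q^{a}:=e^{2\pi \mathrm i\eta a}$ for $a\in\mathbb C$, and $X=e^{-2\pi \mathrm i\lambda}$. Let $[n]=\frac{q^n-q^{-n}}{q-q^{-1}}$, $[n]!=[1]\cdots[n]$, and for $n\ge 0$ let $(a;p)_n=\prod_{j=0}^{n-1}(1-p^ja)$, $(a;p)_{-n}=\prod_{j=1}^n(1-p^{-j}a)^{-1}$. Square roots $\sqrt{[n]}$ are principal, and $\sqrt{[n]!}=\prod_{i\le n}\sqrt{[i]}$. Let $V^{L}$ have basis $|0\rangle,\dots,|L\rangle$ with $H|n\rangle=(2n-L)|n\rangle$, $E_+|n\rangle=\sqrt{[L-n]}\sqrt{[n+1]}\,|n+1\rangle$, $E_-|n\rangle=\sqrt{[n]}\sqrt{[L-n+1]}\,|n-1\rangle$. Let $P$ denote the flip of a tensor product. Fix $\Lambda,J\in\mathbb Z_{\ge0}$. **The weights $S$.** The spectral $R$-matrix $R^D(z)$ on $V^\Lambda\otimes V^J$ is the linear operator with $R^D(z)|0,0\rangle=|0,0\rangle$, commuting with $q^H\otimes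 q^H$, such that $$R^D(z)\,\bigl(E_\pm\otimes q^{H/2}+q^{-H/2}\otimes E_\pm\bigr)=\bigl(E_\pm\otimes q^{-H/2}+q^{H/2}\otimes E_\pm\bigr)\,R^D(z),$$ $$R^D(z)\,\bigl(z^{\mp1}E_\pm\otimes q^{-H/2}+q^{H/2}\otimes E_\pm\bigr)=\bigl(z^{\mp1}E_\pm\otimes q^{H/2}+q^{-H/2}\otimes E_\pm\bigr)\,R^D(z).$$ The universal dynamical twist is $$F(\lambda)=\sum_{k\ge0}\frac{(-1)^k(q-q^{-1})^k}{[k]!}\,\frac{X^k\,q^{k(k+1)/2}\,q^{k(3H_1+H_2)/2}}{\prod_{\nu=1}^{k}(1-X\,q^{2H_1+2\nu})}\;E_-^k\otimes E_+^k .$$ Put $R(z,\lambda)=F_{21}(\lambda)\,R^D(z)^{-1}F_{12}(\lambda)^{-1}$ and $\check R=PR$. On $V^{L_1}\otimes V^{L_2}$ let $G(\lambda)$ be the diagonal matrix with entries $$\langle\xi_1,\xi_2|G|\xi_1,\xi_2\rangle=\frac{q^{(L_1/2+L_2)\xi_1+L_2\xi_2/2}}{\sqrt{[L_1-\xi_1]!}\sqrt{[L_2-\xi_2]!}\sqrt{[\xi_1]!}\sqrt{[\xi_2]!}\;(Xq^{4\xi_1-2L_1+2};q^2)_{L_1-\xi_1}\,(Xq^{4(\xi_1+\xi_2)-2(L_1+L_2)+2};q^2)_{L_2-\xi_2}}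 .$$ Then $S(z,\lambda)=P\,G(\lambda)^{-1}\check R(z,\lambda)\,G(\lambda)$ on $V^\Lambda\otimes V^J$, with the right factor $G(\lambda)$ on $V^\Lambda\otimes V^J$ and $G(\lambda)^{-1}$ on $V^J\otimes V^\Lambda$; its weights are $\langle i_1,j_1|S(z,\lambda)|i_2,j_2\rangle$. **The fused weights $\psi$.** Given $\hat\eta,u\in\mathbb C$, put $\hat q=e^{-4\pi \mathrm i\hat\eta}$, $s=e^{2\pi \mathrm i\hat\eta\Lambda}$, $\kappa^{-1}=\hat q^{\,J-2j_1}e^{2\pi \mathrm i\lambda}$ and, with all Pochhammer symbols $(a)_n=(a;\hat q)_n$ in base $\hat q$, $$\psi_{\Lambda,J,u,\lambda}(i_1,j_1;i_2,j_2)=\mathbf 1_{i_1+j_1=i_2+j_2}\,\hat q^{(j_2-i_1)J}\Bigl(\frac us\Bigr)^{j_1}\frac{(\hat q^{i_1-j_2+1})_{j_2}(\hat q^{j_2-J})_{j_1}(su\hat q^J)_{i_1-j_2}(s^2\hat q^{i_1-j_2})_{j_1}}{(su)_{i_1+j_1}(\hat q)_{j_2}(\hat q^{j_2-J})_{j_1-j_2}}$$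 $$\times\frac{(us^{-1}\kappa^{-1}\hat q^{-i_1})_{j_2}(\hat q^{1-i_1-J}u^{-1}s^{-1}\kappa^{-1})_{j_1}(\hat q\kappa^{-1})_{j_1}(\hat q^{j_2-2i_1+1}s^{-2}\kappa^{-1})_{i_1-j_2}}{(\hat q^{1-j_2}\kappa^{-1})_{j_1}(\hat q^{j_2-i_1-J+1}s^{-2}\kappa^{-1})_{j_1}(\hat q^{j_2-2i_1-J}s^{-2}\kappa^{-1})_{j_2}(\hat q^{2j_2-2i_1-J+1}s^{-2}\kappa^{-1})_{i_1-j_2}}$$ $$\times{}_{10}W_9\bigl(\hat q^{-j_2}\kappa^{-1};\hat q^{-j_1},\hat q^{-j_2},\hat q^{j_1-J}\kappa^{-1},\hat q^{1-i_1}s^{-2}\kappa^{-1},su^{-1}\hat q^{i_1-j_2+1},us\hat q^{i_1-j_2+J},\hat q^{-i_1}\kappa^{-1};\hat q,\hat q\bigr),$$ where ${}_{r+1}W_r(a_1;a_4,\dots,a_{r+1};p,x)=\sum_{k\ge0}\frac{x^k(a_1;p)_k}{(p;p)_k}\frac{1-a_1p^{2k}}{1-a_1}\prod_{j=4}^{r+1}\frac{(a_j;p)_k}{(pa_1/a_j;p)_k}$.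 Where this formula reads $0/0$ (for instance when $i_1<j_2$ or $j_1+j_2>J$), $\psi$ denotes the value obtained after replacing $(\hat q^{j_2-J})_{j_1}/(\hat q^{j_2-J})_{j_1-j_2}$ by $(\hat q^{j_1-J})_{j_2}=(-1)^{j_2}\hat q^{\,j_2(j_1-J)+j_2(j_2-1)/2}(\hat q^{J-j_1-j_2+1})_{j_2}$, ending the series at $k=\min(j_1,j_2)$, and cancelling the four prefactors $$(\hat q^{i_1-j_2+1})_{j_2},\quad(\hat q^{J-j_1-j_2+1})_{j_2},\quad(us^{-1}\kappa^{-1}\hat q^{-i_1})_{j_2},\quad(\hat q^{1-i_1-J}u^{-1}s^{-1}\kappa^{-1})_{j_1}$$ against the corresponding denominators $(b)_k$ of the series by $(b)_n/(b)_k=(b\hat q^{k})_{n-k}$. **Proposition.** Assume that $q$ is not a root of unity, $z\ne0$, $z\notin q^{\mathbb Z}$ and $e^{-2\pi \mathrm i\lambda}\notin q^{2\mathbb Z}$. Then for all $\Lambda,J\in\mathbb Z_{\ge0}$ the operator $R^D(z)$ on $V^\Lambda\otimes V^J$ exists, is unique and is invertible, and for all $0\le i_1,i_2\le\Lambda$,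 $0\le j_1,j_2\le J$, $$\langle i_1,j_1|S(z,\lambda)|i_2,j_2\rangle=\psi_{\Lambda,J,u,\lambda}(i_1,j_1;i_2,j_2)\qquad\text{with } \hat\eta=-\eta\ (\text{so } \hat q=q^2,\ s=q^{-\Lambda}),\quad u=\frac1{z\,q^{J}}.$$ If moreover $zX\notin q^{\mathbb Z}$ and $z/X\notin q^{\mathbb Z}$, then for $j_2\le i_1$ and $j_1+j_2\le J$ the displayed formula for $\psi$, taken literally, has this value. -/

import Mathlib

open Matrix
open scoped Kronecker

noncomputable section

namespace DynVertex

/-! ### `q`-notation -/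

/-- `q ^ a` for a complex exponent `a`, where `q = exp (2 π i η)`. -/
def qpow (η a : ℂ) : ℂ := Complex.exp (2 * Real.pi * Complex.I * η * a)

/-- The `q`-integer `[n] = (q ^ n - q ^ (-n)) / (q - q ^ (-1))`. -/
def qint (η : ℂ) (n : ℕ) : ℂ :=
  (qpow η n - qpow η (-n)) / (qpow η 1 - qpow η (-1))

/-- The `q`-factorial `[n]! = [1] [2] ⋯ [n]`. -/
def qfact (η : ℂ) (n : ℕ) : ℂ := ∏ i ∈ Finset.range n, qint η (i + 1)

/-- The (principal) square root of `[n]`; the positive root when `q > 0`. -/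
def qintSqrt (η : ℂ) (n : ℕ) : ℂ := qint η n ^ (1 / 2 : ℂ)

/-- The square root of `[n]!`, as the product of the chosen square roots of `[1], …, [n]`. -/
def qfactSqrt (η : ℂ) (n : ℕ) : ℂ := ∏ i ∈ Finset.range n, qintSqrt η (i + 1)

/-- The `q`-Pochhammer symbol `(a; q)_n` for an integer `n` of either sign:
`(a; q)_n = ∏_{0 ≤ j < n} (1 - q ^ j a)` and `(a; q)_{-n} = ∏_{1 ≤ j ≤ n} 1 / (1 - q ^ (-j) a)`. -/
def qPoch (a q : ℂ) : ℤ → ℂ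
  | Int.ofNat n => ∏ j ∈ Finset.range n, (1 - q ^ j * a)
  | Int.negSucc n => ∏ j ∈ Finset.range (n + 1), 1 / (1 - q ^ (-((j : ℤ) + 1)) * a)

/-! ### Representations of `U_q(sl_2)` and the spectral `R`-matrix

`V^L` has the basis `|0⟩, …, |L⟩` (`|n⟩` = `n` particles), and a matrix `A` has the entries
`A m n = ⟨m| A |n⟩`. -/

/-- `E_+ |n⟩ = √[L - n] √[n + 1] |n + 1⟩` on `V^L`. -/
def raising (η : ℂ) (L : ℕ) : Matrix (Fin (L + 1)) (Fin (L + 1)) ℂ :=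
  Matrix.of fun m n =>
    if (m : ℕ) = (n : ℕ) + 1 then qintSqrt η (L - n) * qintSqrt η (n + 1) else 0

/-- `E_- |n + 1⟩ = √[L - n] √[n + 1] |n⟩` on `V^L`. -/
def lowering (η : ℂ) (L : ℕ) : Matrix (Fin (L + 1)) (Fin (L + 1)) ℂ :=
  Matrix.of fun m n =>
    if (n : ℕ) = (m : ℕ) + 1 then qintSqrt η (L - m) * qintSqrt η (m + 1) else 0

/-- The eigenvalue of `H` on `|n⟩ ∈ V^L`. -/
def weight (L : ℕ) (n : Fin (L + 1)) : ℂ := 2 * ((n : ℕ) : ℂ) - (L : ℂ)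

/-- `q ^ (c H)` on `V^L`. -/
def qH (η : ℂ) (L : ℕ) (c : ℂ) : Matrix (Fin (L + 1)) (Fin (L + 1)) ℂ :=
  Matrix.diagonal fun n => qpow η (c * weight L n)

/-- `A ⊗ q ^ (c H) + q ^ (-c H) ⊗ B` on `V^L ⊗ V^J`. With `c = 1/2` this is the shape of the
coproduct `Δ(E_±) = E_± ⊗ q ^ (H/2) + q ^ (-H/2) ⊗ E_±`, and with `c = -1/2` the shape of the
opposite coproduct `Δ'(E_±)`. -/
def skewSum (η : ℂ) (L J : ℕ) (c : ℂ) (A : Matrix (Fin (L + 1)) (Fin (L + 1)) ℂ)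
    (B : Matrix (Fin (J + 1)) (Fin (J + 1)) ℂ) :
    Matrix (Fin (L + 1) × Fin (J + 1)) (Fin (L + 1) × Fin (J + 1)) ℂ :=
  A ⊗ₖ qH η J c + qH η L (-c) ⊗ₖ B

/-- `R` is the spectral `R`-matrix `R^D(z)` on `V^L ⊗ V^J`: it satisfies `R Δ(X) = Δ'(X) R` for the
generators `X` of the quantum affine algebra `U_q(sl_2^)`, acting on `V^L` by the evaluation
representation with parameter `z` and on `V^J` by the one with parameter `1`
(`e_1 = E_+`, `f_1 = E_-`, `e_0 = z E_-`, `f_0 = z⁻¹ E_+`, `h_1 = H = -h_0`),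
and it is normalized by `R |0, 0⟩ = |0, 0⟩`. -/
structure IsSpectralR (η z : ℂ) (L J : ℕ)
    (R : Matrix (Fin (L + 1) × Fin (J + 1)) (Fin (L + 1) × Fin (J + 1)) ℂ) : Prop where
  cartan : R * (qH η L 1 ⊗ₖ qH η J 1) = (qH η L 1 ⊗ₖ qH η J 1) * R
  e_one : R * skewSum η L J (1 / 2) (raising η L) (raising η J) =
    skewSum η L J (-1 / 2) (raising η L) (raising η J) * R
  f_one : R * skewSum η L J (1 / 2) (lowering η L) (lowering η J) =
    skewSum η L J (-1 / 2) (lowering η L) (lowering η J) * R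
  e_zero : R * skewSum η L J (-1 / 2) (z • lowering η L) (lowering η J) =
    skewSum η L J (1 / 2) (z • lowering η L) (lowering η J) * R
  f_zero : R * skewSum η L J (-1 / 2) (z⁻¹ • raising η L) (raising η J) =
    skewSum η L J (1 / 2) (z⁻¹ • raising η L) (raising η J) * R
  normalized : R (0, 0) (0, 0) = 1

/-! ### The dynamical twist, the twisted `R`-matrix, and the stochastic matrix `S` -/

/-- The dynamical variable `e^{-2 π i λ}`. Replacing `λ` by `λ - 2 η H` multiplies it by
`q ^ (2 H)`. -/
def dynX (lam : ℂ) : ℂ := Complex.exp (-(2 * Real.pi * Complex.I * lam))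

/-- The universal dynamical twist
`F(λ) = ∑_k (-1)^k (q - q⁻¹)^k / [k]! · X^k q^{k(k+1)/2} q^{k(3 H_1 + H_2)/2}
  / ∏_{ν=1}^k (1 - X q^{2 H_1 + 2 ν}) · E_-^k ⊗ E_+^k`, with `X = e^{-2 π i λ}`,
acting on `V^L ⊗ V^J`. It tends to `1` as `X → 0`, and it is the solution
of the shifted cocycle condition that twists the opposite coproduct. The terms with `k > L` vanish,
since `E_-^k = 0` on `V^L`. -/
def twist (η lam : ℂ) (L J : ℕ) :
    Matrix (Fin (L + 1) × Fin (J + 1)) (Fin (L + 1) × Fin (J + 1)) ℂ :=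
  ∑ k ∈ Finset.range (L + 1),
    (Matrix.diagonal fun p : Fin (L + 1) × Fin (J + 1) =>
      (-1) ^ k * (qpow η 1 - qpow η (-1)) ^ k / qfact η k * dynX lam ^ k *
        qpow η ((k : ℂ) * (k + 1) / 2) *
        qpow η ((k : ℂ) * (3 * weight L p.1 + weight J p.2) / 2) /
        ∏ ν ∈ Finset.range k,
          (1 - dynX lam * qpow η (2 * weight L p.1 + 2 * ((ν : ℂ) + 1)))) *
    ((lowering η L ^ k) ⊗ₖ (raising η J ^ k))

/-- `F_{21}(λ)` on `V^L ⊗ V^J`: the twist on `V^J ⊗ V^L` conjugated by the flip. -/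
def twist21 (η lam : ℂ) (L J : ℕ) :
    Matrix (Fin (L + 1) × Fin (J + 1)) (Fin (L + 1) × Fin (J + 1)) ℂ :=
  (twist η lam J L).submatrix Prod.swap Prod.swap

/-- The twisted `R`-matrix `R(z, λ) = F_{21}(λ) (R^D(z))⁻¹ F_{12}(λ)⁻¹`, from `R^D(z) = RD`. -/
def twistedR (η lam : ℂ) {L J : ℕ}
    (RD : Matrix (Fin (L + 1) × Fin (J + 1)) (Fin (L + 1) × Fin (J + 1)) ℂ) :
    Matrix (Fin (L + 1) × Fin (J + 1)) (Fin (L + 1) × Fin (J + 1)) ℂ :=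
  twist21 η lam L J * RD⁻¹ * (twist η lam L J)⁻¹

/-- The diagonal ground state transformation `G(λ)` on `V^{L₁} ⊗ V^{L₂}`, with
`⟨ξ₁, ξ₂| G |ξ₁, ξ₂⟩ = ([L₁-ξ₁]! [L₂-ξ₂]! [ξ₁]! [ξ₂]!)^{-1/2} q^{(L₁/2 + L₂) ξ₁ + L₂ ξ₂ / 2} /
((X q^{4 ξ₁ - 2 L₁ + 2}; q²)_{L₁-ξ₁} (X q^{4(ξ₁+ξ₂) - 2(L₁+L₂) + 2}; q²)_{L₂-ξ₂})`. -/
def groundState (η lam : ℂ) (L₁ L₂ : ℕ) :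
    Matrix (Fin (L₁ + 1) × Fin (L₂ + 1)) (Fin (L₁ + 1) × Fin (L₂ + 1)) ℂ :=
  Matrix.diagonal fun p =>
    (qfactSqrt η (L₁ - p.1) * qfactSqrt η (L₂ - p.2) * qfactSqrt η p.2 * qfactSqrt η p.1)⁻¹ *
      qpow η (((L₁ : ℂ) / 2 + L₂) * ((p.1 : ℕ) : ℂ) + (L₂ : ℂ) / 2 * ((p.2 : ℕ) : ℂ)) /
      (qPoch (dynX lam * qpow η (4 * ((p.1 : ℕ) : ℂ) - 2 * L₁ + 2)) (qpow η 2)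
          ((L₁ : ℤ) - (p.1 : ℕ)) *
        qPoch (dynX lam *
            qpow η (4 * (((p.1 : ℕ) : ℂ) + ((p.2 : ℕ) : ℂ)) - 2 * ((L₁ : ℂ) + L₂) + 2)) (qpow η 2)
          ((L₂ : ℤ) - (p.2 : ℕ)))

/-- `Ř = P R`, a map `V^L ⊗ V^J → V^J ⊗ V^L`. -/
def checkR (η lam : ℂ) {L J : ℕ}
    (RD : Matrix (Fin (L + 1) × Fin (J + 1)) (Fin (L + 1) × Fin (J + 1)) ℂ) :
    Matrix (Fin (J + 1) × Fin (L + 1)) (Fin (L + 1) × Fin (J + 1)) ℂ :=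
  (twistedR η lam RD).submatrix Prod.swap id

/-- `Š(z, λ) = G(λ)⁻¹ Ř(z, λ) G(λ)`, a map `V^L ⊗ V^J → V^J ⊗ V^L`. -/
def checkS (η lam : ℂ) {L J : ℕ}
    (RD : Matrix (Fin (L + 1) × Fin (J + 1)) (Fin (L + 1) × Fin (J + 1)) ℂ) :
    Matrix (Fin (J + 1) × Fin (L + 1)) (Fin (L + 1) × Fin (J + 1)) ℂ :=
  (groundState η lam J L)⁻¹ * checkR η lam RD * groundState η lam L J

/-- `S(z, λ) = P Š(z, λ)` on `V^L ⊗ V^J`. -/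
def stochS (η lam : ℂ) {L J : ℕ}
    (RD : Matrix (Fin (L + 1) × Fin (J + 1)) (Fin (L + 1) × Fin (J + 1)) ℂ) :
    Matrix (Fin (L + 1) × Fin (J + 1)) (Fin (L + 1) × Fin (J + 1)) ℂ :=
  (checkS η lam RD).submatrix Prod.swap id

/-! ### The fused stochastic weights

The vertical spin is `Λ`, the horizontal spin `J`, and
`q = e^{-4 π i η}`, `s = e^{2 π i η Λ}`, `ϰ = e^{2 π i λ}`, `κ = (q^{J - 2 j₁} ϰ)⁻¹`. -/

/-- The very-well-poised series `_{r+1}W_r(a₁; a₄, …, a_{r+1}; q, z)`; `as = [a₄, …, a_{r+1}]`. -/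
def vwp (a₁ : ℂ) (as : List ℂ) (q z : ℂ) : ℂ :=
  ∑' k : ℕ, z ^ k * qPoch a₁ q k / qPoch q q k * ((1 - a₁ * q ^ (2 * k)) / (1 - a₁)) *
    (as.map fun a => qPoch a q k / qPoch (q * a₁ / a) q k).prod

/-- `κ = (q^{J - 2 j₁} e^{2 π i λ})⁻¹`. -/
def kappa (q lam : ℂ) (J j₁ : ℕ) : ℂ :=
  (q ^ ((J : ℤ) - 2 * j₁) * Complex.exp (2 * Real.pi * Complex.I * lam))⁻¹

/-- The fused weight `ψ_{Λ,J,u,λ}(i₁, j₁; i₂, j₂)`, by its explicit `₁₀W₉` formula read literally.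
The formula is an indeterminate `0 / 0` when `i₁ < j₂` or `j₁ + j₂ > J`; see `psi`. -/
def psiLiteral (η : ℂ) (Λ J : ℕ) (u lam : ℂ) (i₁ j₁ i₂ j₂ : ℕ) : ℂ :=
  let q : ℂ := Complex.exp (-(4 * Real.pi * Complex.I * η))
  let s : ℂ := Complex.exp (2 * Real.pi * Complex.I * η * Λ)
  let κ : ℂ := kappa q lam J j₁
  let I₁ : ℤ := i₁
  let J₁ : ℤ := j₁
  let J₂ : ℤ := j₂
  let N : ℤ := J
  if i₁ + j₁ = i₂ + j₂ then
    q ^ ((J₂ - I₁) * N) * (u / s) ^ j₁ *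
      (qPoch (q ^ (I₁ - J₂ + 1)) q J₂ * qPoch (q ^ (J₂ - N)) q J₁ *
        qPoch (s * u * q ^ N) q (I₁ - J₂) * qPoch (s ^ 2 * q ^ (I₁ - J₂)) q J₁ /
        (qPoch (s * u) q (I₁ + J₁) * qPoch q q J₂ * qPoch (q ^ (J₂ - N)) q (J₁ - J₂))) *
      (qPoch (u * s⁻¹ * κ⁻¹ * q ^ (-I₁)) q J₂ *
        qPoch (q ^ (1 - I₁ - N) * u⁻¹ * s⁻¹ * κ⁻¹) q J₁ * qPoch (q * κ⁻¹) q J₁ *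
        qPoch (q ^ (J₂ - 2 * I₁ + 1) * (s ^ 2)⁻¹ * κ⁻¹) q (I₁ - J₂) /
        (qPoch (q ^ (1 - J₂) * κ⁻¹) q J₁ *
          qPoch (q ^ (J₂ - I₁ - N + 1) * (s ^ 2)⁻¹ * κ⁻¹) q J₁ *
          qPoch (q ^ (J₂ - 2 * I₁ - N) * (s ^ 2)⁻¹ * κ⁻¹) q J₂ *
          qPoch (q ^ (2 * J₂ - 2 * I₁ - N + 1) * (s ^ 2)⁻¹ * κ⁻¹) q (I₁ - J₂))) *
      vwp (q ^ (-J₂) * κ⁻¹)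
        [q ^ (-J₁), q ^ (-J₂), q ^ (J₁ - N) * κ⁻¹, q ^ (1 - I₁) * (s ^ 2)⁻¹ * κ⁻¹,
          s * u⁻¹ * q ^ (I₁ - J₂ + 1), u * s * q ^ (I₁ - J₂ + N), q ^ (-I₁) * κ⁻¹] q q
  else 0

/-- The fused weight `ψ_{Λ,J,u,λ}(i₁, j₁; i₂, j₂)` with the removable singularities of the explicit
formula removed. Here `a₁ = q^{-j₂} κ⁻¹`, and four of the factors of the prefactor have been
combined with the four denominators `(q a₁ / a; q)_k` of the series for `a` = `q^{-i₁} κ⁻¹`,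
`q^{j₁-J} κ⁻¹`, `s u⁻¹ q^{i₁-j₂+1}`, `u s q^{i₁-j₂+J}` through
`(b; q)_n / (b; q)_k = (b q^k; q)_{n-k}` for `k ≤ n`:
* `(q^{i₁-j₂+1}; q)_{j₂} / (q^{i₁-j₂+1}; q)_k = (q^{i₁-j₂+1+k}; q)_{j₂-k}`;
* `(q^{j₂-J}; q)_{j₁} / ((q^{j₂-J}; q)_{j₁-j₂} (q^{J-j₁-j₂+1}; q)_k)
    = (-1)^{j₂} q^{j₂(j₁-J) + j₂(j₂-1)/2} (q^{J-j₁-j₂+1+k}; q)_{j₂-k}`,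
  where `(q^{j₂-J}; q)_{j₁} / (q^{j₂-J}; q)_{j₁-j₂} = (q^{j₁-J}; q)_{j₂}`;
* `(u s⁻¹ κ⁻¹ q^{-i₁}; q)_{j₂} / (u s⁻¹ κ⁻¹ q^{-i₁}; q)_k = (u s⁻¹ κ⁻¹ q^{k-i₁}; q)_{j₂-k}`;
* `(q^{1-i₁-J} u⁻¹ s⁻¹ κ⁻¹; q)_{j₁} / (q^{1-i₁-J} u⁻¹ s⁻¹ κ⁻¹; q)_k
    = (q^{1-i₁-J+k} u⁻¹ s⁻¹ κ⁻¹; q)_{j₁-k}`.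
The series ends at `k = min j₁ j₂` because of the factors `(q^{-j₁}; q)_k (q^{-j₂}; q)_k`. -/
def psi (η : ℂ) (Λ J : ℕ) (u lam : ℂ) (i₁ j₁ i₂ j₂ : ℕ) : ℂ :=
  let q : ℂ := Complex.exp (-(4 * Real.pi * Complex.I * η))
  let s : ℂ := Complex.exp (2 * Real.pi * Complex.I * η * Λ)
  let κ : ℂ := kappa q lam J j₁
  let I₁ : ℤ := i₁
  let J₁ : ℤ := j₁
  let J₂ : ℤ := j₂
  let N : ℤ := J
  let a₁ : ℂ := q ^ (-J₂) * κ⁻¹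
  if i₁ + j₁ = i₂ + j₂ then
    q ^ ((J₂ - I₁) * N) * (u / s) ^ j₁ *
      ((-1) ^ j₂ * q ^ (J₂ * (J₁ - N) + J₂ * (J₂ - 1) / 2) *
        qPoch (s * u * q ^ N) q (I₁ - J₂) * qPoch (s ^ 2 * q ^ (I₁ - J₂)) q J₁ /
        (qPoch (s * u) q (I₁ + J₁) * qPoch q q J₂)) *
      (qPoch (q * κ⁻¹) q J₁ * qPoch (q ^ (J₂ - 2 * I₁ + 1) * (s ^ 2)⁻¹ * κ⁻¹) q (I₁ - J₂) /
        (qPoch (q ^ (1 - J₂) * κ⁻¹) q J₁ *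
          qPoch (q ^ (J₂ - I₁ - N + 1) * (s ^ 2)⁻¹ * κ⁻¹) q J₁ *
          qPoch (q ^ (J₂ - 2 * I₁ - N) * (s ^ 2)⁻¹ * κ⁻¹) q J₂ *
          qPoch (q ^ (2 * J₂ - 2 * I₁ - N + 1) * (s ^ 2)⁻¹ * κ⁻¹) q (I₁ - J₂))) *
      ∑ k ∈ Finset.range (min j₁ j₂ + 1),
        q ^ k * qPoch a₁ q k / qPoch q q k * ((1 - a₁ * q ^ (2 * k)) / (1 - a₁)) *
          (([q ^ (-J₁), q ^ (-J₂), q ^ (1 - I₁) * (s ^ 2)⁻¹ * κ⁻¹] : List ℂ).map fun a =>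
            qPoch a q k / qPoch (q * a₁ / a) q k).prod *
          (([q ^ (J₁ - N) * κ⁻¹, s * u⁻¹ * q ^ (I₁ - J₂ + 1), u * s * q ^ (I₁ - J₂ + N),
            q ^ (-I₁) * κ⁻¹] : List ℂ).map fun a => qPoch a q k).prod *
          (qPoch (q ^ (I₁ - J₂ + 1 + k)) q (J₂ - k) *
            qPoch (q ^ (N - J₁ - J₂ + 1 + k)) q (J₂ - k) *
            qPoch (u * s⁻¹ * κ⁻¹ * q ^ ((k : ℤ) - I₁)) q (J₂ - k) *
            qPoch (q ^ (1 - I₁ - N + k) * u⁻¹ * s⁻¹ * κ⁻¹) q (J₁ - k))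
  else 0

end DynVertex

end

noncomputable section

namespace DynVertex

/-! ### Scalars -/

/-! Everything is determined by raising operators acting on the vacuum `f_0 ⊗ f_0`; here `f_i` is a
rescaled basis in which the square roots disappear and all coefficients are rational in `q`,
`q^{Λ/2}`, `q^{J/2}`, `z` and `X`.

The `R`-matrix. The generators `e_1` and `f_0` of the quantum affine algebra act by two commuting
raising operators. Combinations of the two, with coefficients depending on `i` or on `j`, send `f_i
⊗ f_j` to a multiple of `f_{i+1} ⊗ f_j` or of `f_i ⊗ f_{j+1}`, and the multiple can vanish only for
`z ∈ q^ℤ`. Hence the vacuum is cyclic (`top_of_stable`), which gives uniqueness and invertibility.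
The corresponding combinations for the opposite coproduct define the images `rvec` of the basis
vectors. These vanish beyond the range because commuting factors may be reversed
(`iterate_eq_zero`). For a lowering operator, the defect of the intertwining relation again
intertwines the raising operators, so it suffices to test it on `f_0 ⊗ f_n` (`lower_of_column`),
whose image is explicit (`rvec_zero_eq`).

The recursion. There is a raising operator `dynRaise`, polynomial in the generators up to scalars of
the level and with a free parameter `w`, that the twist makes two-diagonal: `F(λ) · dynRaise =
dynDiag · F(λ - 2η)` (`twist_dynRaise`). Since `R^D` and the flip permute operators of this kind,
the twisted `R`-matrix satisfies an exchange relation between `λ` and `λ - 2η`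
(`twistedR_exchange`). A suitable `w` kills one of the two coefficients of `dynDiag`. What remains
is a three-term recursion, expressing a column of `S` through an earlier column at `λ - 2η`; the
ground state transformation brings its coefficients into product form (`sCoeff_snd`, `sCoeff_fst`).

The formula. The column `j₂ = 0` is a product and satisfies its recursion by a rational identity
(`baseTerm_threeTerm`). In general the series satisfies the recursion summand by summand: the
summand `k` on one side is combined from the summands `k` and `k - 1` of the two neighbours
(`term_threeTerm`). Induction on `i₂` and then on `j₂` identifies the entries with `termSum`
(`sCoeff_eq`), and regrouping Pochhammer symbols turns `termSum` into `psi` and, under the extra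
assumptions, into `psiLiteral`. -/

/-- `[n]` for an integer `n`, in terms of `q`. -/
def qn (q : ℂ) (n : ℤ) : ℂ := (q ^ n - q ^ (-n)) / (q - q⁻¹)

theorem qpow_add (η a b : ℂ) : qpow η (a + b) = qpow η a * qpow η b := by
  simp only [qpow, ← Complex.exp_add]; ring_nf

theorem qpow_zero (η : ℂ) : qpow η 0 = 1 := by simp [qpow]

theorem qpow_ne_zero (η a : ℂ) : qpow η a ≠ 0 := Complex.exp_ne_zero _

theorem qpow_neg (η a : ℂ) : qpow η (-a) = (qpow η a)⁻¹ := by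
  rw [qpow, qpow, ← Complex.exp_neg]; ring_nf

theorem qpow_int_mul (η : ℂ) (n : ℤ) (a : ℂ) : qpow η (n * a) = qpow η a ^ n := by
  rw [qpow, qpow, ← Complex.exp_int_mul]; ring_nf

theorem qpow_int (η : ℂ) (n : ℤ) : qpow η n = qpow η 1 ^ n := by
  rw [← qpow_int_mul, mul_one]

theorem qpow_nat (η : ℂ) (n : ℕ) : qpow η n = qpow η 1 ^ n := by
  simpa using qpow_int η n

/-- `q` is not a root of unity. -/
def Generic (q : ℂ) : Prop := q ≠ 0 ∧ ∀ n : ℤ, n ≠ 0 → q ^ n ≠ 1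

theorem generic_qpow {η : ℂ} (hq : ∀ n : ℕ, 0 < n → qpow η n ≠ 1) : Generic (qpow η 1) := by
  refine ⟨qpow_ne_zero _ _, fun n hn h => ?_⟩
  have key : ∀ m : ℕ, 0 < m → qpow η 1 ^ m ≠ 1 := fun m hm => by
    rw [← qpow_nat]; exact hq m hm
  rcases Int.natAbs_eq n with h' | h'
  · rw [h', zpow_natCast] at h; exact key _ (Int.natAbs_pos.2 hn) h
  · rw [h', _root_.zpow_neg, zpow_natCast, inv_eq_one] at h; exact key _ (Int.natAbs_pos.2 hn) h

namespace Generic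

variable {q : ℂ}

theorem ne_zero (h : Generic q) : q ≠ 0 := h.1

theorem zpow_ne_one (h : Generic q) {n : ℤ} (hn : n ≠ 0) : q ^ n ≠ 1 := h.2 n hn

theorem sub_inv_ne (h : Generic q) : q - q⁻¹ ≠ 0 := fun h0 => by
  have : q ^ (2 : ℤ) = 1 := by
    have h1 : q = q⁻¹ := sub_eq_zero.1 h0
    rw [zpow_two]; nth_rw 2 [h1]; exact mul_inv_cancel₀ h.1
  exact h.2 2 (by norm_num) this

theorem add_inv_ne (h : Generic q) : q + q⁻¹ ≠ 0 := fun h0 => by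
  have : q ^ (4 : ℤ) = 1 := by
    have h1 : q = -q⁻¹ := eq_neg_of_add_eq_zero_left h0
    have h2 : q * q = -1 := by nth_rw 2 [h1]; rw [mul_neg, mul_inv_cancel₀ h.1]
    calc q ^ (4 : ℤ) = (q * q) * (q * q) := by norm_cast; ring
      _ = 1 := by rw [h2]; norm_num
  exact h.2 4 (by norm_num) this

theorem zpow_sub_ne (h : Generic q) {n : ℤ} (hn : n ≠ 0) : q ^ n - q ^ (-n) ≠ 0 := fun h0 => by
  have h1 : q ^ n = q ^ (-n) := sub_eq_zero.1 h0
  have : q ^ (n + n) = 1 := by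
    rw [zpow_add₀ h.1]; nth_rw 2 [h1]; rw [← zpow_add₀ h.1, add_neg_cancel, zpow_zero]
  exact h.2 (n + n) (by omega) this

theorem qn_ne_zero (h : Generic q) {n : ℤ} (hn : n ≠ 0) : qn q n ≠ 0 :=
  div_ne_zero (h.zpow_sub_ne hn) h.sub_inv_ne

end Generic

@[simp] theorem qn_zero (q : ℂ) : qn q 0 = 0 := by simp [qn]

theorem qint_eq (η : ℂ) (n : ℕ) : qint η n = qn (qpow η 1) n := by
  rw [qint, qn, qpow_neg, qpow_neg, qpow_nat, zpow_natCast, _root_.zpow_neg, zpow_natCast]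

/-- The only property of the square roots that is used, non-vanishing being a consequence of it. The
choice of branch is therefore immaterial. -/
theorem qintSqrt_mul_self (η : ℂ) (n : ℕ) : qintSqrt η n * qintSqrt η n = qn (qpow η 1) n := by
  rw [← qint_eq, qintSqrt, ← sq, ← Complex.cpow_nat_mul]
  norm_num

theorem qintSqrt_ne_zero {η : ℂ} (h : Generic (qpow η 1)) {n : ℕ} (hn : n ≠ 0) :
    qintSqrt η n ≠ 0 := fun h0 => by
  have := qintSqrt_mul_self η n
  rw [h0, mul_zero] at this
  exact h.qn_ne_zero (by exact_mod_cast hn) this.symm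

theorem qfactSqrt_succ (η : ℂ) (n : ℕ) :
    qfactSqrt η (n + 1) = qfactSqrt η n * qintSqrt η (n + 1) := by
  simp [qfactSqrt, Finset.prod_range_succ]

theorem qfactSqrt_ne_zero {η : ℂ} (h : Generic (qpow η 1)) (n : ℕ) : qfactSqrt η n ≠ 0 :=
  Finset.prod_ne_zero_iff.2 fun _ _ => qintSqrt_ne_zero h (Nat.succ_ne_zero _)

/-! ### A rescaled basis of `V^L`, indexed by the integers -/

/-- `|n⟩` is rescaled by `√[L]! / (√[L-n]! √[n]!)`. -/
def basisScale (η : ℂ) (L n : ℕ) : ℂ := qfactSqrt η L / (qfactSqrt η (L - n) * qfactSqrt η n)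

theorem basisScale_ne_zero {η : ℂ} (h : Generic (qpow η 1)) (L n : ℕ) : basisScale η L n ≠ 0 :=
  div_ne_zero (qfactSqrt_ne_zero h _) (mul_ne_zero (qfactSqrt_ne_zero h _) (qfactSqrt_ne_zero h _))

/-- The rescaled basis vector `f_i` of `V^L`, zero unless `0 ≤ i ≤ L`. -/
def ket (η : ℂ) (L : ℕ) (i : ℤ) : Fin (L + 1) → ℂ :=
  fun p => if ((p : ℕ) : ℤ) = i then basisScale η L p else 0

theorem ket_nat (η : ℂ) (L : ℕ) (i : Fin (L + 1)) :
    ket η L ((i : ℕ) : ℤ) = basisScale η L i • Pi.single i 1 := by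
  ext p
  by_cases hp : p = i
  · subst hp; simp [ket]
  · have : (p : ℕ) ≠ i := fun h => hp (Fin.ext h)
    simp [ket, hp, this]

theorem ket_eq_zero (η : ℂ) (L : ℕ) {i : ℤ} (hi : i < 0 ∨ (L : ℤ) < i) : ket η L i = 0 := by
  ext p
  have := p.2
  simp only [ket, Pi.zero_apply, ite_eq_right_iff]
  intro h; omega

theorem mulVec_ket {η : ℂ} {L : ℕ} (M : Matrix (Fin (L + 1)) (Fin (L + 1)) ℂ)
    (i p : Fin (L + 1)) :
    (M *ᵥ ket η L ((i : ℕ) : ℤ)) p = basisScale η L i * M p i := by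
  rw [ket_nat, mulVec_smul, mulVec_single_one]; simp

/-- The rescaling pairs each square root with its twin. The formula holds for every integer index:
the coefficient `[0]` or a vanishing vector takes care of both ends of the range, so later
computations need no boundary cases. -/
theorem raising_ket {η : ℂ} (h : Generic (qpow η 1)) (L : ℕ) (i : ℤ) :
    raising η L *ᵥ ket η L i = qn (qpow η 1) (i + 1) • ket η L (i + 1) := by
  by_cases hi : 0 ≤ i ∧ i ≤ L
  · obtain ⟨n, rfl⟩ := Int.eq_ofNat_of_zero_le hi.1
    have hn : n < L + 1 := by omega
    ext p
    have := mulVec_ket (η := η) (raising η L) ⟨n, hn⟩ p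
    simp only at this
    rw [this]
    simp only [raising, of_apply, Pi.smul_apply, smul_eq_mul, ket]
    by_cases hp : (p : ℕ) = n + 1
    · rw [if_pos hp, if_pos (by exact_mod_cast hp), hp]
      have hL : L - n = (L - (n + 1)) + 1 := by have := p.2; omega
      rw [basisScale, basisScale, hL, qfactSqrt_succ, qfactSqrt_succ]
      have e := qintSqrt_mul_self η (n + 1)
      push_cast at e
      rw [← e]
      have h1 := qfactSqrt_ne_zero h (L - (n + 1))
      have h2 := qfactSqrt_ne_zero h n
      have h3 := qintSqrt_ne_zero h (Nat.succ_ne_zero (L - (n + 1)))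
      have h4 := qintSqrt_ne_zero h (Nat.succ_ne_zero n)
      field_simp
    · rw [if_neg hp, if_neg (by exact_mod_cast hp)]; simp
  · rw [ket_eq_zero η L (by omega), mulVec_zero]
    -- This is the only index outside the range whose successor lies inside; there the coefficient
    -- is `[0] = 0`.
    by_cases h1 : i = -1
    · subst h1; simp
    · rw [ket_eq_zero η L (by omega), smul_zero]

theorem lowering_ket {η : ℂ} (h : Generic (qpow η 1)) (L : ℕ) (i : ℤ) :
    lowering η L *ᵥ ket η L i = qn (qpow η 1) (L - i + 1) • ket η L (i - 1) := by
  by_cases hi : 0 ≤ i ∧ i ≤ L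
  · obtain ⟨n, rfl⟩ := Int.eq_ofNat_of_zero_le hi.1
    have hn : n < L + 1 := by omega
    ext p
    have := mulVec_ket (η := η) (lowering η L) ⟨n, hn⟩ p
    simp only at this
    rw [this]
    simp only [lowering, of_apply, Pi.smul_apply, smul_eq_mul, ket]
    by_cases hp : n = (p : ℕ) + 1
    · rw [if_pos hp, if_pos (by subst hp; push_cast; ring)]
      have hL : L - p = (L - n) + 1 := by have := p.2; omega
      rw [basisScale, basisScale, hL, hp, qfactSqrt_succ, qfactSqrt_succ]
      have e := qintSqrt_mul_self η (L - n + 1)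
      have e' : (((L - n + 1 : ℕ)) : ℤ) = L - (((p : ℕ) + 1 : ℕ) : ℤ) + 1 := by omega
      rw [e'] at e
      simp only [hp] at e
      rw [← e]
      have h1 := qfactSqrt_ne_zero h (L - ((p : ℕ) + 1))
      have h2 := qfactSqrt_ne_zero h p
      have h3 := qintSqrt_ne_zero h (Nat.succ_ne_zero (L - ((p : ℕ) + 1)))
      have h4 := qintSqrt_ne_zero h (Nat.succ_ne_zero (p : ℕ))
      field_simp
    · rw [if_neg hp, if_neg (by intro h'; apply hp; omega)]; simp
  · rw [ket_eq_zero η L (by omega), mulVec_zero]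
    by_cases h1 : i = L + 1
    · subst h1; simp
    · rw [ket_eq_zero η L (by omega), smul_zero]

theorem qH_ket (η : ℂ) (L : ℕ) (c : ℂ) (i : ℤ) :
    qH η L c *ᵥ ket η L i = qpow η (c * (2 * i - L)) • ket η L i := by
  ext p
  simp only [qH, mulVec_diagonal, Pi.smul_apply, smul_eq_mul, ket, weight]
  split_ifs with h
  · rw [← h]; push_cast; rfl
  · simp

/-! ### The tensor product basis and the generators in it -/

/-- `q ^ (L / 2)`. -/
def qhalf (η : ℂ) (L : ℕ) : ℂ := qpow η ((L : ℂ) / 2)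

theorem qhalf_ne_zero (η : ℂ) (L : ℕ) : qhalf η L ≠ 0 := qpow_ne_zero _ _

theorem qhalf_sq (η : ℂ) (L : ℕ) : qhalf η L ^ 2 = qpow η 1 ^ (L : ℤ) := by
  rw [sq, qhalf, ← qpow_add, ← qpow_int]; congr 1; push_cast; ring

/-- Half-integral powers of `q` enter only through `q^{L/2}` and `q^{J/2}`. With these two as
separate letters, identities between operators become rational identities. -/
theorem qpow_half_pos (η : ℂ) (L : ℕ) (i : ℤ) :
    qpow η (1 / 2 * (2 * i - L)) = qpow η 1 ^ i * (qhalf η L)⁻¹ := by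
  rw [qhalf, ← qpow_neg, ← qpow_int, ← qpow_add]; congr 1; ring

theorem qpow_half_neg (η : ℂ) (L : ℕ) (i : ℤ) :
    qpow η (-1 / 2 * (2 * i - L)) = (qpow η 1 ^ i)⁻¹ * qhalf η L := by
  rw [qhalf, ← qpow_int, ← qpow_neg, ← qpow_add]; congr 1; ring

/-- The space `V^L ⊗ V^J`. -/
abbrev Tens (L J : ℕ) := Fin (L + 1) × Fin (J + 1) → ℂ

/-- Operators on `V^L ⊗ V^J`. -/
abbrev TMat (L J : ℕ) := Matrix (Fin (L + 1) × Fin (J + 1)) (Fin (L + 1) × Fin (J + 1)) ℂ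

/-- The basis vector `f_i ⊗ f_j`. -/
def tket (η : ℂ) (L J : ℕ) (i j : ℤ) : Tens L J := fun p => ket η L i p.1 * ket η J j p.2

theorem tket_eq_zero (η : ℂ) (L J : ℕ) {i j : ℤ}
    (h : i < 0 ∨ (L : ℤ) < i ∨ j < 0 ∨ (J : ℤ) < j) : tket η L J i j = 0 := by
  ext p
  rcases h with h | h | h | h
  · simp [tket, ket_eq_zero η L (Or.inl h)]
  · simp [tket, ket_eq_zero η L (Or.inr h)]
  · simp [tket, ket_eq_zero η J (Or.inl h)]
  · simp [tket, ket_eq_zero η J (Or.inr h)]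

theorem kronecker_mulVec {m n : Type*} [Fintype m] [Fintype n]
    (A : Matrix m m ℂ) (B : Matrix n n ℂ) (v : m → ℂ) (w : n → ℂ) :
    ((A ⊗ₖ B) *ᵥ fun p : m × n => v p.1 * w p.2) = fun p => (A *ᵥ v) p.1 * (B *ᵥ w) p.2 := by
  ext p
  simp only [mulVec, dotProduct, Fintype.sum_prod_type, kroneckerMap_apply]
  rw [Finset.sum_mul_sum]
  exact Finset.sum_congr rfl fun _ _ => Finset.sum_congr rfl fun _ _ => by ring

theorem kronecker_tket {η : ℂ} {L J : ℕ} {A : Matrix (Fin (L + 1)) (Fin (L + 1)) ℂ}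
    {B : Matrix (Fin (J + 1)) (Fin (J + 1)) ℂ} {i j i' j' : ℤ} {x y : ℂ}
    (hA : A *ᵥ ket η L i = x • ket η L i') (hB : B *ᵥ ket η J j = y • ket η J j') :
    (A ⊗ₖ B) *ᵥ tket η L J i j = (x * y) • tket η L J i' j' := by
  have : tket η L J i j = fun p : Fin (L + 1) × Fin (J + 1) => ket η L i p.1 * ket η J j p.2 := rfl
  rw [this, kronecker_mulVec, hA, hB]
  ext p
  simp only [Pi.smul_apply, smul_eq_mul, tket]; ring

theorem skewSum_tket {η : ℂ} {L J : ℕ} {c : ℂ} {A : Matrix (Fin (L + 1)) (Fin (L + 1)) ℂ}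
    {B : Matrix (Fin (J + 1)) (Fin (J + 1)) ℂ} {i j i' j' : ℤ} {x y : ℂ}
    (hA : A *ᵥ ket η L i = x • ket η L i') (hB : B *ᵥ ket η J j = y • ket η J j') :
    skewSum η L J c A B *ᵥ tket η L J i j =
      (x * qpow η (c * (2 * j - J))) • tket η L J i' j +
        (qpow η (-c * (2 * i - L)) * y) • tket η L J i j' := by
  rw [skewSum, add_mulVec, kronecker_tket hA (qH_ket η J c j), kronecker_tket (qH_ket η L (-c) i) hB]

/-- Raising operators with `q ^ (H/2)`: for `z = 1` this is `Δ(e_1)`, for `z⁻¹` it is `Δ'(f_0)`. -/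
def raisePos (η : ℂ) (L J : ℕ) (z : ℂ) : TMat L J :=
  skewSum η L J (1 / 2) (z • raising η L) (raising η J)

/-- For `z = 1` this is `Δ'(e_1)`, and for `z⁻¹` it is `Δ(f_0)`. -/
def raiseNeg (η : ℂ) (L J : ℕ) (z : ℂ) : TMat L J :=
  skewSum η L J (-1 / 2) (z • raising η L) (raising η J)

/-- For parameter `1` this is `Δ(f_1)`, and for parameter `z` it is `Δ'(e_0)`. In `lowerNeg` the
roles of `Δ` and `Δ'` are exchanged. -/
def lowerPos (η : ℂ) (L J : ℕ) (z : ℂ) : TMat L J :=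
  skewSum η L J (1 / 2) (z • lowering η L) (lowering η J)

def lowerNeg (η : ℂ) (L J : ℕ) (z : ℂ) : TMat L J :=
  skewSum η L J (-1 / 2) (z • lowering η L) (lowering η J)

section Action

variable {η : ℂ} (h : Generic (qpow η 1)) (L J : ℕ) (z : ℂ) (i j : ℤ)

theorem smul_raising_ket (h : Generic (qpow η 1)) : (z • raising η L) *ᵥ ket η L i =
    (z * qn (qpow η 1) (i + 1)) • ket η L (i + 1) := by
  rw [smul_mulVec, raising_ket h, smul_smul]

theorem smul_lowering_ket (h : Generic (qpow η 1)) : (z • lowering η L) *ᵥ ket η L i =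
    (z * qn (qpow η 1) (L - i + 1)) • ket η L (i - 1) := by
  rw [smul_mulVec, lowering_ket h, smul_smul]

theorem raisePos_tket (h : Generic (qpow η 1)) : raisePos η L J z *ᵥ tket η L J i j =
    (z * qn (qpow η 1) (i + 1) * (qpow η 1 ^ j * (qhalf η J)⁻¹)) • tket η L J (i + 1) j +
      (qn (qpow η 1) (j + 1) * ((qpow η 1 ^ i)⁻¹ * qhalf η L)) • tket η L J i (j + 1) := by
  rw [raisePos, skewSum_tket (smul_raising_ket L z i h) (raising_ket h J j), qpow_half_pos,
    ← neg_div, qpow_half_neg, mul_comm (qn _ (j + 1))]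

theorem raiseNeg_tket (h : Generic (qpow η 1)) : raiseNeg η L J z *ᵥ tket η L J i j =
    (z * qn (qpow η 1) (i + 1) * ((qpow η 1 ^ j)⁻¹ * qhalf η J)) • tket η L J (i + 1) j +
      (qn (qpow η 1) (j + 1) * (qpow η 1 ^ i * (qhalf η L)⁻¹)) • tket η L J i (j + 1) := by
  rw [raiseNeg, skewSum_tket (smul_raising_ket L z i h) (raising_ket h J j), qpow_half_neg,
    ← neg_div, neg_neg, qpow_half_pos, mul_comm (qn _ (j + 1))]

theorem lowerPos_tket (h : Generic (qpow η 1)) : lowerPos η L J z *ᵥ tket η L J i j =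
    (z * qn (qpow η 1) (L - i + 1) * (qpow η 1 ^ j * (qhalf η J)⁻¹)) • tket η L J (i - 1) j +
      (qn (qpow η 1) (J - j + 1) * ((qpow η 1 ^ i)⁻¹ * qhalf η L)) • tket η L J i (j - 1) := by
  rw [lowerPos, skewSum_tket (smul_lowering_ket L z i h) (lowering_ket h J j), qpow_half_pos,
    ← neg_div, qpow_half_neg, mul_comm (qn _ (J - j + 1))]

theorem lowerNeg_tket (h : Generic (qpow η 1)) : lowerNeg η L J z *ᵥ tket η L J i j =
    (z * qn (qpow η 1) (L - i + 1) * ((qpow η 1 ^ j)⁻¹ * qhalf η J)) • tket η L J (i - 1) j +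
      (qn (qpow η 1) (J - j + 1) * (qpow η 1 ^ i * (qhalf η L)⁻¹)) • tket η L J i (j - 1) := by
  rw [lowerNeg, skewSum_tket (smul_lowering_ket L z i h) (lowering_ket h J j), qpow_half_neg,
    ← neg_div, neg_neg, qpow_half_pos, mul_comm (qn _ (J - j + 1))]

end Action

theorem tket_nat (η : ℂ) {L J : ℕ} (p : Fin (L + 1) × Fin (J + 1)) :
    tket η L J ((p.1 : ℕ) : ℤ) ((p.2 : ℕ) : ℤ) =
      (basisScale η L p.1 * basisScale η J p.2) • Pi.single p 1 := by
  ext r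
  rw [tket, ket_nat, ket_nat]
  by_cases h1 : r.1 = p.1
  · by_cases h2 : r.2 = p.2
    · rw [show r = p from Prod.ext h1 h2]; simp
    · have : r ≠ p := fun e => h2 (by rw [e])
      simp [this, h2]
  · have : r ≠ p := fun e => h1 (by rw [e])
    simp [this, h1]

theorem tmat_ext {η : ℂ} (h : Generic (qpow η 1)) {L J : ℕ} {M N : TMat L J}
    (H : ∀ i j : ℕ, i ≤ L → j ≤ J → M *ᵥ tket η L J i j = N *ᵥ tket η L J i j) : M = N := by
  ext p r
  have := congrFun (H r.1 r.2 (Nat.lt_succ_iff.1 r.1.2) (Nat.lt_succ_iff.1 r.2.2)) p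
  rw [tket_nat, mulVec_smul, mulVec_smul, mulVec_single_one, mulVec_single_one] at this
  exact mul_left_cancel₀ (mul_ne_zero (basisScale_ne_zero h L r.1) (basisScale_ne_zero h J r.2)) this

/-- The operator with prescribed values on the basis. -/
def ofCols (η : ℂ) (L J : ℕ) (w : ℕ → ℕ → Tens L J) : TMat L J :=
  Matrix.of fun p r => w r.1 r.2 p / (basisScale η L r.1 * basisScale η J r.2)

theorem ofCols_tket {η : ℂ} (h : Generic (qpow η 1)) {L J : ℕ} (w : ℕ → ℕ → Tens L J) {i j : ℕ}
    (hi : i ≤ L) (hj : j ≤ J) : ofCols η L J w *ᵥ tket η L J i j = w i j := by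
  have := tket_nat η (L := L) (J := J) (⟨i, Nat.lt_succ_of_le hi⟩, ⟨j, Nat.lt_succ_of_le hj⟩)
  simp only at this
  rw [this, mulVec_smul, mulVec_single_one]
  ext p
  simp only [Pi.smul_apply, col_apply, ofCols, of_apply, smul_eq_mul]
  exact mul_div_cancel₀ _ (mul_ne_zero (basisScale_ne_zero h L i) (basisScale_ne_zero h J j))

/-- The operator acting by the scalar `g n` on the vectors of level `n`. -/
def lev (L J : ℕ) (g : ℤ → ℂ) : TMat L J :=
  Matrix.diagonal fun p => g (((p.1 : ℕ) : ℤ) + ((p.2 : ℕ) : ℤ))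

theorem lev_tket (η : ℂ) (L J : ℕ) (g : ℤ → ℂ) (i j : ℤ) :
    lev L J g *ᵥ tket η L J i j = g (i + j) • tket η L J i j := by
  ext p
  simp only [lev, mulVec_diagonal, Pi.smul_apply, smul_eq_mul, tket, ket]
  split_ifs with h1 h2
  · rw [h1, h2]
  all_goals simp

/-! ### Construction of the spectral `R`-matrix -/

theorem Generic.sq_sub_one_ne {q : ℂ} (h : Generic q) : q ^ 2 - 1 ≠ 0 := fun h0 =>
  h.2 2 (by norm_num) (by exact_mod_cast sub_eq_zero.1 h0)

theorem qn_eq {q : ℂ} (n : ℤ) : qn q n = (q ^ n - (q ^ n)⁻¹) / (q - q⁻¹) := by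
  rw [qn, _root_.zpow_neg]

/-- This is `[e_1, f_0] = 0`. It holds for independent `z` and `w` because the powers of `q` from
moving `q^{±H/2}` past `E_+` in the two tensor factors cancel. -/
theorem raise_comm {η : ℂ} (h : Generic (qpow η 1)) (L J : ℕ) (z w : ℂ) :
    Commute (raisePos η L J z) (raiseNeg η L J w) := by
  refine tmat_ext h fun i j _ _ => ?_
  rw [← mulVec_mulVec, ← mulVec_mulVec, raisePos_tket _ _ _ _ _ h, raiseNeg_tket _ _ _ _ _ h]
  simp only [mulVec_add, mulVec_smul, raisePos_tket _ _ _ _ _ h, raiseNeg_tket _ _ _ _ _ h,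
    zpow_add₀ h.ne_zero, zpow_one]
  have h0 := h.ne_zero
  have ha := qhalf_ne_zero η L
  have hb := qhalf_ne_zero η J
  match_scalars <;> (field_simp; try ring)

section Construction

variable (η : ℂ) (L J : ℕ) (z : ℂ)

/-- On the image of `f_i ⊗ f_j` this operator is a multiple of the image of `f_{i+1} ⊗ f_j`. -/
def stepFst (i : ℤ) : TMat L J :=
  (qpow η 1 ^ i * (qhalf η L)⁻¹) • raiseNeg η L J 1 -
    ((qpow η 1 ^ i)⁻¹ * qhalf η L) • raisePos η L J z⁻¹

def stepSnd (j : ℤ) : TMat L J :=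
  (qpow η 1 ^ j * (qhalf η J)⁻¹) • raisePos η L J z⁻¹ -
    (z⁻¹ * (qpow η 1 ^ j)⁻¹ * qhalf η J) • raiseNeg η L J 1

/-- The same combination as `stepFst` with `i` replaced by `L - i`. It moves along the basis `f_i ⊗
f_j` itself, whereas `stepFst` moves along the images under the `R`-matrix. -/
def stepFst' (i : ℤ) : TMat L J :=
  ((qpow η 1 ^ i)⁻¹ * qhalf η L) • raiseNeg η L J 1 -
    (qpow η 1 ^ i * (qhalf η L)⁻¹) • raisePos η L J z⁻¹

def stepSnd' (j : ℤ) : TMat L J :=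
  ((qpow η 1 ^ j)⁻¹ * qhalf η J) • raisePos η L J z⁻¹ -
    (z⁻¹ * qpow η 1 ^ j * (qhalf η J)⁻¹) • raiseNeg η L J 1

/-- The part of the step scalar that depends on the level `n = i + j`. It is also the determinant of
the pair `stepFst i`, `stepSnd j` in terms of the two raising operators. -/
def delta (n : ℤ) : ℂ :=
  qpow η 1 ^ n * (qhalf η L * qhalf η J)⁻¹ - z⁻¹ * (qpow η 1 ^ n)⁻¹ * (qhalf η L * qhalf η J)

def delta' (n : ℤ) : ℂ :=
  (qpow η 1 ^ n)⁻¹ * (qhalf η L * qhalf η J) - z⁻¹ * qpow η 1 ^ n * (qhalf η L * qhalf η J)⁻¹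

/-- The image of `f_i ⊗ f_j` under the spectral `R`-matrix. -/
def rvec : ℕ → ℕ → Tens L J
  | 0, 0 => tket η L J 0 0
  | 0, j + 1 => (qn (qpow η 1) (j + 1) * delta η L J z j)⁻¹ • (stepSnd η L J z j *ᵥ rvec 0 j)
  | i + 1, j =>
    (qn (qpow η 1) (i + 1) * delta η L J z (i + j))⁻¹ • (stepFst η L J z i *ᵥ rvec i j)

/-- The spectral `R`-matrix. -/
def spectralR : TMat L J := ofCols η L J (rvec η L J z)

end Construction

/-! ### Images of the basis vectors and the intertwining of the raising operators. -/

section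

variable {η : ℂ} {L J : ℕ} {z : ℂ}

theorem delta_ne_zero (h : Generic (qpow η 1)) (hz0 : z ≠ 0) (hz : ∀ k : ℤ, z ≠ qpow η 1 ^ k)
    (n : ℤ) : delta η L J z n ≠ 0 := fun h0 => by
  have h1 := h.ne_zero
  have ha := qhalf_ne_zero η L
  have hb := qhalf_ne_zero η J
  have hn : qpow η 1 ^ n ≠ 0 := zpow_ne_zero _ h1
  -- The vanishing of `delta n` would mean `z = q^{L+J-2n}`.
  apply hz (L + J - 2 * n)
  rw [zpow_sub₀ h1, zpow_add₀ h1, ← qhalf_sq, ← qhalf_sq, two_mul, zpow_add₀ h1]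
  rw [delta] at h0
  field_simp at h0 ⊢
  linear_combination h0

theorem delta'_ne_zero (h : Generic (qpow η 1)) (hz0 : z ≠ 0) (hz : ∀ k : ℤ, z ≠ qpow η 1 ^ k)
    (n : ℤ) : delta' η L J z n ≠ 0 := fun h0 => by
  have h1 := h.ne_zero
  have ha := qhalf_ne_zero η L
  have hb := qhalf_ne_zero η J
  have hn : qpow η 1 ^ n ≠ 0 := zpow_ne_zero _ h1
  apply hz (2 * n - (L + J))
  rw [zpow_sub₀ h1, zpow_add₀ h1, ← qhalf_sq, ← qhalf_sq, two_mul, zpow_add₀ h1]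
  rw [delta'] at h0
  field_simp at h0 ⊢
  linear_combination h0

/-- All step operators lie in the commutative algebra generated by the two raising operators. -/
theorem step_comm (h : Generic (qpow η 1)) (s t u v : ℂ) :
    Commute (s • raiseNeg η L J 1 - t • raisePos η L J z⁻¹)
      (u • raiseNeg η L J 1 - v • raisePos η L J z⁻¹) := by
  have c := raise_comm h L J z⁻¹ 1
  refine Commute.sub_left (Commute.smul_left ?_ _) (Commute.smul_left ?_ _) <;>
    refine Commute.sub_right (Commute.smul_right ?_ _) (Commute.smul_right ?_ _)
  exacts [Commute.refl _, c.symm, c, Commute.refl _]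

theorem stepSnd_eq_neg (j : ℤ) : stepSnd η L J z j =
    -((z⁻¹ * (qpow η 1 ^ j)⁻¹ * qhalf η J) • raiseNeg η L J 1 -
      (qpow η 1 ^ j * (qhalf η J)⁻¹) • raisePos η L J z⁻¹) := by
  rw [stepSnd, neg_sub]

theorem stepSnd'_eq_neg (j : ℤ) : stepSnd' η L J z j =
    -((z⁻¹ * qpow η 1 ^ j * (qhalf η J)⁻¹) • raiseNeg η L J 1 -
      ((qpow η 1 ^ j)⁻¹ * qhalf η J) • raisePos η L J z⁻¹) := by
  rw [stepSnd', neg_sub]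

theorem stepFst_comm_stepSnd (h : Generic (qpow η 1)) (i j : ℤ) :
    Commute (stepFst η L J z i) (stepSnd η L J z j) := by
  rw [stepSnd_eq_neg]; exact (step_comm h _ _ _ _).neg_right

/-- The coefficients of the combination are chosen so that the component at `f_i ⊗ f_{j+1}` cancels.
-/
theorem stepFst'_tket (h : Generic (qpow η 1)) (i j : ℤ) :
    stepFst' η L J z i *ᵥ tket η L J i j =
      (qn (qpow η 1) (i + 1) * delta' η L J z (i + j)) • tket η L J (i + 1) j := by
  simp only [stepFst', sub_mulVec, smul_mulVec, raisePos_tket _ _ _ _ _ h,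
    raiseNeg_tket _ _ _ _ _ h, delta', zpow_add₀ h.ne_zero]
  have h0 := h.ne_zero
  have ha := qhalf_ne_zero η L
  have hb := qhalf_ne_zero η J
  match_scalars <;> (field_simp; try ring)

theorem stepSnd'_tket (h : Generic (qpow η 1)) (hz0 : z ≠ 0) (i j : ℤ) :
    stepSnd' η L J z j *ᵥ tket η L J i j =
      (qn (qpow η 1) (j + 1) * delta' η L J z (i + j)) • tket η L J i (j + 1) := by
  simp only [stepSnd', sub_mulVec, smul_mulVec, raisePos_tket _ _ _ _ _ h,
    raiseNeg_tket _ _ _ _ _ h, delta', zpow_add₀ h.ne_zero]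
  have h0 := h.ne_zero
  have ha := qhalf_ne_zero η L
  have hb := qhalf_ne_zero η J
  match_scalars <;> (field_simp; try ring)

/-- Reversing the order of the factors in a product of commuting operators. -/
theorem iterate_eq_zero (N : ℕ) (u u' : ℕ → TMat L J) (hc : ∀ m n, Commute (u' m) (u' n))
    (hu : ∀ k ≤ N, u k = u' (N - k)) (v w : ℕ → Tens L J) (c d : ℕ → ℂ)
    (hv : ∀ k, u' k *ᵥ v k = c k • v (k + 1)) (hN : v (N + 1) = 0) (h0 : w 0 = v 0)
    (hw : ∀ k, w (k + 1) = d k • (u k *ᵥ w k)) : w (N + 1) = 0 := by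
  have key : ∀ n, ∃ x : ℂ, ((List.range n).map u').reverse.prod *ᵥ v 0 = x • v n := by
    intro n
    induction n with
    | zero => exact ⟨1, by simp⟩
    | succ n ih =>
      obtain ⟨x, hx⟩ := ih
      refine ⟨x * c n, ?_⟩
      rw [List.range_succ, List.map_append, List.reverse_append, List.prod_append]
      simp only [List.map_cons, List.map_nil, List.reverse_cons, List.reverse_nil, List.nil_append,
        List.prod_cons, List.prod_nil, mul_one]
      rw [← mulVec_mulVec, hx, mulVec_smul, hv, smul_smul]
  have key2 : ∀ n, ∃ x : ℂ, w n = x • (((List.range n).map u).reverse.prod *ᵥ v 0) := by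
    intro n
    induction n with
    | zero => exact ⟨1, by simp [h0]⟩
    | succ n ih =>
      obtain ⟨x, hx⟩ := ih
      refine ⟨d n * x, ?_⟩
      rw [List.range_succ, List.map_append, List.reverse_append, List.prod_append]
      simp only [List.map_cons, List.map_nil, List.reverse_cons, List.reverse_nil, List.nil_append,
        List.prod_cons, List.prod_nil, mul_one]
      rw [← mulVec_mulVec, hw, hx, mulVec_smul, smul_smul]
  -- The product of the `u k` is the product of the `u' k` in the opposite order; by commutativity
  -- the two agree, and the latter carries `v 0` to a multiple of `v (N + 1) = 0`.
  obtain ⟨x, hx⟩ := key2 (N + 1)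
  obtain ⟨y, hy⟩ := key (N + 1)
  have hl : (List.range (N + 1)).map u = ((List.range (N + 1)).map u').reverse := by
    apply List.ext_getElem (by simp)
    intro k h1 h2
    simp only [List.length_map, List.length_range] at h1
    simp only [List.getElem_map, List.getElem_range, List.getElem_reverse, List.length_map,
      List.length_range]
    rw [hu k (by omega)]; congr 1
  have hp : ((List.range (N + 1)).map u').Pairwise Commute := by
    rw [List.pairwise_map]
    exact List.Pairwise.imp (R := fun _ _ => True) (fun _ => hc _ _)
      (List.pairwise_of_forall fun _ _ => trivial)
  rw [hx, hl, List.reverse_reverse, ((List.reverse_perm _).symm).prod_eq' hp, hy, hN]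
  simp

theorem rvec_succ (i j : ℕ) : rvec η L J z (i + 1) j =
    (qn (qpow η 1) (i + 1) * delta η L J z (i + j))⁻¹ • (stepFst η L J z i *ᵥ rvec η L J z i j) := by
  rw [rvec]

theorem rvec_zero_succ (j : ℕ) : rvec η L J z 0 (j + 1) =
    (qn (qpow η 1) (j + 1) * delta η L J z j)⁻¹ • (stepSnd η L J z j *ᵥ rvec η L J z 0 j) := by
  rw [rvec]

theorem stepFst_rvec (h : Generic (qpow η 1)) (hz0 : z ≠ 0) (hz : ∀ k : ℤ, z ≠ qpow η 1 ^ k)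
    (i j : ℕ) : stepFst η L J z i *ᵥ rvec η L J z i j =
      (qn (qpow η 1) (i + 1) * delta η L J z (i + j)) • rvec η L J z (i + 1) j := by
  rw [rvec_succ, smul_inv_smul₀]
  exact mul_ne_zero (h.qn_ne_zero (by omega)) (delta_ne_zero h hz0 hz _)

/-- The definition of `rvec` moves in the second index only at `i = 0`. Commuting `stepSnd` past
`stepFst` extends this to all `i`, and the scalars match because `delta` depends on the level alone.
-/
theorem stepSnd_rvec (h : Generic (qpow η 1)) (hz0 : z ≠ 0) (hz : ∀ k : ℤ, z ≠ qpow η 1 ^ k)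
    (i j : ℕ) : stepSnd η L J z j *ᵥ rvec η L J z i j =
      (qn (qpow η 1) (j + 1) * delta η L J z (i + j)) • rvec η L J z i (j + 1) := by
  induction i with
  | zero =>
    rw [rvec_zero_succ, Nat.cast_zero, zero_add, smul_inv_smul₀]
    exact mul_ne_zero (h.qn_ne_zero (by omega)) (delta_ne_zero h hz0 hz _)
  | succ i ih =>
    have d1 : delta η L J z (i + j) ≠ 0 := delta_ne_zero h hz0 hz _
    have d2 : qn (qpow η 1) (i + 1) ≠ 0 := h.qn_ne_zero (by omega)
    rw [rvec_succ, mulVec_smul, mulVec_mulVec, ← (stepFst_comm_stepSnd h _ _).eq,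
      ← mulVec_mulVec, ih, mulVec_smul, stepFst_rvec h hz0 hz, smul_smul, smul_smul]
    congr 1
    push_cast
    rw [show (i : ℤ) + (j + 1) = i + 1 + j by ring]
    field_simp

/-- The two step relations form a linear system for the raising operators on `rvec i j` with
determinant `delta (i + j) ≠ 0`. Its solution has the same coefficients as `Δ(e_1)` and `Δ(f_0)`
have on `f_i ⊗ f_j`. -/
theorem raise_rvec (h : Generic (qpow η 1)) (hz0 : z ≠ 0) (hz : ∀ k : ℤ, z ≠ qpow η 1 ^ k)
    (i j : ℕ) :
    raiseNeg η L J 1 *ᵥ rvec η L J z i j =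
      (1 * qn (qpow η 1) (i + 1) * (qpow η 1 ^ (j : ℤ) * (qhalf η J)⁻¹)) • rvec η L J z (i + 1) j +
      (qn (qpow η 1) (j + 1) * ((qpow η 1 ^ (i : ℤ))⁻¹ * qhalf η L)) • rvec η L J z i (j + 1) ∧
    raisePos η L J z⁻¹ *ᵥ rvec η L J z i j =
      (z⁻¹ * qn (qpow η 1) (i + 1) * ((qpow η 1 ^ (j : ℤ))⁻¹ * qhalf η J)) •
        rvec η L J z (i + 1) j +
      (qn (qpow η 1) (j + 1) * (qpow η 1 ^ (i : ℤ) * (qhalf η L)⁻¹)) • rvec η L J z i (j + 1) := by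
  have e1 := stepFst_rvec (L := L) (J := J) h hz0 hz i j
  have e2 := stepSnd_rvec (L := L) (J := J) h hz0 hz i j
  have hd := delta_ne_zero (L := L) (J := J) h hz0 hz (i + j)
  have h0 := h.ne_zero
  have ha := qhalf_ne_zero η L
  have hb := qhalf_ne_zero η J
  simp only [stepFst, stepSnd, sub_mulVec, smul_mulVec] at e1 e2
  constructor
  · apply smul_right_injective (Tens L J) hd
    simp only
    rw [smul_add, smul_smul, smul_smul]
    have : ∀ x y : ℂ, delta η L J z (i + j) * (1 * qn (qpow η 1) (i + 1) * x) =
      x * (qn (qpow η 1) (i + 1) * delta η L J z (i + j)) ∧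
      delta η L J z (i + j) * (qn (qpow η 1) (j + 1) * y) =
      y * (qn (qpow η 1) (j + 1) * delta η L J z (i + j)) := fun x y => ⟨by ring, by ring⟩
    rw [(this _ 0).1, (this 0 _).2, mul_smul, mul_smul _ (qn _ (j + 1) * _), ← e1, ← e2]
    simp only [delta, zpow_add₀ h0]
    match_scalars <;> (field_simp; try ring)
  · apply smul_right_injective (Tens L J) hd
    simp only
    rw [smul_add, smul_smul, smul_smul]
    have : ∀ x y : ℂ, delta η L J z (i + j) * (z⁻¹ * qn (qpow η 1) (i + 1) * x) =
      (z⁻¹ * x) * (qn (qpow η 1) (i + 1) * delta η L J z (i + j)) ∧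
      delta η L J z (i + j) * (qn (qpow η 1) (j + 1) * y) =
      y * (qn (qpow η 1) (j + 1) * delta η L J z (i + j)) := fun x y => ⟨by ring, by ring⟩
    rw [(this _ 0).1, (this 0 _).2, mul_smul, mul_smul _ (qn _ (j + 1) * _), ← e1, ← e2]
    simp only [delta, zpow_add₀ h0]
    match_scalars <;> (field_simp; try ring)

/-- Since `stepFst k = stepFst' (L - k)`, the `L + 1` steps taken in reverse order move along the
basis and leave the range, so their product kills the vacuum. -/
theorem rvec_fst_top (h : Generic (qpow η 1)) : rvec η L J z (L + 1) 0 = 0 := by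
  refine iterate_eq_zero (L := L) (J := J) L (fun k => stepFst η L J z k)
    (fun k => stepFst' η L J z k)
    (fun m n => step_comm h _ _ _ _) (fun k hk => ?_) (fun k => tket η L J k 0)
    (fun k => rvec η L J z k 0)
    (fun k => qn (qpow η 1) (k + 1) * delta' η L J z k)
    (fun k => (qn (qpow η 1) (k + 1) * delta η L J z k)⁻¹) (fun k => ?_) ?_ ?_ (fun k => ?_)
  · simp only [stepFst, stepFst']
    have h0 := h.ne_zero
    have ha := qhalf_ne_zero η L
    have e : qpow η 1 ^ (((L - k : ℕ)) : ℤ) = qhalf η L ^ 2 * (qpow η 1 ^ (k : ℤ))⁻¹ := by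
      rw [qhalf_sq, Nat.cast_sub hk, zpow_sub₀ h0, div_eq_mul_inv]
    rw [e]
    congr 2 <;> field_simp
  · have := stepFst'_tket (L := L) (J := J) (z := z) h k 0
    rw [add_zero] at this
    exact_mod_cast this
  · exact tket_eq_zero _ _ _ (Or.inr (Or.inl (by push_cast; omega)))
  · simp [rvec]
  · simpa using rvec_succ (L := L) (J := J) (η := η) (z := z) k 0

theorem rvec_snd_top (h : Generic (qpow η 1)) (hz0 : z ≠ 0) : rvec η L J z 0 (J + 1) = 0 := by
  refine iterate_eq_zero (L := L) (J := J) J (fun k => stepSnd η L J z k)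
    (fun k => stepSnd' η L J z k)
    (fun m n => ?_) (fun k hk => ?_) (fun k => tket η L J 0 k)
    (fun k => rvec η L J z 0 k)
    (fun k => qn (qpow η 1) (k + 1) * delta' η L J z k)
    (fun k => (qn (qpow η 1) (k + 1) * delta η L J z k)⁻¹) (fun k => ?_) ?_ ?_ (fun k => ?_)
  · simp only [stepSnd'_eq_neg]
    exact (step_comm h _ _ _ _).neg_left.neg_right
  · simp only [stepSnd, stepSnd']
    have h0 := h.ne_zero
    have hb := qhalf_ne_zero η J
    have e : qpow η 1 ^ (((J - k : ℕ)) : ℤ) = qhalf η J ^ 2 * (qpow η 1 ^ (k : ℤ))⁻¹ := by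
      rw [qhalf_sq, Nat.cast_sub hk, zpow_sub₀ h0, div_eq_mul_inv]
    rw [e]
    congr 2 <;> field_simp
  · have := stepSnd'_tket (L := L) (J := J) (z := z) h hz0 0 k
    rw [zero_add] at this
    exact_mod_cast this
  · exact tket_eq_zero _ _ _ (Or.inr (Or.inr (Or.inr (by push_cast; omega))))
  · simp [rvec]
  · exact rvec_zero_succ k

theorem rvec_eq_zero (h : Generic (qpow η 1)) (hz0 : z ≠ 0) (hz : ∀ k : ℤ, z ≠ qpow η 1 ^ k)
    {i j : ℕ} (hij : L < i ∨ J < j) : rvec η L J z i j = 0 := by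
  have s2 : ∀ i j, rvec η L J z i j = 0 → rvec η L J z i (j + 1) = 0 := fun i j e => by
    have := stepSnd_rvec (L := L) (J := J) h hz0 hz i j
    rw [e, mulVec_zero] at this
    exact (smul_eq_zero.1 this.symm).resolve_left
      (mul_ne_zero (h.qn_ne_zero (by omega)) (delta_ne_zero h hz0 hz _))
  have s1 : ∀ i j, rvec η L J z i j = 0 → rvec η L J z (i + 1) j = 0 := fun i j e => by
    rw [rvec_succ, e]; simp
  rcases hij with hi | hj
  · obtain ⟨k, rfl⟩ := Nat.exists_eq_add_of_lt hi
    have : rvec η L J z (L + k + 1) 0 = 0 := by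
      induction k with
      | zero => exact rvec_fst_top h
      | succ k ih => exact s1 _ _ (ih (by omega))
    induction j with
    | zero => exact this
    | succ j ih => exact s2 _ _ ih
  · obtain ⟨k, rfl⟩ := Nat.exists_eq_add_of_lt hj
    have : rvec η L J z 0 (J + k + 1) = 0 := by
      induction k with
      | zero => exact rvec_snd_top h hz0
      | succ k ih => exact s2 _ _ (ih (by omega))
    induction i with
    | zero => exact this
    | succ i ih => exact s1 _ _ ih

/-- Images and basis vectors vanish beyond the same range, so the intertwining relations can be
checked without regard to the edges. -/
theorem spectralR_tket (h : Generic (qpow η 1)) (hz0 : z ≠ 0) (hz : ∀ k : ℤ, z ≠ qpow η 1 ^ k)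
    (i j : ℕ) : spectralR η L J z *ᵥ tket η L J i j = rvec η L J z i j := by
  by_cases hij : i ≤ L ∧ j ≤ J
  · exact ofCols_tket h _ hij.1 hij.2
  · rw [tket_eq_zero _ _ _ (by omega), mulVec_zero, rvec_eq_zero h hz0 hz (by omega)]

theorem spectralR_raisePos (h : Generic (qpow η 1)) (hz0 : z ≠ 0)
    (hz : ∀ k : ℤ, z ≠ qpow η 1 ^ k) :
    spectralR η L J z * raisePos η L J 1 = raiseNeg η L J 1 * spectralR η L J z := by
  refine tmat_ext h fun i j _ _ => ?_
  have e1 := spectralR_tket (L := L) (J := J) h hz0 hz (i + 1) j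
  have e2 := spectralR_tket (L := L) (J := J) h hz0 hz i (j + 1)
  push_cast at e1 e2
  rw [← mulVec_mulVec, ← mulVec_mulVec, spectralR_tket h hz0 hz, (raise_rvec h hz0 hz i j).1,
    raisePos_tket _ _ _ _ _ h, mulVec_add, mulVec_smul, mulVec_smul, e1, e2]

theorem spectralR_raiseNeg (h : Generic (qpow η 1)) (hz0 : z ≠ 0)
    (hz : ∀ k : ℤ, z ≠ qpow η 1 ^ k) :
    spectralR η L J z * raiseNeg η L J z⁻¹ = raisePos η L J z⁻¹ * spectralR η L J z := by
  refine tmat_ext h fun i j _ _ => ?_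
  have e1 := spectralR_tket (L := L) (J := J) h hz0 hz (i + 1) j
  have e2 := spectralR_tket (L := L) (J := J) h hz0 hz i (j + 1)
  push_cast at e1 e2
  rw [← mulVec_mulVec, ← mulVec_mulVec, spectralR_tket h hz0 hz, (raise_rvec h hz0 hz i j).2,
    raiseNeg_tket _ _ _ _ _ h, mulVec_add, mulVec_smul, mulVec_smul, e1, e2]

theorem lev_raisePos (h : Generic (qpow η 1)) (g : ℤ → ℂ) (w : ℂ) :
    lev L J g * raisePos η L J w = raisePos η L J w * lev L J (fun n => g (n + 1)) := by
  refine tmat_ext h fun i j _ _ => ?_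
  simp only [← mulVec_mulVec, lev_tket, raisePos_tket _ _ _ _ _ h, mulVec_add, mulVec_smul]
  rw [show (i : ℤ) + 1 + j = i + j + 1 by ring, show (i : ℤ) + (j + 1) = i + j + 1 by ring]
  module

theorem lev_raiseNeg (h : Generic (qpow η 1)) (g : ℤ → ℂ) (w : ℂ) :
    lev L J g * raiseNeg η L J w = raiseNeg η L J w * lev L J (fun n => g (n + 1)) := by
  refine tmat_ext h fun i j _ _ => ?_
  simp only [← mulVec_mulVec, lev_tket, raiseNeg_tket _ _ _ _ _ h, mulVec_add, mulVec_smul]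
  rw [show (i : ℤ) + 1 + j = i + j + 1 by ring, show (i : ℤ) + (j + 1) = i + j + 1 by ring]
  module

/-- Each step raises the level by one and thereby shifts `g`, so the induction has to run over all
`g` at once. -/
theorem lev_rvec (h : Generic (qpow η 1)) (i j : ℕ) : ∀ g : ℤ → ℂ,
    lev L J g *ᵥ rvec η L J z i j = g (i + j) • rvec η L J z i j := by
  have hst : ∀ (s t : ℂ) (g : ℤ → ℂ) (v : Tens L J) (n : ℤ),
      (∀ g : ℤ → ℂ, lev L J g *ᵥ v = g n • v) →
      lev L J g *ᵥ ((s • raiseNeg η L J 1 - t • raisePos η L J z⁻¹) *ᵥ v) =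
        g (n + 1) • ((s • raiseNeg η L J 1 - t • raisePos η L J z⁻¹) *ᵥ v) := by
    intro s t g v n hv
    simp only [sub_mulVec, smul_mulVec, mulVec_sub, mulVec_smul]
    rw [mulVec_mulVec, mulVec_mulVec, lev_raisePos h, lev_raiseNeg h, ← mulVec_mulVec,
      ← mulVec_mulVec, hv, mulVec_smul, mulVec_smul]
    module
  induction i with
  | zero =>
    induction j with
    | zero => intro g; rw [rvec]; exact_mod_cast lev_tket η L J g 0 0
    | succ j ih =>
      intro g
      rw [rvec_zero_succ, stepSnd_eq_neg, neg_mulVec, mulVec_smul, mulVec_neg, hst _ _ g _ _ ih]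
      push_cast
      rw [add_assoc]
      module
  | succ i ih =>
    intro g
    rw [rvec_succ, stepFst, mulVec_smul, hst _ _ g _ _ ih]
    push_cast
    rw [show (i : ℤ) + 1 + j = i + j + 1 by ring]
    module

theorem spectralR_lev (h : Generic (qpow η 1)) (hz0 : z ≠ 0)
    (hz : ∀ k : ℤ, z ≠ qpow η 1 ^ k) (g : ℤ → ℂ) :
    spectralR η L J z * lev L J g = lev L J g * spectralR η L J z := by
  refine tmat_ext h fun i j _ _ => ?_
  rw [← mulVec_mulVec, ← mulVec_mulVec, spectralR_tket h hz0 hz, lev_rvec h, lev_tket,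
    mulVec_smul, spectralR_tket h hz0 hz]

end

/-! ### From raising to lowering operators. -/

section

variable {η : ℂ} {L J : ℕ} {z : ℂ}

theorem qhalf_zpow_sub {η : ℂ} (h : Generic (qpow η 1)) (L : ℕ) (i : ℤ) :
    qpow η 1 ^ ((L : ℤ) - i) = qhalf η L ^ 2 * (qpow η 1 ^ i)⁻¹ := by
  rw [qhalf_sq, zpow_sub₀ h.ne_zero, div_eq_mul_inv]

/-- The relation `[e, f] = [h]`, with `2n - L - J` the total weight at level `n`. The evaluation
parameters `w⁻¹` and `w` cancel. -/
theorem raisePos_lowerPos (h : Generic (qpow η 1)) {w : ℂ} (hw : w ≠ 0) :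
    raisePos η L J w⁻¹ * lowerPos η L J w = lowerPos η L J w * raisePos η L J w⁻¹ +
      lev L J (fun n => qn (qpow η 1) (2 * n - L - J)) := by
  refine tmat_ext h fun i j _ _ => ?_
  have h0 := h.ne_zero
  have ha := qhalf_ne_zero η L
  have hb := qhalf_ne_zero η J
  have hs := h.sq_sub_one_ne
  have e : qpow η 1 ^ (2 * ((i : ℤ) + j) - L - J) =
      qpow η 1 ^ (i : ℤ) * qpow η 1 ^ (i : ℤ) * (qpow η 1 ^ (j : ℤ) * qpow η 1 ^ (j : ℤ)) *
        (qhalf η L ^ 2)⁻¹ * (qhalf η J ^ 2)⁻¹ := by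
    rw [zpow_sub₀ h0, zpow_sub₀ h0, two_mul, zpow_add₀ h0, zpow_add₀ h0, qhalf_sq, qhalf_sq]
    field_simp
  simp only [add_mulVec, ← mulVec_mulVec, lev_tket, raisePos_tket _ _ _ _ _ h,
    lowerPos_tket _ _ _ _ _ h, mulVec_add, mulVec_smul, sub_add_cancel, add_sub_cancel_right]
  simp only [qn_eq, e]
  simp only [sub_add_eq_add_sub, zpow_add₀ h0, zpow_sub₀ h0, zpow_one, ← qhalf_sq]
  match_scalars <;> (field_simp; try ring)

theorem raiseNeg_lowerNeg (h : Generic (qpow η 1)) {w : ℂ} (hw : w ≠ 0) :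
    raiseNeg η L J w⁻¹ * lowerNeg η L J w = lowerNeg η L J w * raiseNeg η L J w⁻¹ +
      lev L J (fun n => qn (qpow η 1) (2 * n - L - J)) := by
  refine tmat_ext h fun i j _ _ => ?_
  have h0 := h.ne_zero
  have ha := qhalf_ne_zero η L
  have hb := qhalf_ne_zero η J
  have hs := h.sq_sub_one_ne
  have e : qpow η 1 ^ (2 * ((i : ℤ) + j) - L - J) =
      qpow η 1 ^ (i : ℤ) * qpow η 1 ^ (i : ℤ) * (qpow η 1 ^ (j : ℤ) * qpow η 1 ^ (j : ℤ)) *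
        (qhalf η L ^ 2)⁻¹ * (qhalf η J ^ 2)⁻¹ := by
    rw [zpow_sub₀ h0, zpow_sub₀ h0, two_mul, zpow_add₀ h0, zpow_add₀ h0, qhalf_sq, qhalf_sq]
    field_simp
  simp only [add_mulVec, ← mulVec_mulVec, lev_tket, raiseNeg_tket _ _ _ _ _ h,
    lowerNeg_tket _ _ _ _ _ h, mulVec_add, mulVec_smul, sub_add_cancel, add_sub_cancel_right]
  simp only [qn_eq, e]
  simp only [sub_add_eq_add_sub, zpow_add₀ h0, zpow_sub₀ h0, zpow_one, ← qhalf_sq]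
  match_scalars <;> (field_simp; try ring)

/-- Both commutators equal the same `K`, and `K` commutes with `R`; so `K` drops out of the relation
for the defect. -/
theorem intertwiner_defect {A : Type*} [Ring A] {R Rs Rs' Lw Lw' K : A}
    (hR : R * Rs = Rs' * R) (hK : R * K = K * R) (h1 : Rs * Lw = Lw * Rs + K)
    (h2 : Rs' * Lw' = Lw' * Rs' + K) :
    (R * Lw - Lw' * R) * Rs = Rs' * (R * Lw - Lw' * R) := by
  have e1 : Lw * Rs = Rs * Lw - K := by rw [h1]; abel
  rw [sub_mul, mul_sub, mul_assoc, e1, mul_assoc, hR, ← mul_assoc Rs', ← mul_assoc Rs', ← hR, h2,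
    mul_sub, add_mul, hK]
  have e3 : R * (Rs * Lw) = Rs' * (R * Lw) := by rw [← mul_assoc, hR, mul_assoc]
  simp only [mul_assoc, hR, e3]
  abel

/-- An intertwiner of raising operators that intertwines the lowering operators on the vectors
`f_0 ⊗ f_n` intertwines them everywhere. -/
theorem lower_of_column (h : Generic (qpow η 1)) {R Rs Rs' Lw Lw' K : TMat L J}
    (hR : R * Rs = Rs' * R) (hK : R * K = K * R) (h1 : Rs * Lw = Lw * Rs + K)
    (h2 : Rs' * Lw' = Lw' * Rs' + K) (α β : ℕ → ℕ → ℂ) (hα : ∀ i j, α i j ≠ 0)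
    (hs : ∀ i j : ℕ, Rs *ᵥ tket η L J i j =
      α i j • tket η L J (i + 1 : ℕ) j + β i j • tket η L J i (j + 1 : ℕ))
    (hc : ∀ n : ℕ, R *ᵥ (Lw *ᵥ tket η L J 0 n) = Lw' *ᵥ (R *ᵥ tket η L J 0 n)) :
    R * Lw = Lw' * R := by
  have hD : (R * Lw - Lw' * R) * Rs = Rs' * (R * Lw - Lw' * R) := by
    exact intertwiner_defect hR hK h1 h2
  have key : ∀ i j : ℕ, (R * Lw - Lw' * R) *ᵥ tket η L J i j = 0 := by
    intro i
    induction i with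
    | zero => intro j; simpa [sub_mulVec, ← mulVec_mulVec, sub_eq_zero] using hc j
    | succ i ih =>
      intro j
      -- The defect kills `f_i ⊗ f_j` and `f_i ⊗ f_{j+1}` by induction, hence also the remaining
      -- term of `Rs (f_i ⊗ f_j)`, a nonzero multiple of `f_{i+1} ⊗ f_j`.
      have e := congrArg (fun M => M *ᵥ tket η L J i j) hD
      simp only [← mulVec_mulVec, ih, mulVec_zero, hs, mulVec_add, mulVec_smul, smul_zero,
        add_zero] at e
      exact (smul_eq_zero.1 e).resolve_left (hα i j)
  rw [← sub_eq_zero]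
  exact tmat_ext h fun i j _ _ => by rw [key, zero_mulVec]

/-! #### The image of `f_0 ⊗ f_n` -/

/-- The quotient of consecutive coefficients of `colVec` in the first index. It depends only on the
level and vanishes at level `J`. -/
def colFst (η : ℂ) (J : ℕ) (z : ℂ) (m : ℤ) : ℂ :=
  z⁻¹ * (qpow η 1 ^ m * (qhalf η J ^ 2)⁻¹ - (qpow η 1 ^ m)⁻¹ * qhalf η J ^ 2)

def colSnd (η : ℂ) (L J : ℕ) (z : ℂ) (m : ℤ) : ℂ :=
  qpow η 1 ^ m * qhalf η L * (qhalf η J)⁻¹ -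
    z⁻¹ * (qpow η 1 ^ m)⁻¹ * (qhalf η L)⁻¹ * qhalf η J

def colCoeff (η : ℂ) (L J : ℕ) (z : ℂ) (i j : ℕ) : ℂ :=
  (∏ m ∈ Finset.range j, colSnd η L J z m) * ∏ m ∈ Finset.range i, colFst η J z (j + m)

theorem colCoeff_succ_fst (i j : ℕ) :
    colCoeff η L J z (i + 1) j = colCoeff η L J z i j * colFst η J z (i + j) := by
  rw [colCoeff, colCoeff, Finset.prod_range_succ, add_comm (i : ℤ)]; ring

/-- Stated without division because `colFst` vanishes at `J`. -/
theorem colCoeff_succ_snd (i j : ℕ) :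
    colFst η J z j * colCoeff η L J z i (j + 1) =
      colCoeff η L J z i j * colSnd η L J z j * colFst η J z (i + j) := by
  have e : (∏ m ∈ Finset.range i, colFst η J z (j + m)) * colFst η J z (i + j) =
      colFst η J z j * ∏ m ∈ Finset.range i, colFst η J z ((j + 1 : ℕ) + m) := by
    rw [add_comm (i : ℤ), ← Finset.prod_range_succ (fun m : ℕ => colFst η J z (j + m)),
      Finset.prod_range_succ', mul_comm]
    push_cast
    rw [add_zero]
    exact congrArg _ (Finset.prod_congr rfl fun m _ => by rw [add_assoc, add_comm (m : ℤ)])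
  rw [colCoeff, colCoeff, Finset.prod_range_succ]
  linear_combination (-(∏ m ∈ Finset.range j, colSnd η L J z m) * colSnd η L J z j) * e

theorem qn_sub_eq_colFst (h : Generic (qpow η 1)) (hz0 : z ≠ 0) (j : ℤ) :
    qn (qpow η 1) (J - j) = -z * (qpow η 1 - (qpow η 1)⁻¹)⁻¹ * colFst η J z j := by
  have h0 := h.ne_zero
  have hb := qhalf_ne_zero η J
  have hs := h.sq_sub_one_ne
  rw [qn_eq, qhalf_zpow_sub h, colFst]
  field_simp
  ring

/-- The image of `f_0 ⊗ f_n`, up to a scalar. -/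
def colVec (η : ℂ) (L J : ℕ) (z : ℂ) (n : ℕ) : Tens L J :=
  ∑ p ∈ Finset.HasAntidiagonal.antidiagonal n, colCoeff η L J z p.1 p.2 • tket η L J p.1 p.2

theorem stepSnd_colVec (h : Generic (qpow η 1)) (hz0 : z ≠ 0) (n : ℕ) :
    stepSnd η L J z n *ᵥ colVec η L J z n = qn (qpow η 1) (n + 1) • colVec η L J z (n + 1) := by
  have h0 := h.ne_zero
  have ha := qhalf_ne_zero η L
  have hb := qhalf_ne_zero η J
  have hs := h.sq_sub_one_ne
  -- `X i j` and `Y i j` are the contributions to `f_i ⊗ f_j` from `f_{i-1} ⊗ f_j` and from `f_i ⊗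
  -- f_{j-1}`. The truncated subtraction is harmless, since the factor `[0]` kills the terms
  -- concerned.
  set X : ℕ → ℕ → ℂ := fun i j => qn (qpow η 1) i * (z⁻¹ *
    (qpow η 1 ^ (n + j : ℤ) * (qhalf η J ^ 2)⁻¹ - (qpow η 1 ^ (n + j : ℤ))⁻¹ * qhalf η J ^ 2)) *
    colCoeff η L J z (i - 1) j with hX
  set Y : ℕ → ℕ → ℂ := fun i j => qn (qpow η 1) j * colSnd η L J z (n - i) *
    colCoeff η L J z i (j - 1) with hY
  -- A `q`-Pascal rule for the coefficients.
  have hXY : ∀ i j : ℕ, i + j = n + 1 →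
      qn (qpow η 1) (n + 1) * colCoeff η L J z i j = X i j + Y i j := by
    intro i j hij
    rcases i with _ | i
    · obtain rfl : j = n + 1 := by omega
      simp only [hX, hY, Nat.cast_zero, qn_zero, zero_mul, zero_add, sub_zero,
        Nat.add_sub_cancel]
      rw [colCoeff, colCoeff, Finset.prod_range_succ]
      push_cast
      simp only [Finset.range_zero, Finset.prod_empty]
      ring
    · have hn : (n : ℤ) = i + j := by omega
      have hYe : Y (i + 1) j = qn (qpow η 1) j * colFst η J z (j - 1) * colCoeff η L J z i j := by
        rcases j with _ | j
        · simp [hY]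
        · simp only [hY, Nat.add_sub_cancel]
          rw [colCoeff_succ_fst]
          have := colCoeff_succ_snd (η := η) (L := L) (J := J) (z := z) i j
          have e1 : (n : ℤ) - ((i + 1 : ℕ) : ℤ) = j := by omega
          have e2 : ((j + 1 : ℕ) : ℤ) - 1 = j := by omega
          rw [e1, e2]
          linear_combination (-qn (qpow η 1) ((j + 1 : ℕ) : ℤ)) * this
      rw [hYe, colCoeff_succ_fst]
      simp only [hX, Nat.add_sub_cancel, colFst, hn]
      push_cast
      simp only [qn_eq, zpow_add₀ h0, zpow_sub₀ h0, zpow_one]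
      field_simp
      ring
  have e1 : ∑ p ∈ Finset.HasAntidiagonal.antidiagonal (n + 1), X p.1 p.2 • tket η L J p.1 p.2 =
      ∑ p ∈ Finset.HasAntidiagonal.antidiagonal n, X (p.1 + 1) p.2 • tket η L J (p.1 + 1 : ℕ) p.2 := by
    rw [Finset.Nat.sum_antidiagonal_succ]
    simp [hX]
  have e2 : ∑ p ∈ Finset.HasAntidiagonal.antidiagonal (n + 1), Y p.1 p.2 • tket η L J p.1 p.2 =
      ∑ p ∈ Finset.HasAntidiagonal.antidiagonal n, Y p.1 (p.2 + 1) • tket η L J p.1 (p.2 + 1 : ℕ) := by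
    rw [Finset.Nat.sum_antidiagonal_succ']
    simp [hY]
  calc stepSnd η L J z n *ᵥ colVec η L J z n
      = ∑ p ∈ Finset.HasAntidiagonal.antidiagonal n, (X (p.1 + 1) p.2 • tket η L J (p.1 + 1 : ℕ) p.2 +
          Y p.1 (p.2 + 1) • tket η L J p.1 (p.2 + 1 : ℕ)) := by
        rw [colVec, mulVec_sum]
        refine Finset.sum_congr rfl fun p hp => ?_
        have hn : (n : ℤ) = p.1 + p.2 := by
          have := Finset.HasAntidiagonal.mem_antidiagonal.1 hp; omega
        simp only [stepSnd, sub_mulVec, smul_mulVec, mulVec_smul, raisePos_tket _ _ _ _ _ h,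
          raiseNeg_tket _ _ _ _ _ h, hX, hY, Nat.add_sub_cancel, colSnd, hn]
        push_cast
        simp only [zpow_add₀ h0, zpow_sub₀ h0]
        match_scalars <;> (field_simp; try ring)
    _ = ∑ p ∈ Finset.HasAntidiagonal.antidiagonal (n + 1), (X p.1 p.2 + Y p.1 p.2) • tket η L J p.1 p.2 := by
        simp only [add_smul, Finset.sum_add_distrib, e1, e2]
    _ = _ := by
        rw [colVec, Finset.smul_sum]
        refine Finset.sum_congr rfl fun p hp => ?_
        rw [smul_smul, hXY _ _ (Finset.HasAntidiagonal.mem_antidiagonal.1 hp)]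

theorem rvec_zero_eq (h : Generic (qpow η 1)) (hz0 : z ≠ 0) (n : ℕ) : rvec η L J z 0 n =
      (∏ m ∈ Finset.range n, delta η L J z m)⁻¹ • colVec η L J z n := by
  induction n with
  | zero => simp [rvec, colVec, colCoeff]
  | succ n ih =>
    have d2 : qn (qpow η 1) (n + 1) ≠ 0 := h.qn_ne_zero (by omega)
    rw [rvec_zero_succ, ih, mulVec_smul, stepSnd_colVec h hz0, Finset.prod_range_succ, smul_smul,
      smul_smul]
    congr 1
    field_simp

/-- The action of a lowering operator on `colVec`. -/
theorem lower_colVec {M : TMat L J} {x y : ℕ → ℕ → ℂ} {c : ℂ} {n : ℕ}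
    (hM : ∀ i j : ℕ, M *ᵥ tket η L J i j = x i j • tket η L J (i - 1) j +
      y i j • tket η L J i (j - 1))
    (hc : ∀ i j : ℕ, i + j = n → colCoeff η L J z (i + 1) j * x (i + 1) j +
      colCoeff η L J z i (j + 1) * y i (j + 1) = c * colCoeff η L J z i j) :
    M *ᵥ colVec η L J z (n + 1) = c • colVec η L J z n := by
  have e1 : ∑ p ∈ Finset.HasAntidiagonal.antidiagonal (n + 1), (colCoeff η L J z p.1 p.2 * x p.1 p.2) •
      tket η L J (p.1 - 1) p.2 = ∑ p ∈ Finset.HasAntidiagonal.antidiagonal n,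
        (colCoeff η L J z (p.1 + 1) p.2 * x (p.1 + 1) p.2) • tket η L J p.1 p.2 := by
    rw [Finset.Nat.sum_antidiagonal_succ, tket_eq_zero η L J (i := _ - 1) (by simp)]
    simp
  have e2 : ∑ p ∈ Finset.HasAntidiagonal.antidiagonal (n + 1), (colCoeff η L J z p.1 p.2 * y p.1 p.2) •
      tket η L J p.1 (p.2 - 1) = ∑ p ∈ Finset.HasAntidiagonal.antidiagonal n,
        (colCoeff η L J z p.1 (p.2 + 1) * y p.1 (p.2 + 1)) • tket η L J p.1 p.2 := by
    rw [Finset.Nat.sum_antidiagonal_succ', tket_eq_zero η L J (j := _ - 1) (by simp)]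
    simp
  simp only [colVec, mulVec_sum, mulVec_smul, hM, smul_add, smul_smul, Finset.sum_add_distrib]
  rw [e1, e2, ← Finset.sum_add_distrib, Finset.smul_sum]
  refine Finset.sum_congr rfl fun p hp => ?_
  rw [← add_smul, hc _ _ (Finset.HasAntidiagonal.mem_antidiagonal.1 hp), smul_smul]

/-- The scalar is that of `Δ(f_1)` on `f_0 ⊗ f_{n+1}` times `delta n`; the latter is absorbed by the
normalization relating `colVec` to `rvec`. -/
theorem lowerNeg_colVec (h : Generic (qpow η 1)) (hz0 : z ≠ 0) (n : ℕ) :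
    lowerNeg η L J 1 *ᵥ colVec η L J z (n + 1) =
      (delta η L J z n * (qn (qpow η 1) (J - n) * qhalf η L)) • colVec η L J z n := by
  have h0 := h.ne_zero
  have ha := qhalf_ne_zero η L
  have hb := qhalf_ne_zero η J
  have hs := h.sq_sub_one_ne
  refine lower_colVec (fun i j => lowerNeg_tket L J 1 i j h) fun i j hij => ?_
  have e := colCoeff_succ_snd (η := η) (L := L) (J := J) (z := z) i j
  push_cast
  rw [colCoeff_succ_fst, show (J : ℤ) - (j + 1) + 1 = J - j by ring,
    show (L : ℤ) - (i + 1) + 1 = L - i by ring, qn_sub_eq_colFst h hz0 j,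
    show ((n : ℕ) : ℤ) = i + j by omega, qn_sub_eq_colFst h hz0 (i + j)]
  have : ∀ x y : ℂ, colCoeff η L J z i (j + 1) * (x * colFst η J z j * y) =
    x * y * (colCoeff η L J z i j * colSnd η L J z j * colFst η J z (i + j)) := fun x y => by
      rw [← e]; ring
  rw [this]
  have : qn (qpow η 1) (L - i) * ((qpow η 1 ^ (j : ℤ))⁻¹ * qhalf η J) +
      -z * (qpow η 1 - (qpow η 1)⁻¹)⁻¹ * (qpow η 1 ^ (i : ℤ) * (qhalf η L)⁻¹) *
        colSnd η L J z j =
      delta η L J z (i + j) * (-z * (qpow η 1 - (qpow η 1)⁻¹)⁻¹ * qhalf η L) := by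
    simp only [qn_eq, qhalf_zpow_sub h, colSnd, delta, zpow_add₀ h0]
    field_simp
    ring
  linear_combination (colCoeff η L J z i j * colFst η J z (i + j)) * this

theorem lowerPos_colVec (h : Generic (qpow η 1)) (hz0 : z ≠ 0) (n : ℕ) :
    lowerPos η L J z *ᵥ colVec η L J z (n + 1) =
      (delta η L J z n * (qn (qpow η 1) (J - n) * (qhalf η L)⁻¹)) • colVec η L J z n := by
  have h0 := h.ne_zero
  have ha := qhalf_ne_zero η L
  have hb := qhalf_ne_zero η J
  have hs := h.sq_sub_one_ne
  refine lower_colVec (fun i j => lowerPos_tket L J z i j h) fun i j hij => ?_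
  have e := colCoeff_succ_snd (η := η) (L := L) (J := J) (z := z) i j
  push_cast
  rw [colCoeff_succ_fst, show (J : ℤ) - (j + 1) + 1 = J - j by ring,
    show (L : ℤ) - (i + 1) + 1 = L - i by ring, qn_sub_eq_colFst h hz0 j,
    show ((n : ℕ) : ℤ) = i + j by omega, qn_sub_eq_colFst h hz0 (i + j)]
  have : ∀ x y : ℂ, colCoeff η L J z i (j + 1) * (x * colFst η J z j * y) =
    x * y * (colCoeff η L J z i j * colSnd η L J z j * colFst η J z (i + j)) := fun x y => by
      rw [← e]; ring
  rw [this]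
  have : z * qn (qpow η 1) (L - i) * (qpow η 1 ^ (j : ℤ) * (qhalf η J)⁻¹) +
      -z * (qpow η 1 - (qpow η 1)⁻¹)⁻¹ * ((qpow η 1 ^ (i : ℤ))⁻¹ * qhalf η L) *
        colSnd η L J z j =
      delta η L J z (i + j) * (-z * (qpow η 1 - (qpow η 1)⁻¹)⁻¹ * (qhalf η L)⁻¹) := by
    simp only [qn_eq, qhalf_zpow_sub h, colSnd, delta, zpow_add₀ h0]
    field_simp
    ring
  linear_combination (colCoeff η L J z i j * colFst η J z (i + j)) * this

theorem rvec_zero_lower (h : Generic (qpow η 1)) (hz0 : z ≠ 0) (hz : ∀ k : ℤ, z ≠ qpow η 1 ^ k)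
    {M : TMat L J} {c : ℂ} {n : ℕ}
    (hM : M *ᵥ colVec η L J z (n + 1) = (delta η L J z n * c) • colVec η L J z n) :
    M *ᵥ rvec η L J z 0 (n + 1) = c • rvec η L J z 0 n := by
  rw [rvec_zero_eq h hz0, rvec_zero_eq h hz0, mulVec_smul, hM, smul_smul, smul_smul,
    Finset.prod_range_succ]
  have := delta_ne_zero (L := L) (J := J) h hz0 hz n
  congr 1
  field_simp

end

/-! ### The lowering relations, and the properties of the spectral `R`-matrix. -/

section

variable {η : ℂ} {L J : ℕ} {z : ℂ}

theorem spectralR_lowerPos (h : Generic (qpow η 1)) (hz0 : z ≠ 0)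
    (hz : ∀ k : ℤ, z ≠ qpow η 1 ^ k) :
    spectralR η L J z * lowerPos η L J 1 = lowerNeg η L J 1 * spectralR η L J z := by
  have h1 := raisePos_lowerPos (L := L) (J := J) h one_ne_zero
  have h2 := raiseNeg_lowerNeg (L := L) (J := J) h one_ne_zero
  rw [inv_one] at h1 h2
  refine lower_of_column h (spectralR_raisePos h hz0 hz) (spectralR_lev h hz0 hz _) h1 h2
    (fun i j => 1 * qn (qpow η 1) (i + 1) * (qpow η 1 ^ (j : ℤ) * (qhalf η J)⁻¹))
    (fun i j => qn (qpow η 1) (j + 1) * ((qpow η 1 ^ (i : ℤ))⁻¹ * qhalf η L))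
    (fun i j => ?_) (fun i j => ?_) (fun n => ?_)
  · exact mul_ne_zero (mul_ne_zero one_ne_zero (h.qn_ne_zero (by omega)))
      (mul_ne_zero (zpow_ne_zero _ h.ne_zero) (inv_ne_zero (qhalf_ne_zero _ _)))
  · exact_mod_cast raisePos_tket L J 1 i j h
  · have e0 := spectralR_tket (L := L) (J := J) h hz0 hz 0 n
    push_cast at e0
    rw [e0]
    rcases n with _ | n
    · rw [rvec, Nat.cast_zero, lowerPos_tket _ _ _ _ _ h, lowerNeg_tket _ _ _ _ _ h,
        tket_eq_zero η L J (i := 0 - 1) (by omega), tket_eq_zero η L J (j := 0 - 1) (by omega)]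
      simp
    · have e1 := spectralR_tket (L := L) (J := J) h hz0 hz 0 n
      push_cast at e1
      rw [rvec_zero_lower h hz0 hz (lowerNeg_colVec h hz0 n), lowerPos_tket _ _ _ _ _ h,
        tket_eq_zero η L J (i := 0 - 1) (by omega), smul_zero, zero_add, mulVec_smul]
      push_cast
      rw [add_sub_cancel_right, e1, sub_add_eq_add_sub, add_sub_add_right_eq_sub]
      simp

theorem spectralR_lowerNeg (h : Generic (qpow η 1)) (hz0 : z ≠ 0)
    (hz : ∀ k : ℤ, z ≠ qpow η 1 ^ k) :
    spectralR η L J z * lowerNeg η L J z = lowerPos η L J z * spectralR η L J z := by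
  refine lower_of_column h (spectralR_raiseNeg h hz0 hz) (spectralR_lev h hz0 hz _)
    (raiseNeg_lowerNeg h hz0) (raisePos_lowerPos h hz0)
    (fun i j => z⁻¹ * qn (qpow η 1) (i + 1) * ((qpow η 1 ^ (j : ℤ))⁻¹ * qhalf η J))
    (fun i j => qn (qpow η 1) (j + 1) * (qpow η 1 ^ (i : ℤ) * (qhalf η L)⁻¹))
    (fun i j => ?_) (fun i j => ?_) (fun n => ?_)
  · exact mul_ne_zero (mul_ne_zero (inv_ne_zero hz0) (h.qn_ne_zero (by omega)))
      (mul_ne_zero (inv_ne_zero (zpow_ne_zero _ h.ne_zero)) (qhalf_ne_zero _ _))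
  · exact_mod_cast raiseNeg_tket L J z⁻¹ i j h
  · have e0 := spectralR_tket (L := L) (J := J) h hz0 hz 0 n
    push_cast at e0
    rw [e0]
    rcases n with _ | n
    · rw [rvec, Nat.cast_zero, lowerPos_tket _ _ _ _ _ h, lowerNeg_tket _ _ _ _ _ h,
        tket_eq_zero η L J (i := 0 - 1) (by omega), tket_eq_zero η L J (j := 0 - 1) (by omega)]
      simp
    · have e1 := spectralR_tket (L := L) (J := J) h hz0 hz 0 n
      push_cast at e1
      rw [rvec_zero_lower h hz0 hz (lowerPos_colVec h hz0 n), lowerNeg_tket _ _ _ _ _ h,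
        tket_eq_zero η L J (i := 0 - 1) (by omega), smul_zero, zero_add, mulVec_smul]
      push_cast
      rw [add_sub_cancel_right, e1, sub_add_eq_add_sub, add_sub_add_right_eq_sub]
      simp

theorem qH_kronecker_eq_lev (η : ℂ) (L J : ℕ) : qH η L 1 ⊗ₖ qH η J 1 =
    lev L J (fun n => qpow η 1 ^ (2 * n - L - J)) := by
  rw [qH, qH, diagonal_kronecker_diagonal, lev]
  congr 1
  ext p
  rw [← qpow_add, ← qpow_int]
  congr 1
  simp only [weight]
  push_cast
  ring

theorem tket_zero (h : Generic (qpow η 1)) : tket η L J 0 0 = Pi.single (0, 0) 1 := by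
  have := tket_nat η ((0, 0) : Fin (L + 1) × Fin (J + 1))
  simp only [Fin.val_zero, Nat.cast_zero] at this
  rw [this]
  have h1 := qfactSqrt_ne_zero h L
  have h2 := qfactSqrt_ne_zero h J
  have h3 : qfactSqrt η 0 = 1 := by simp [qfactSqrt]
  simp [basisScale, h3, h1, h2]

theorem isSpectralR_spectralR (h : Generic (qpow η 1)) (hz0 : z ≠ 0)
    (hz : ∀ k : ℤ, z ≠ qpow η 1 ^ k) : IsSpectralR η z L J (spectralR η L J z) where
  cartan := by rw [qH_kronecker_eq_lev]; exact spectralR_lev h hz0 hz _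
  e_one := by simpa [raisePos, raiseNeg] using spectralR_raisePos (L := L) (J := J) h hz0 hz
  f_one := by simpa [lowerPos, lowerNeg] using spectralR_lowerPos (L := L) (J := J) h hz0 hz
  e_zero := spectralR_lowerNeg h hz0 hz
  f_zero := spectralR_raiseNeg h hz0 hz
  normalized := by
    have := spectralR_tket (L := L) (J := J) h hz0 hz 0 0
    rw [rvec, Nat.cast_zero, tket_zero h, mulVec_single_one] at this
    simpa using congrFun this (0, 0)

/-! ### Uniqueness and invertibility -/

/-- A subspace that contains `f_0 ⊗ f_0` and is stable under the raising operators is everything. -/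
theorem top_of_stable (h : Generic (qpow η 1)) (hz0 : z ≠ 0) (hz : ∀ k : ℤ, z ≠ qpow η 1 ^ k)
    (W : Submodule ℂ (Tens L J)) (h0 : tket η L J 0 0 ∈ W)
    (h1 : ∀ v ∈ W, raiseNeg η L J 1 *ᵥ v ∈ W) (h2 : ∀ v ∈ W, raisePos η L J z⁻¹ *ᵥ v ∈ W)
    (v : Tens L J) : v ∈ W := by
  have s1 : ∀ i j : ℕ, tket η L J i j ∈ W → tket η L J (i + 1 : ℕ) j ∈ W := fun i j hm => by
    have e := stepFst'_tket (L := L) (J := J) (z := z) h i j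
    have hc : qn (qpow η 1) (i + 1) * delta' η L J z (i + j) ≠ 0 :=
      mul_ne_zero (h.qn_ne_zero (by omega)) (delta'_ne_zero h hz0 hz _)
    rw [← W.smul_mem_iff hc]
    push_cast
    rw [← e, stepFst', sub_mulVec, smul_mulVec, smul_mulVec]
    exact W.sub_mem (W.smul_mem _ (h1 _ hm)) (W.smul_mem _ (h2 _ hm))
  have s2 : ∀ i j : ℕ, tket η L J i j ∈ W → tket η L J i (j + 1 : ℕ) ∈ W := fun i j hm => by
    have e := stepSnd'_tket (L := L) (J := J) (z := z) h hz0 i j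
    have hc : qn (qpow η 1) (j + 1) * delta' η L J z (i + j) ≠ 0 :=
      mul_ne_zero (h.qn_ne_zero (by omega)) (delta'_ne_zero h hz0 hz _)
    rw [← W.smul_mem_iff hc]
    push_cast
    rw [← e, stepSnd', sub_mulVec, smul_mulVec, smul_mulVec]
    exact W.sub_mem (W.smul_mem _ (h2 _ hm)) (W.smul_mem _ (h1 _ hm))
  have hall : ∀ i j : ℕ, tket η L J i j ∈ W := by
    intro i
    induction i with
    | zero =>
      intro j
      induction j with
      | zero => exact_mod_cast h0
      | succ j ih => exact s2 _ _ ih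
    | succ i ih => exact fun j => s1 _ _ (ih j)
  rw [pi_eq_sum_univ' v]
  refine W.sum_mem fun p _ => W.smul_mem _ ?_
  have e := tket_nat η p
  have hp := hall p.1 p.2
  rw [e, W.smul_mem_iff (mul_ne_zero (basisScale_ne_zero h _ _) (basisScale_ne_zero h _ _))] at hp
  convert hp using 1

/-- The range of `R` contains the vacuum and, by the intertwining relations, is stable under both
raising operators; cyclicity makes `R` surjective. -/
theorem IsSpectralR.isUnit {R : TMat L J} (hR : IsSpectralR η z L J R)
    (h : Generic (qpow η 1)) (hz0 : z ≠ 0) (hz : ∀ k : ℤ, z ≠ qpow η 1 ^ k)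
    (h00 : R *ᵥ tket η L J 0 0 = tket η L J 0 0) : IsUnit R := by
  rw [← mulVec_surjective_iff_isUnit]
  have e1 : R * raisePos η L J 1 = raiseNeg η L J 1 * R := by
    simpa [raisePos, raiseNeg] using hR.e_one
  have e2 : R * raiseNeg η L J z⁻¹ = raisePos η L J z⁻¹ * R := hR.f_zero
  intro v
  refine top_of_stable h hz0 hz (LinearMap.range R.mulVecLin) ⟨tket η L J 0 0, h00⟩ ?_ ?_ v
  · rintro _ ⟨w, rfl⟩
    exact ⟨raisePos η L J 1 *ᵥ w, by simp [mulVec_mulVec, e1]⟩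
  · rintro _ ⟨w, rfl⟩
    exact ⟨raiseNeg η L J z⁻¹ *ᵥ w, by simp [mulVec_mulVec, e2]⟩

/-- The weight of the vacuum occurs at level `0` only, as `q` is not a root of unity. So `R` maps
the vacuum to a multiple of itself, and the normalization fixes the multiple. -/
theorem IsSpectralR.mulVec_zero {R : TMat L J} (hR : IsSpectralR η z L J R)
    (h : Generic (qpow η 1)) : R *ᵥ tket η L J 0 0 = tket η L J 0 0 := by
  rw [tket_zero h, mulVec_single_one]
  ext p
  have hc := congrArg (fun M : TMat L J => M p (0, 0)) hR.cartan
  rw [qH_kronecker_eq_lev] at hc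
  simp only [lev, mul_diagonal, diagonal_mul] at hc
  by_cases hp : p = (0, 0)
  · subst hp; simpa using hR.normalized
  · have hpos : ((p.1 : ℕ) : ℤ) + ((p.2 : ℕ) : ℤ) ≠ 0 := fun h0 => hp (by
      have a1 : p.1 = 0 := Fin.ext (by rw [Fin.val_zero]; omega)
      have a2 : p.2 = 0 := Fin.ext (by rw [Fin.val_zero]; omega)
      exact Prod.ext a1 a2)
    have hne : qpow η 1 ^ (2 * (((p.1 : ℕ) : ℤ) + ((p.2 : ℕ) : ℤ)) - L - J) ≠
        qpow η 1 ^ (2 * ((((0 : Fin (L + 1)) : ℕ) : ℤ) + (((0 : Fin (J + 1)) : ℕ) : ℤ)) - L - J) := by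
      intro e
      apply h.zpow_ne_one (n := 2 * (((p.1 : ℕ) : ℤ) + ((p.2 : ℕ) : ℤ))) (by omega)
      rw [sub_sub, sub_sub, zpow_sub₀ h.ne_zero, zpow_sub₀ h.ne_zero,
        div_left_inj' (zpow_ne_zero _ h.ne_zero)] at e
      simpa using e
    have : R p (0, 0) = 0 := by
      by_contra hne'
      exact hne (mul_right_cancel₀ hne' (by rw [mul_comm] at hc; exact hc.symm))
    simp [hp, this]

/-- `R' R⁻¹` commutes with both raising operators of the opposite coproduct and fixes the vacuum.
Its fixed vectors form a stable subspace, hence everything. -/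
theorem IsSpectralR.eq {R R' : TMat L J} (hR : IsSpectralR η z L J R)
    (hR' : IsSpectralR η z L J R') (h : Generic (qpow η 1)) (hz0 : z ≠ 0)
    (hz : ∀ k : ℤ, z ≠ qpow η 1 ^ k) : R' = R := by
  have hu := hR.isUnit h hz0 hz (hR.mulVec_zero h)
  have hu' := hR'.isUnit h hz0 hz (hR'.mulVec_zero h)
  have e1 : R * raisePos η L J 1 = raiseNeg η L J 1 * R := by
    simpa [raisePos, raiseNeg] using hR.e_one
  have e2 : R * raiseNeg η L J z⁻¹ = raisePos η L J z⁻¹ * R := hR.f_zero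
  have e1' : R' * raisePos η L J 1 = raiseNeg η L J 1 * R' := by
    simpa [raisePos, raiseNeg] using hR'.e_one
  have e2' : R' * raiseNeg η L J z⁻¹ = raisePos η L J z⁻¹ * R' := hR'.f_zero
  have hd := (Matrix.isUnit_iff_isUnit_det R).1 hu
  have c1 : ∀ {M N : TMat L J}, R * M = N * R → R' * M = N * R' →
      R' * R⁻¹ * N = N * (R' * R⁻¹) := by
    intro M N a b
    calc R' * R⁻¹ * N = R' * R⁻¹ * (N * R) * R⁻¹ := by
          rw [mul_assoc _ (N * R), mul_nonsing_inv_cancel_right _ _ hd]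
      _ = R' * M * R⁻¹ := by rw [← a, ← mul_assoc, nonsing_inv_mul_cancel_right _ _ hd]
      _ = N * (R' * R⁻¹) := by rw [b, mul_assoc]
  have k1 := c1 e1 e1'
  have k2 := c1 e2 e2'
  have hQ : ∀ v, (R' * R⁻¹) *ᵥ v = v := by
    intro v
    refine top_of_stable h hz0 hz (LinearMap.eqLocus (R' * R⁻¹).mulVecLin LinearMap.id) ?_ ?_ ?_ v
    · change (R' * R⁻¹) *ᵥ tket η L J 0 0 = tket η L J 0 0
      conv_lhs => rw [← hR.mulVec_zero h]
      rw [mulVec_mulVec, nonsing_inv_mul_cancel_right _ _ hd, hR'.mulVec_zero h]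
    · intro w hw
      change (R' * R⁻¹) *ᵥ w = w at hw
      change (R' * R⁻¹) *ᵥ (raiseNeg η L J 1 *ᵥ w) = raiseNeg η L J 1 *ᵥ w
      rw [mulVec_mulVec, k1, ← mulVec_mulVec, hw]
    · intro w hw
      change (R' * R⁻¹) *ᵥ w = w at hw
      change (R' * R⁻¹) *ᵥ (raisePos η L J z⁻¹ *ᵥ w) = raisePos η L J z⁻¹ *ᵥ w
      rw [mulVec_mulVec, k2, ← mulVec_mulVec, hw]
  have : R' * R⁻¹ = 1 := tmat_ext h fun i j _ _ => by rw [hQ, one_mulVec]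
  calc R' = R' * R⁻¹ * R := by rw [nonsing_inv_mul_cancel_right _ _ hd]
    _ = R := by rw [this, one_mul]

end

/-! ### The dynamical twist in the rescaled basis -/

section Twist

variable {η : ℂ} {L J : ℕ}

theorem lowering_pow_ket (h : Generic (qpow η 1)) (i : ℤ) (k : ℕ) :
    lowering η L ^ k *ᵥ ket η L i =
      (∏ m ∈ Finset.range k, qn (qpow η 1) (L - (i - k) - m)) • ket η L (i - k) := by
  induction k with
  | zero => simp
  | succ k ih =>
    rw [pow_succ', ← mulVec_mulVec, ih, mulVec_smul, lowering_ket h, smul_smul,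
      Finset.prod_range_succ', Nat.cast_succ, sub_add_eq_sub_sub]
    congr 2
    · exact Finset.prod_congr rfl fun m _ => by congr 1; push_cast; ring
    · congr 1; push_cast; ring

theorem raising_pow_ket (h : Generic (qpow η 1)) (j : ℤ) (k : ℕ) :
    raising η J ^ k *ᵥ ket η J j =
      (∏ m ∈ Finset.range k, qn (qpow η 1) (j + k - m)) • ket η J (j + k) := by
  induction k with
  | zero => simp
  | succ k ih =>
    rw [pow_succ', ← mulVec_mulVec, ih, mulVec_smul, raising_ket h, smul_smul,
      Finset.prod_range_succ', Nat.cast_succ, ← add_assoc]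
    congr 2
    · exact Finset.prod_congr rfl fun m _ => by congr 1; push_cast; ring
    · congr 1; push_cast; ring

/-- The coefficient of `f_i ⊗ f_j` in the twist of `f_{i+k} ⊗ f_{j-k}`. -/
def twistCoeff (η X : ℂ) (L J : ℕ) (i j : ℤ) (k : ℕ) : ℂ :=
  ∏ m ∈ Finset.range k, (-(qpow η 1 - (qpow η 1)⁻¹) * qn (qpow η 1) (L - i - m) *
    qn (qpow η 1) (j - m) / qn (qpow η 1) (m + 1) * X * (qpow η 1 ^ (m : ℤ) * qpow η 1) *
    (qpow η 1 ^ i) ^ 3 * qpow η 1 ^ j * (qhalf η L ^ 3 * qhalf η J)⁻¹ /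
    (1 - X * (qhalf η L ^ 4)⁻¹ * (qpow η 1 ^ i) ^ 4 * (qpow η 1 ^ (m : ℤ)) ^ 2 * qpow η 1 ^ 2))

theorem twistCoeff_zero (X : ℂ) (i j : ℤ) : twistCoeff η X L J i j 0 = 1 := by
  simp [twistCoeff]

theorem twistCoeff_succ (X : ℂ) (i j : ℤ) (m : ℕ) :
    twistCoeff η X L J i j (m + 1) = twistCoeff η X L J i j m *
    (-(qpow η 1 - (qpow η 1)⁻¹) * qn (qpow η 1) (L - i - m) *
    qn (qpow η 1) (j - m) / qn (qpow η 1) (m + 1) * X * (qpow η 1 ^ (m : ℤ) * qpow η 1) *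
    (qpow η 1 ^ i) ^ 3 * qpow η 1 ^ j * (qhalf η L ^ 3 * qhalf η J)⁻¹ /
    (1 - X * (qhalf η L ^ 4)⁻¹ * (qpow η 1 ^ i) ^ 4 * (qpow η 1 ^ (m : ℤ)) ^ 2 *
      qpow η 1 ^ 2)) := by
  rw [twistCoeff, Finset.prod_range_succ, ← twistCoeff]

theorem qpow_triangle (η : ℂ) (k : ℕ) : qpow η ((k : ℂ) * (k + 1) / 2) =
    ∏ m ∈ Finset.range k, (qpow η 1 ^ (m : ℤ) * qpow η 1) := by
  induction k with
  | zero => simp [qpow_zero]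
  | succ k ih =>
    rw [Finset.prod_range_succ, ← ih, ← qpow_int, ← qpow_add, ← qpow_add]
    congr 1
    push_cast
    ring

/-- The diagonal factor of the twist acts after the shift operators, so it is evaluated at the
target `(i - k, j + k)`; hence `twistCoeff` is indexed by the target. -/
theorem twist_summand_tket (h : Generic (qpow η 1)) (lam : ℂ) (i j : ℤ) (k : ℕ) :
    ((Matrix.diagonal fun p : Fin (L + 1) × Fin (J + 1) =>
      (-1) ^ k * (qpow η 1 - qpow η (-1)) ^ k / qfact η k * dynX lam ^ k *
        qpow η ((k : ℂ) * (k + 1) / 2) *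
        qpow η ((k : ℂ) * (3 * weight L p.1 + weight J p.2) / 2) /
        ∏ ν ∈ Finset.range k,
          (1 - dynX lam * qpow η (2 * weight L p.1 + 2 * ((ν : ℂ) + 1)))) *
    ((lowering η L ^ k) ⊗ₖ (raising η J ^ k))) *ᵥ tket η L J i j =
      twistCoeff η (dynX lam) L J (i - k) (j + k) k • tket η L J (i - k) (j + k) := by
  rw [← mulVec_mulVec, kronecker_tket (lowering_pow_ket h i k) (raising_pow_ket h j k), mulVec_smul]
  ext p
  simp only [mulVec_diagonal, Pi.smul_apply, smul_eq_mul]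
  by_cases hp : ((p.1 : ℕ) : ℤ) = i - k ∧ ((p.2 : ℕ) : ℤ) = j + k
  · rw [← mul_assoc]
    congr 1
    rw [twistCoeff, ← hp.1, ← hp.2]
    have h0 := h.ne_zero
    have e1 : qpow η ((k : ℂ) * (3 * weight L p.1 + weight J p.2) / 2) =
        ∏ m ∈ Finset.range k, ((qpow η 1 ^ ((p.1 : ℕ) : ℤ)) ^ 3 * qpow η 1 ^ ((p.2 : ℕ) : ℤ) *
          (qhalf η L ^ 3 * qhalf η J)⁻¹) := by
      rw [Finset.prod_const, Finset.card_range, ← zpow_natCast _ k, ← zpow_natCast _ 3,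
        ← zpow_natCast _ 3, ← _root_.zpow_mul, ← qpow_int, ← qpow_int, qhalf, qhalf, ← qpow_int_mul,
        ← qpow_add, ← qpow_add, ← qpow_neg, ← qpow_add, ← qpow_int_mul]
      congr 1
      simp only [weight]
      push_cast
      ring
    have e2 : ∀ ν : ℕ, dynX lam * qpow η (2 * weight L p.1 + 2 * ((ν : ℂ) + 1)) =
        dynX lam * (qhalf η L ^ 4)⁻¹ * (qpow η 1 ^ ((p.1 : ℕ) : ℤ)) ^ 4 *
          (qpow η 1 ^ (ν : ℤ)) ^ 2 * qpow η 1 ^ 2 := by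
      intro ν
      have : qpow η (2 * weight L p.1 + 2 * ((ν : ℂ) + 1)) = (qhalf η L ^ 4)⁻¹ *
          (qpow η 1 ^ ((p.1 : ℕ) : ℤ)) ^ 4 * (qpow η 1 ^ (ν : ℤ)) ^ 2 * qpow η 1 ^ 2 := by
        rw [← zpow_natCast _ 4, ← zpow_natCast _ 4, ← zpow_natCast _ 2, ← zpow_natCast _ 2,
          ← _root_.zpow_mul, ← _root_.zpow_mul, qhalf, ← qpow_int_mul, ← qpow_int, ← qpow_int, ← qpow_int,
          ← qpow_neg, ← qpow_add, ← qpow_add, ← qpow_add]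
        congr 1
        simp only [weight]
        push_cast
        ring
      rw [this]; ring
    simp only [e1, e2, qpow_triangle, qpow_neg, qfact]
    have e3 : ∀ ν : ℕ, qint η (ν + 1) = qn (qpow η 1) (ν + 1) := fun ν => by
      exact_mod_cast qint_eq η (ν + 1)
    simp only [e3]
    rw [← mul_pow]
    have e4 : ∀ x : ℂ, x ^ k = ∏ _m ∈ Finset.range k, x := fun x => by simp
    rw [e4 (-1 * _), e4 (dynX lam)]
    simp only [← Finset.prod_mul_distrib, ← Finset.prod_div_distrib]
    exact Finset.prod_congr rfl fun m _ => by ring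
  · have : tket η L J (i - k) (j + k) p = 0 := by
      simp only [tket, ket]
      by_cases h1 : ((p.1 : ℕ) : ℤ) = i - k
      · rw [if_neg (fun h2 : ((p.2 : ℕ) : ℤ) = j + k => hp ⟨h1, h2⟩), mul_zero]
      · rw [if_neg h1, zero_mul]
    rw [this]; simp

/-- The length of the sum may be any `N > L`, which allows sums for neighbouring vectors to be
aligned. -/
theorem twist_tket (h : Generic (qpow η 1)) (lam : ℂ) (i j : ℤ) {N : ℕ} (hN : L + 1 ≤ N) :
    twist η lam L J *ᵥ tket η L J i j = ∑ k ∈ Finset.range N,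
      twistCoeff η (dynX lam) L J (i - k) (j + k) k • tket η L J (i - k) (j + k) := by
  rw [twist, sum_mulVec]
  simp only [twist_summand_tket h]
  refine Finset.sum_subset (Finset.range_subset_range.2 hN) fun k _ hk => ?_
  rw [Finset.mem_range, not_lt] at hk
  rw [← twist_summand_tket h lam]
  by_cases hi : i ≤ L
  · rw [twist_summand_tket h, tket_eq_zero _ _ _ (by omega), smul_zero]
  · rw [tket_eq_zero _ _ _ (by omega), mulVec_zero]

/-- The twist is unitriangular: apart from the identity it only lowers the first index. Surjectivity
follows by induction on that index. -/
theorem isUnit_twist (h : Generic (qpow η 1)) (lam : ℂ) : IsUnit (twist η lam L J) := by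
  have key : ∀ i j : ℕ, tket η L J i j ∈ LinearMap.range (twist η lam L J).mulVecLin := by
    intro i
    induction i using Nat.strong_induction_on with
    | _ i ih =>
      intro j
      have e := twist_tket (L := L) (J := J) h lam i j (N := L + 1) le_rfl
      rw [Finset.sum_range_succ'] at e
      simp only [Nat.cast_zero, sub_zero, add_zero, twistCoeff_zero, one_smul] at e
      rw [← sub_eq_iff_eq_add'] at e
      rw [← e]
      refine Submodule.sub_mem _ ⟨_, rfl⟩ (Submodule.sum_mem _ fun k _ => Submodule.smul_mem _ _ ?_)
      by_cases hk : k + 1 ≤ i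
      · have := ih (i - (k + 1)) (by omega) (j + (k + 1))
        rw [Nat.cast_sub hk] at this
        exact_mod_cast this
      · rw [tket_eq_zero _ _ _ (by omega)]; exact Submodule.zero_mem _
  rw [← mulVec_surjective_iff_isUnit]
  intro v
  have : v ∈ LinearMap.range (twist η lam L J).mulVecLin := by
    rw [pi_eq_sum_univ' v]
    refine Submodule.sum_mem _ fun p _ => Submodule.smul_mem _ _ ?_
    have hp := key p.1 p.2
    rw [tket_nat η p, Submodule.smul_mem_iff _
      (mul_ne_zero (basisScale_ne_zero h _ _) (basisScale_ne_zero h _ _))] at hp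
    exact hp
  exact this

end Twist

/-! ### A raising operator that the dynamical twist makes two-diagonal -/

section

variable {η : ℂ} {L J : ℕ} {z : ℂ}

/-- A scalar of the level, used to cancel the terms of `raisePos` in the twisted relation. -/
def levG (η X : ℂ) (L J : ℕ) (n : ℤ) : ℂ :=
  (qpow η 1 - (qpow η 1)⁻¹) / (qpow η 1 + (qpow η 1)⁻¹) * X * (qpow η 1 ^ n) ^ 2 * qpow η 1 *
    (qhalf η L ^ 2 * qhalf η J ^ 2)⁻¹

/-- The two inner brackets are `q^{L+1} + q^{-L-1}` and `q^{J+1} + q^{-J-1}`, the Casimir values of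
the two factors. Exchanging `L` with `J` and `z` with `z⁻¹` multiplies the expression by `z`. -/
def levC (η X z : ℂ) (L J : ℕ) (n : ℤ) : ℂ :=
  -(qpow η 1 + (qpow η 1)⁻¹)⁻¹ * X * (qpow η 1 ^ n) ^ 2 * qpow η 1 ^ 2 *
    (qhalf η L ^ 2 * qhalf η J ^ 2)⁻¹ *
    (z⁻¹ * (qpow η 1 * qhalf η L ^ 2 + (qpow η 1 * qhalf η L ^ 2)⁻¹) +
      (qpow η 1 * qhalf η J ^ 2 + (qpow η 1 * qhalf η J ^ 2)⁻¹))

/-- The operator that is conjugated to a two-diagonal one by the twist. -/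
def dynRaise (η X z w : ℂ) (L J : ℕ) : TMat L J :=
  (1 - X * qpow η 1 ^ 2) • raisePos η L J z⁻¹ +
    raiseNeg η L J 1 * (lowerNeg η L J 1 * raisePos η L J z⁻¹ -
      qpow η 1 ^ 2 • (raisePos η L J z⁻¹ * lowerNeg η L J 1)) * lev L J (levG η X L J) -
    raiseNeg η L J 1 * lev L J (levC η X z L J) - w • raiseNeg η L J 1

/-- The image of `dynRaise` under the spectral `R`-matrix. -/
def dynRaise' (η X z w : ℂ) (L J : ℕ) : TMat L J :=
  (1 - X * qpow η 1 ^ 2) • raiseNeg η L J z⁻¹ +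
    raisePos η L J 1 * (lowerPos η L J 1 * raiseNeg η L J z⁻¹ -
      qpow η 1 ^ 2 • (raiseNeg η L J z⁻¹ * lowerPos η L J 1)) * lev L J (levG η X L J) -
    raisePos η L J 1 * lev L J (levC η X z L J) - w • raisePos η L J 1

/-- Both operators are the same polynomial, once in the generators under `Δ` and once under `Δ'`,
with scalars of the level that commute with the `R`-matrix. -/
theorem spectralR_dynRaise (h : Generic (qpow η 1)) (hz0 : z ≠ 0) (hz : ∀ k : ℤ, z ≠ qpow η 1 ^ k)
    (X w : ℂ) : spectralR η L J z * dynRaise' η X z w L J =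
      dynRaise η X z w L J * spectralR η L J z := by
  have e1 := spectralR_raisePos (L := L) (J := J) h hz0 hz
  have e2 := spectralR_raiseNeg (L := L) (J := J) h hz0 hz
  have e3 := spectralR_lowerPos (L := L) (J := J) h hz0 hz
  have e4 := fun g => spectralR_lev (L := L) (J := J) h hz0 hz g
  have e12 : ∀ M : TMat L J, spectralR η L J z * (raisePos η L J 1 * M) =
      raiseNeg η L J 1 * (spectralR η L J z * M) := fun M => by
    rw [← mul_assoc, e1, mul_assoc]
  have e22 : ∀ M : TMat L J, spectralR η L J z * (raiseNeg η L J z⁻¹ * M) =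
      raisePos η L J z⁻¹ * (spectralR η L J z * M) := fun M => by
    rw [← mul_assoc, e2, mul_assoc]
  have e32 : ∀ M : TMat L J, spectralR η L J z * (lowerPos η L J 1 * M) =
      lowerNeg η L J 1 * (spectralR η L J z * M) := fun M => by
    rw [← mul_assoc, e3, mul_assoc]
  simp only [dynRaise, dynRaise', mul_sub, mul_add, sub_mul, add_mul, mul_smul_comm, smul_mul_assoc,
    mul_assoc, e12, e22, e32, e1, e2, e4]

/-- The weight `q²` in the commutator is chosen so that the component at `f_{i+1} ⊗ f_{j-1}`
cancels. -/
theorem dynRaise_aux (h : Generic (qpow η 1)) (hz0 : z ≠ 0) (i j : ℤ) :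
    (lowerNeg η L J 1 * raisePos η L J z⁻¹ -
      qpow η 1 ^ 2 • (raisePos η L J z⁻¹ * lowerNeg η L J 1)) *ᵥ tket η L J i j =
      (z⁻¹ * (qn (qpow η 1) (i + 1) * qn (qpow η 1) (L - i) -
          qpow η 1 ^ 2 * (qn (qpow η 1) i * qn (qpow η 1) (L - i + 1))) +
        (qn (qpow η 1) (j + 1) * qn (qpow η 1) (J - j) -
          qpow η 1 ^ 2 * (qn (qpow η 1) j * qn (qpow η 1) (J - j + 1)))) • tket η L J i j +
      (-qpow η 1 * qn (qpow η 1) (L - i + 1) * qn (qpow η 1) (j + 1) *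
        (qpow η 1 ^ i * qpow η 1 ^ j)⁻¹ * (qhalf η L * qhalf η J) *
        (qpow η 1 ^ 2 - (qpow η 1 ^ 2)⁻¹)) • tket η L J (i - 1) (j + 1) := by
  have h0 := h.ne_zero
  have ha := qhalf_ne_zero η L
  have hb := qhalf_ne_zero η J
  have hs := h.sq_sub_one_ne
  simp only [sub_mulVec, smul_mulVec, ← mulVec_mulVec, raisePos_tket _ _ _ _ _ h,
    lowerNeg_tket _ _ _ _ _ h, mulVec_add, mulVec_smul, sub_add_cancel, add_sub_cancel_right]
  simp only [qn_eq]
  simp only [sub_add_eq_add_sub, zpow_add₀ h0, zpow_sub₀ h0, zpow_one, ← qhalf_sq]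
  match_scalars <;> (field_simp; try ring)

theorem dynRaise_tket (h : Generic (qpow η 1)) (hz0 : z ≠ 0) (X w : ℂ) (i j : ℤ) :
    dynRaise η X z w L J *ᵥ tket η L J i j =
      (qn (qpow η 1) (i + 1) * (qpow η 1 ^ j)⁻¹ * qhalf η J *
        (z⁻¹ * (qpow η 1 ^ j) ^ 2 * (qhalf η J ^ 2)⁻¹ +
          X * (qpow η 1 ^ i) ^ 2 * qpow η 1 ^ 2 * (qhalf η L ^ 2)⁻¹ - w)) • tket η L J (i + 1) j +
      (qn (qpow η 1) (j + 1) * ((qpow η 1 ^ i)⁻¹ * qhalf η L +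
        z⁻¹ * X * qpow η 1 ^ i * (qpow η 1 ^ j) ^ 2 * qpow η 1 ^ 2 *
          (qhalf η L * qhalf η J ^ 2)⁻¹ +
        X * (qhalf η L ^ 3)⁻¹ * (qpow η 1 ^ i) ^ 3 * (qpow η 1 ^ 2 + 1) -
        X * qpow η 1 ^ i * qpow η 1 ^ 2 * qhalf η L - X * (qhalf η L ^ 3)⁻¹ * qpow η 1 ^ i -
        w * qpow η 1 ^ i * (qhalf η L)⁻¹)) • tket η L J i (j + 1) +
      (-(qpow η 1 - (qpow η 1)⁻¹) ^ 2 * X * (qpow η 1 ^ i) ^ 2 * qpow η 1 ^ j * qpow η 1 *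
        (qhalf η L ^ 2 * qhalf η J)⁻¹ * qn (qpow η 1) (L - i + 1) * qn (qpow η 1) (j + 1) *
        qn (qpow η 1) (j + 2)) • tket η L J (i - 1) (j + 2) := by
  have h0 := h.ne_zero
  have ha := qhalf_ne_zero η L
  have hb := qhalf_ne_zero η J
  have hs := h.sq_sub_one_ne
  have hp : qpow η 1 ^ 2 + 1 ≠ 0 := fun e => h.add_inv_ne (by field_simp; rw [e, mul_zero])
  simp only [dynRaise, sub_mulVec (_ + _ - _), sub_mulVec (_ + _), add_mulVec, smul_mulVec,
    ← mulVec_mulVec, lev_tket, mulVec_smul, dynRaise_aux h hz0, mulVec_add,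
    raisePos_tket _ _ _ _ _ h, raiseNeg_tket _ _ _ _ _ h, sub_add_cancel]
  simp only [show j + 1 + 1 = j + 2 by ring]
  simp only [qn_eq, levG, levC]
  simp only [sub_add_eq_add_sub, zpow_add₀ h0, zpow_sub₀ h0, zpow_one, ← qhalf_sq,
    show qpow η 1 ^ (2 : ℤ) = qpow η 1 ^ 2 from zpow_ofNat _ 2]
  match_scalars <;> (field_simp; try ring)

end

/-! ### The coefficients of the twist under the shift of `λ`. -/

section

variable {η : ℂ} {L J : ℕ} {z X : ℂ}

/-- The denominators of the twist do not vanish. -/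
theorem dyn_ne (hX : ∀ k : ℤ, X ≠ qpow η 1 ^ (2 * k)) (n : ℤ) :
    1 - X * qpow η 1 ^ (2 * n) ≠ 0 := fun e => by
  apply hX (-n)
  rw [mul_neg, _root_.zpow_neg]
  exact eq_inv_of_mul_eq_one_left (sub_eq_zero.1 e).symm

/-- The power of `q` multiplying `X` has exponent `2(2i + n - L)`, which is even; so `X ∉ q^{2ℤ}`
suffices. -/
theorem twist_den_ne (h : Generic (qpow η 1)) (hX : ∀ k : ℤ, X ≠ qpow η 1 ^ (2 * k)) (i n : ℤ) :
    1 - X * (qhalf η L ^ 4)⁻¹ * (qpow η 1 ^ i) ^ 4 * (qpow η 1 ^ n) ^ 2 ≠ 0 := by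
  have := dyn_ne hX (2 * i + n - L)
  have e : qpow η 1 ^ (2 * (2 * i + n - L)) =
      (qhalf η L ^ 4)⁻¹ * (qpow η 1 ^ i) ^ 4 * (qpow η 1 ^ n) ^ 2 := by
    rw [show qhalf η L ^ 4 = (qhalf η L ^ 2) ^ 2 by ring, qhalf_sq, ← zpow_natCast _ 2,
      ← zpow_natCast _ 4, ← zpow_natCast _ 2, ← _root_.zpow_mul, ← _root_.zpow_mul,
      ← _root_.zpow_mul, ← _root_.zpow_neg, ← zpow_add₀ h.ne_zero, ← zpow_add₀ h.ne_zero]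
    congr 1
    push_cast
    ring
  rw [e] at this
  convert this using 2
  ring

/-- Replacing `X` by `X q²` and `i` by `i - 1` moves each denominator to the preceding one, so the
quotient of the products telescopes. -/
theorem twistCoeff_shift_fst (h : Generic (qpow η 1)) (hX : ∀ k : ℤ, X ≠ qpow η 1 ^ (2 * k))
    (i j : ℤ) (m : ℕ) :
    twistCoeff η (X * qpow η 1 ^ 2) L J (i - 1) j (m + 1) =
      twistCoeff η X L J i j m * (-(qpow η 1 - (qpow η 1)⁻¹) * qn (qpow η 1) (L - i + 1) *
        qn (qpow η 1) (j - m) / qn (qpow η 1) (m + 1) * X * (qpow η 1 ^ i) ^ 3 * qpow η 1 ^ j *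
        (qhalf η L ^ 3 * qhalf η J)⁻¹ / (1 - X * (qhalf η L ^ 4)⁻¹ * (qpow η 1 ^ i) ^ 4)) := by
  have h0 := h.ne_zero
  have ha := qhalf_ne_zero η L
  have hb := qhalf_ne_zero η J
  have d0 := twist_den_ne (L := L) h hX i 0
  rw [zpow_zero, one_pow, mul_one] at d0
  have e1 : qpow η 1 ^ (i - 1) = qpow η 1 ^ i * (qpow η 1)⁻¹ := by
    rw [zpow_sub₀ h0, zpow_one, div_eq_mul_inv]
  have e2 : ∀ x : ℂ, X * qpow η 1 ^ 2 * (qhalf η L ^ 4)⁻¹ * (qpow η 1 ^ i * (qpow η 1)⁻¹) ^ 4 *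
      x ^ 2 * qpow η 1 ^ 2 = X * (qhalf η L ^ 4)⁻¹ * (qpow η 1 ^ i) ^ 4 * x ^ 2 := fun x => by
    field_simp
  have e3 : ∀ m : ℤ, (L : ℤ) - (i - 1) - m = L - i + 1 - m := fun m => by ring
  induction m with
  | zero =>
    rw [twistCoeff_succ, twistCoeff_zero, twistCoeff_zero, e1, e2, e3]
    simp only [Nat.cast_zero, zpow_zero, one_pow, mul_one, zero_add, sub_zero, one_mul]
    congr 1
    field_simp
  | succ m ih =>
    have d1 := twist_den_ne (L := L) h hX i (m + 1)
    have hm : qn (qpow η 1) (m + 1) ≠ 0 := h.qn_ne_zero (by omega)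
    have hm2 : qn (qpow η 1) (m + 1 + 1) ≠ 0 := h.qn_ne_zero (by omega)
    rw [twistCoeff_succ, ih, twistCoeff_succ _ i j m, e1, e2, e3]
    push_cast
    rw [show (L : ℤ) - i + 1 - (m + 1) = L - i - m by ring]
    have e4 : X * (qhalf η L ^ 4)⁻¹ * (qpow η 1 ^ i) ^ 4 * (qpow η 1 ^ (m : ℤ)) ^ 2 *
        qpow η 1 ^ 2 = X * (qhalf η L ^ 4)⁻¹ * (qpow η 1 ^ i) ^ 4 *
          (qpow η 1 ^ ((m : ℤ) + 1)) ^ 2 := by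
      rw [zpow_add₀ h0, zpow_one]; ring
    rw [e4]
    generalize 1 - X * (qhalf η L ^ 4)⁻¹ * (qpow η 1 ^ i) ^ 4 * (qpow η 1 ^ ((m : ℤ) + 1)) ^ 2 = D1
      at *
    generalize 1 - X * (qhalf η L ^ 4)⁻¹ * (qpow η 1 ^ i) ^ 4 = D0 at *
    rw [zpow_add₀ h0, zpow_one]
    field_simp

/-- Again a telescoping quotient. It is multiplied by `[j]` instead of divided, as `[j]` may vanish.
-/
theorem twistCoeff_shift_snd (h : Generic (qpow η 1)) (hX : ∀ k : ℤ, X ≠ qpow η 1 ^ (2 * k))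
    (i j : ℤ) (m : ℕ) :
    twistCoeff η (X * qpow η 1 ^ 2) L J i (j - 1) m * qn (qpow η 1) j =
      twistCoeff η X L J i j m * (qpow η 1 ^ (m : ℤ) * qn (qpow η 1) (j - m) *
        (1 - X * (qhalf η L ^ 4)⁻¹ * (qpow η 1 ^ i) ^ 4 * qpow η 1 ^ 2) /
        (1 - X * (qhalf η L ^ 4)⁻¹ * (qpow η 1 ^ i) ^ 4 * (qpow η 1 ^ (m : ℤ)) ^ 2 *
          qpow η 1 ^ 2)) := by
  have h0 := h.ne_zero
  have ha := qhalf_ne_zero η L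
  have hb := qhalf_ne_zero η J
  have hden : ∀ n : ℤ, 1 - X * (qhalf η L ^ 4)⁻¹ * (qpow η 1 ^ i) ^ 4 * (qpow η 1 ^ n) ^ 2 *
      qpow η 1 ^ 2 ≠ 0 := fun n => by
    have := twist_den_ne (L := L) h hX i (n + 1)
    rw [zpow_add₀ h0, zpow_one, mul_pow, ← mul_assoc] at this
    exact this
  induction m with
  | zero =>
    have d0 := hden 0
    simp only [zpow_zero, one_pow, mul_one] at d0
    simp only [twistCoeff_zero, Nat.cast_zero, zpow_zero, one_pow, mul_one, sub_zero, one_mul]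
    rw [mul_div_assoc, div_self d0, mul_one]
  | succ m ih =>
    have d1 := hden (m + 1)
    have d2 := hden m
    have hm : qn (qpow η 1) (m + 1) ≠ 0 := h.qn_ne_zero (by omega)
    rw [twistCoeff_succ, mul_right_comm, ih, twistCoeff_succ _ i j m]
    push_cast
    rw [show (j : ℤ) - 1 - m = j - (m + 1) by ring]
    have e4 : X * qpow η 1 ^ 2 * (qhalf η L ^ 4)⁻¹ * (qpow η 1 ^ i) ^ 4 *
        (qpow η 1 ^ (m : ℤ)) ^ 2 * qpow η 1 ^ 2 = X * (qhalf η L ^ 4)⁻¹ * (qpow η 1 ^ i) ^ 4 *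
          (qpow η 1 ^ ((m : ℤ) + 1)) ^ 2 * qpow η 1 ^ 2 := by
      rw [zpow_add₀ h0, zpow_one]; ring
    have e5 : qpow η 1 ^ (j - 1) = qpow η 1 ^ j * (qpow η 1)⁻¹ := by
      rw [zpow_sub₀ h0, zpow_one, div_eq_mul_inv]
    rw [e4, e5]
    generalize 1 - X * (qhalf η L ^ 4)⁻¹ * (qpow η 1 ^ i) ^ 4 * (qpow η 1 ^ ((m : ℤ) + 1)) ^ 2 *
      qpow η 1 ^ 2 = D1 at *
    generalize 1 - X * (qhalf η L ^ 4)⁻¹ * (qpow η 1 ^ i) ^ 4 * (qpow η 1 ^ (m : ℤ)) ^ 2 *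
      qpow η 1 ^ 2 = D0 at *
    rw [zpow_add₀ h0, zpow_one]
    field_simp

/-- The value of `twistCoeff` at `m - 1`. -/
def twistCoeffPred (η X : ℂ) (L J : ℕ) (i j : ℤ) (m : ℕ) : ℂ :=
  if m = 0 then 0 else twistCoeff η X L J i j (m - 1)

/-- The recursion of `twistCoeff` read backwards, with the possibly vanishing `q`-integers kept as
factors. At `m = 0` both sides vanish. -/
theorem twistCoeffPred_mul (h : Generic (qpow η 1)) (hX : ∀ k : ℤ, X ≠ qpow η 1 ^ (2 * k))
    (i j : ℤ) (m : ℕ) :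
    twistCoeffPred η X L J i j m * (-(qpow η 1 - (qpow η 1)⁻¹) * qn (qpow η 1) (L - i - m + 1) *
      qn (qpow η 1) (j - m + 1) * X * qpow η 1 ^ (m : ℤ) *
      (qpow η 1 ^ i) ^ 3 * qpow η 1 ^ j * (qhalf η L ^ 3 * qhalf η J)⁻¹) =
      twistCoeff η X L J i j m * (qn (qpow η 1) m *
        (1 - X * (qhalf η L ^ 4)⁻¹ * (qpow η 1 ^ i) ^ 4 * (qpow η 1 ^ (m : ℤ)) ^ 2)) := by
  have h0 := h.ne_zero
  rcases m with _ | m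
  · simp [twistCoeffPred]
  · have d1 := twist_den_ne (L := L) h hX i (m + 1)
    have hm : qn (qpow η 1) (m + 1) ≠ 0 := h.qn_ne_zero (by omega)
    rw [twistCoeff_succ, twistCoeffPred, if_neg (Nat.succ_ne_zero m), Nat.add_sub_cancel]
    push_cast
    have e4 : X * (qhalf η L ^ 4)⁻¹ * (qpow η 1 ^ i) ^ 4 * (qpow η 1 ^ (m : ℤ)) ^ 2 *
        qpow η 1 ^ 2 = X * (qhalf η L ^ 4)⁻¹ * (qpow η 1 ^ i) ^ 4 *
          (qpow η 1 ^ ((m : ℤ) + 1)) ^ 2 := by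
      rw [zpow_add₀ h0, zpow_one]; ring
    rw [e4, show (L : ℤ) - i - (m + 1) + 1 = L - i - m by ring,
      show j - (m + 1 : ℤ) + 1 = j - m by ring]
    generalize 1 - X * (qhalf η L ^ 4)⁻¹ * (qpow η 1 ^ i) ^ 4 * (qpow η 1 ^ ((m : ℤ) + 1)) ^ 2 = D1
      at *
    rw [zpow_add₀ h0, zpow_one]
    field_simp

end

/-! ### The termwise identity behind the conjugation by the twist. -/

section

variable {η : ℂ} {L J : ℕ} {z X : ℂ}

/-- Here and in `dynSnd` the parameter `w` is subtracted inside a single bracket, so a suitable `w`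
makes the coefficient vanish. -/
def dynFst (η X z w : ℂ) (L J : ℕ) (i j : ℤ) : ℂ :=
  qn (qpow η 1) (i + 1) * (qpow η 1 ^ j)⁻¹ * qhalf η J *
    (z⁻¹ * (qpow η 1 ^ j) ^ 2 * (qhalf η J ^ 2)⁻¹ +
      X * (qpow η 1 ^ i) ^ 2 * qpow η 1 ^ 2 * (qhalf η L ^ 2)⁻¹ - w)

def dynSnd (η X z w : ℂ) (L J : ℕ) (i j : ℤ) : ℂ :=
  qn (qpow η 1) (j + 1) * qpow η 1 ^ i * (qhalf η L)⁻¹ *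
    ((1 - X * (qpow η 1 ^ i) ^ 2 * qpow η 1 ^ 2) *
      (1 - X * (qpow η 1 ^ i) ^ 2 * (qhalf η L ^ 4)⁻¹) /
      ((1 - X * (qhalf η L ^ 4)⁻¹ * (qpow η 1 ^ i) ^ 4) *
        (1 - X * (qhalf η L ^ 4)⁻¹ * (qpow η 1 ^ i) ^ 4 * qpow η 1 ^ 2))) *
    ((qpow η 1 ^ i)⁻¹ ^ 2 * qhalf η L ^ 2 + z⁻¹ * X * (qpow η 1 ^ i) ^ 4 * (qpow η 1 ^ j) ^ 2 *
      qpow η 1 ^ 2 * (qhalf η L ^ 4)⁻¹ * (qhalf η J ^ 2)⁻¹ - w)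

/-- `dynMid` and `dynLast` are coefficients of `dynRaise`; conjugation by the twist replaces
`dynMid` by the factored `dynSnd` and removes `dynLast`. -/
def dynMid (η X z w : ℂ) (L J : ℕ) (i j : ℤ) : ℂ :=
  qn (qpow η 1) (j + 1) * ((qpow η 1 ^ i)⁻¹ * qhalf η L +
    z⁻¹ * X * qpow η 1 ^ i * (qpow η 1 ^ j) ^ 2 * qpow η 1 ^ 2 *
      (qhalf η L * qhalf η J ^ 2)⁻¹ +
    X * (qhalf η L ^ 3)⁻¹ * (qpow η 1 ^ i) ^ 3 * (qpow η 1 ^ 2 + 1) -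
    X * qpow η 1 ^ i * qpow η 1 ^ 2 * qhalf η L - X * (qhalf η L ^ 3)⁻¹ * qpow η 1 ^ i -
    w * qpow η 1 ^ i * (qhalf η L)⁻¹)

def dynLast (η X : ℂ) (L J : ℕ) (i j : ℤ) : ℂ :=
  -(qpow η 1 - (qpow η 1)⁻¹) ^ 2 * X * (qpow η 1 ^ i) ^ 2 * qpow η 1 ^ j * qpow η 1 *
    (qhalf η L ^ 2 * qhalf η J)⁻¹ * qn (qpow η 1) (L - i + 1) * qn (qpow η 1) (j + 1) *
    qn (qpow η 1) (j + 2)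

theorem dynRaise_tket' (h : Generic (qpow η 1)) (hz0 : z ≠ 0) (X w : ℂ) (i j : ℤ) :
    dynRaise η X z w L J *ᵥ tket η L J i j =
      dynFst η X z w L J i j • tket η L J (i + 1) j +
      dynMid η X z w L J i j • tket η L J i (j + 1) +
      dynLast η X L J i j • tket η L J (i - 1) (j + 2) :=
  dynRaise_tket h hz0 X w i j

/-- The two sides are the coefficients of `f_i ⊗ f_j` when the two products in `twist_dynRaise` are
applied to `f_{i+m} ⊗ f_{j-m-1}`. Once everything is written as a multiple of `twistCoeff η X L J i
j m`, a rational identity in `q^i`, `q^j` and `q^m` remains. -/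
theorem dyn_termwise (h : Generic (qpow η 1)) (hX : ∀ k : ℤ, X ≠ qpow η 1 ^ (2 * k)) (w : ℂ)
    (i j : ℤ) (m : ℕ) :
    dynFst η X z w L J (i + m) (j - m - 1) * twistCoeff η X L J i j (m + 1) +
      dynMid η X z w L J (i + m) (j - m - 1) * twistCoeff η X L J i j m +
      dynLast η X L J (i + m) (j - m - 1) * twistCoeffPred η X L J i j m =
    dynFst η X z w L J (i - 1) j * twistCoeff η (X * qpow η 1 ^ 2) L J (i - 1) j (m + 1) +
      dynSnd η X z w L J i (j - 1) * twistCoeff η (X * qpow η 1 ^ 2) L J i (j - 1) m := by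
  have h0 := h.ne_zero
  have ha := qhalf_ne_zero η L
  have hb := qhalf_ne_zero η J
  have hs := h.sq_sub_one_ne
  have hu : qpow η 1 ^ i ≠ 0 := zpow_ne_zero _ h0
  have hv : qpow η 1 ^ j ≠ 0 := zpow_ne_zero _ h0
  have hp : qpow η 1 ^ (m : ℤ) ≠ 0 := zpow_ne_zero _ h0
  have hm : (qpow η 1 ^ (m : ℤ) * qpow η 1) ^ 2 - 1 ≠ 0 := fun e => by
    apply h.zpow_ne_one (n := ((m : ℤ) + 1) * 2) (by omega)
    rw [_root_.zpow_mul, zpow_add₀ h0, zpow_one]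
    exact_mod_cast sub_eq_zero.1 e
  have eL : dynLast η X L J (i + m) (j - m - 1) * twistCoeffPred η X L J i j m =
      twistCoeff η X L J i j m * (qn (qpow η 1) m *
        (1 - X * (qhalf η L ^ 4)⁻¹ * (qpow η 1 ^ i) ^ 4 * (qpow η 1 ^ (m : ℤ)) ^ 2)) *
      ((qpow η 1 - (qpow η 1)⁻¹) * qn (qpow η 1) (j - m) * qhalf η L * (qpow η 1 ^ i)⁻¹) := by
    rw [← twistCoeffPred_mul h hX, dynLast, show (L : ℤ) - (i + m) + 1 = L - i - m + 1 by ring,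
      sub_add_cancel, show j - m - 1 + 2 = j - m + 1 by ring, zpow_add₀ h0, zpow_sub₀ h0,
      zpow_sub₀ h0, zpow_one]
    field_simp
  have eS : dynSnd η X z w L J i (j - 1) * twistCoeff η (X * qpow η 1 ^ 2) L J i (j - 1) m =
      twistCoeff η X L J i j m * (qpow η 1 ^ (m : ℤ) * qn (qpow η 1) (j - m) *
        (1 - X * (qhalf η L ^ 4)⁻¹ * (qpow η 1 ^ i) ^ 4 * qpow η 1 ^ 2) /
        (1 - X * (qhalf η L ^ 4)⁻¹ * (qpow η 1 ^ i) ^ 4 * (qpow η 1 ^ (m : ℤ)) ^ 2 *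
          qpow η 1 ^ 2)) * (qpow η 1 ^ i * (qhalf η L)⁻¹ *
    ((1 - X * (qpow η 1 ^ i) ^ 2 * qpow η 1 ^ 2) *
      (1 - X * (qpow η 1 ^ i) ^ 2 * (qhalf η L ^ 4)⁻¹) /
      ((1 - X * (qhalf η L ^ 4)⁻¹ * (qpow η 1 ^ i) ^ 4) *
        (1 - X * (qhalf η L ^ 4)⁻¹ * (qpow η 1 ^ i) ^ 4 * qpow η 1 ^ 2))) *
    ((qpow η 1 ^ i)⁻¹ ^ 2 * qhalf η L ^ 2 + z⁻¹ * X * (qpow η 1 ^ i) ^ 4 *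
      (qpow η 1 ^ (j - 1)) ^ 2 *
      qpow η 1 ^ 2 * (qhalf η L ^ 4)⁻¹ * (qhalf η J ^ 2)⁻¹ - w)) := by
    rw [← twistCoeff_shift_snd h hX, dynSnd, sub_add_cancel]
    ring
  rw [eL, eS, twistCoeff_succ, twistCoeff_shift_fst h hX]
  have d0 := twist_den_ne (L := L) h hX i 0
  have d1 := twist_den_ne (L := L) h hX i 1
  have d2 := twist_den_ne (L := L) h hX i (m + 1)
  simp only [zpow_zero, zpow_one, one_pow, mul_one] at d0 d1
  rw [zpow_add₀ h0, zpow_one, mul_pow, ← mul_assoc] at d2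
  simp only [dynFst, dynMid, sub_add_cancel, qn_eq, zpow_add₀ h0, zpow_sub₀ h0, zpow_one,
    ← qhalf_sq η L]
  generalize twistCoeff η X L J i j m = Φ
  -- In terms of this `Y` the denominators of the twist are `1 - Y`, `1 - Y q²` and `1 - Y
  -- q^{2m+2}`, free of `q^i` and `q^{L/2}`.
  obtain ⟨Y, hY⟩ : ∃ Y, Y = X * (qhalf η L ^ 4)⁻¹ * (qpow η 1 ^ i) ^ 4 := ⟨_, rfl⟩
  rw [← hY] at d0 d1 d2 ⊢
  have hXY : X = Y * qhalf η L ^ 4 * ((qpow η 1 ^ i) ^ 4)⁻¹ := by rw [hY]; field_simp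
  clear hY
  subst hXY
  generalize qpow η 1 ^ i = u at *
  generalize qpow η 1 ^ j = v at *
  generalize qpow η 1 ^ (m : ℤ) = p at *
  generalize qpow η 1 = q at *
  generalize qhalf η L = a at *
  generalize qhalf η J = b at *
  clear eL eS
  generalize z⁻¹ = ζ
  rw [mul_pow] at hm
  rw [mul_comm] at d1
  rw [mul_assoc, mul_comm] at d2
  field_simp
  ring

end

/-! ### Conjugation by the twist. -/

section

variable {η : ℂ} {L J : ℕ} {z X : ℂ}

/-- The two-diagonal operator obtained from `dynRaise` by conjugation with the twist. -/
def dynDiag (η X z w : ℂ) (L J : ℕ) : TMat L J :=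
  ofCols η L J fun i j => dynFst η X z w L J i j • tket η L J (i + 1) j +
    dynSnd η X z w L J i j • tket η L J i (j + 1)

theorem dynDiag_tket (h : Generic (qpow η 1)) (X z w : ℂ) (i j : ℤ) :
    dynDiag η X z w L J *ᵥ tket η L J i j = dynFst η X z w L J i j • tket η L J (i + 1) j +
      dynSnd η X z w L J i j • tket η L J i (j + 1) := by
  by_cases hij : 0 ≤ i ∧ i ≤ L ∧ 0 ≤ j ∧ j ≤ J
  · obtain ⟨m, rfl⟩ := Int.eq_ofNat_of_zero_le hij.1
    obtain ⟨n, rfl⟩ := Int.eq_ofNat_of_zero_le hij.2.2.1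
    rw [dynDiag, ofCols_tket h _ (by omega) (by omega)]
  · rw [tket_eq_zero _ _ _ (by omega), mulVec_zero]
    by_cases h1 : i = -1
    · subst h1
      rw [tket_eq_zero _ _ _ (i := -1) (by omega)]
      simp [dynFst]
    · by_cases h2 : j = -1
      · subst h2
        rw [tket_eq_zero _ _ _ (j := -1) (by omega)]
        simp [dynSnd]
      · rw [tket_eq_zero _ _ _ (by omega), tket_eq_zero _ _ _ (by omega)]
        simp

theorem dynX_shift (η lam : ℂ) : dynX (lam - 2 * η) = dynX lam * qpow η 1 ^ 2 := by
  rw [dynX, dynX, qpow, ← Complex.exp_nat_mul, ← Complex.exp_add]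
  congr 1
  push_cast
  ring

/-- The twist contributes infinitesimally many neighbours only through `E_- ⊗ E_+`, so all terms lie
on the line of targets `(i - k, j + 1 + k)` apart from `(i + 1, j)`; there `dyn_termwise` compares
the coefficients one by one. -/
theorem twist_dynRaise (h : Generic (qpow η 1)) (hz0 : z ≠ 0) {lam : ℂ}
    (hX : ∀ k : ℤ, dynX lam ≠ qpow η 1 ^ (2 * k)) (w : ℂ) :
    twist η lam L J * dynRaise η (dynX lam) z w L J =
      dynDiag η (dynX lam) z w L J * twist η (lam - 2 * η) L J := by
  refine tmat_ext h fun i j hi _ => ?_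
  -- The three expansions are brought to the common targets `(i - k, j + 1 + k)`. The term `k = 0`
  -- of this one is split off, and the one for `(i - 1, j + 2)` starts one step later, which
  -- `twistCoeffPred` encodes.
  have eA : twist η lam L J *ᵥ tket η L J (i + 1) j = tket η L J (i + 1) j +
      ∑ k ∈ Finset.range (L + 2), twistCoeff η (dynX lam) L J (i - k) (j + 1 + k) (k + 1) •
        tket η L J (i - k) (j + 1 + k) := by
    rw [twist_tket h lam _ _ (N := L + 3) (by omega), Finset.sum_range_succ']
    refine (add_comm _ _).trans ?_
    simp only [Nat.cast_zero, sub_zero, add_zero, twistCoeff_zero, one_smul]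
    refine congrArg _ (Finset.sum_congr rfl fun k _ => ?_)
    push_cast
    rw [add_sub_add_right_eq_sub, add_comm (k : ℤ) 1, add_assoc]
  have eB := twist_tket (L := L) (J := J) h lam i (j + 1) (N := L + 2) (by omega)
  have eC : twist η lam L J *ᵥ tket η L J (i - 1) (j + 2) =
      ∑ k ∈ Finset.range (L + 2), twistCoeffPred η (dynX lam) L J (i - k) (j + 1 + k) k •
        tket η L J (i - k) (j + 1 + k) := by
    rw [twist_tket h lam _ _ (N := L + 1) le_rfl, Finset.sum_range_succ' _ (L + 1)]
    simp only [twistCoeffPred, if_true, zero_smul, add_zero, if_neg (Nat.succ_ne_zero _),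
      Nat.add_sub_cancel]
    refine Finset.sum_congr rfl fun k _ => ?_
    push_cast
    rw [show (i : ℤ) - 1 - k = i - (k + 1) by ring, show (j : ℤ) + 2 + k = j + 1 + (k + 1) by ring]
  have eR : dynDiag η (dynX lam) z w L J *ᵥ (twist η (lam - 2 * η) L J *ᵥ tket η L J i j) =
      dynFst η (dynX lam) z w L J i j • tket η L J (i + 1) j +
      ∑ k ∈ Finset.range (L + 2), (dynFst η (dynX lam) z w L J (i - k - 1) (j + 1 + k) *
          twistCoeff η (dynX lam * qpow η 1 ^ 2) L J (i - k - 1) (j + 1 + k) (k + 1) +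
        dynSnd η (dynX lam) z w L J (i - k) (j + 1 + k - 1) *
          twistCoeff η (dynX lam * qpow η 1 ^ 2) L J (i - k) (j + 1 + k - 1) k) •
        tket η L J (i - k) (j + 1 + k) := by
    rw [twist_tket h _ _ _ (N := L + 3) (by omega), dynX_shift, mulVec_sum]
    simp only [mulVec_smul, dynDiag_tket h, smul_add, Finset.sum_add_distrib, add_smul]
    -- The sum with `dynFst` loses its first term and the sum with `dynSnd` its last one, which is
    -- zero because its first index is negative.
    rw [Finset.sum_range_succ' (n := L + 2), Finset.sum_range_succ (n := L + 2),
      tket_eq_zero _ _ _ (i := (i : ℤ) - (L + 2 : ℕ)) (by push_cast; omega)]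
    simp only [Nat.cast_zero, sub_zero, add_zero, twistCoeff_zero, one_mul, smul_zero, smul_smul]
    rw [add_comm _ (dynFst η (dynX lam) z w L J i j • _), add_assoc]
    refine congrArg _ (congrArg₂ _ (Finset.sum_congr rfl fun k _ => ?_)
      (Finset.sum_congr rfl fun k _ => ?_))
    · push_cast
      rw [show (i : ℤ) - (k + 1) = i - k - 1 by ring, show (j : ℤ) + (k + 1) = j + 1 + k by ring,
        sub_add_cancel, mul_comm]
    · rw [show (j : ℤ) + 1 + k - 1 = j + k by ring, show (j : ℤ) + k + 1 = j + 1 + k by ring,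
        mul_comm]
  rw [← mulVec_mulVec, ← mulVec_mulVec, eR, dynRaise_tket' h hz0, mulVec_add, mulVec_add,
    mulVec_smul, mulVec_smul, mulVec_smul, eA, eB, eC, smul_add, Finset.smul_sum, Finset.smul_sum,
    Finset.smul_sum, add_assoc, add_assoc, ← Finset.sum_add_distrib, ← Finset.sum_add_distrib]
  refine congrArg _ (Finset.sum_congr rfl fun k _ => ?_)
  rw [← dyn_termwise h hX, sub_add_cancel, show (j : ℤ) + 1 + k - k - 1 = j by ring, smul_smul,
    smul_smul, smul_smul, ← add_smul, ← add_smul]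
  congr 1
  ring

/-! ### The opposite twist -/

theorem flip_mul {L J : ℕ} (M N : TMat J L) : (M * N).submatrix Prod.swap Prod.swap =
    (M.submatrix Prod.swap Prod.swap * N.submatrix Prod.swap Prod.swap : TMat L J) :=
  (submatrix_mul_equiv M N _ (Equiv.prodComm _ _) _).symm

theorem flip_skewSum (c : ℂ) (A : Matrix (Fin (J + 1)) (Fin (J + 1)) ℂ)
    (B : Matrix (Fin (L + 1)) (Fin (L + 1)) ℂ) :
    ((skewSum η J L c A B).submatrix Prod.swap Prod.swap : TMat L J) =
      skewSum η L J (-c) B A := by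
  ext p r
  simp only [skewSum, submatrix_apply, Matrix.add_apply, kroneckerMap_apply, Prod.fst_swap, Prod.snd_swap,
    neg_neg]
  ring

theorem skewSum_smul_snd (hz0 : z ≠ 0) (c : ℂ) (A : Matrix (Fin (L + 1)) (Fin (L + 1)) ℂ)
    (B : Matrix (Fin (J + 1)) (Fin (J + 1)) ℂ) :
    skewSum η L J c A (z⁻¹ • B) = z⁻¹ • skewSum η L J c (z • A) B := by
  ext p r
  simp only [skewSum, Matrix.smul_apply, Matrix.add_apply, kroneckerMap_apply, smul_eq_mul]
  field_simp

theorem flip_lev (g : ℤ → ℂ) :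
    ((lev J L g).submatrix Prod.swap Prod.swap : TMat L J) = lev L J g := by
  rw [lev, show (Prod.swap : Fin (L + 1) × Fin (J + 1) → _) = Equiv.prodComm _ _ from rfl,
    submatrix_diagonal_equiv, lev]
  congr 1
  ext p
  simp [add_comm]

theorem flip_tket (M : TMat J L) (i j : ℤ) :
    (M.submatrix Prod.swap Prod.swap : TMat L J) *ᵥ tket η L J i j =
      (M *ᵥ tket η J L j i) ∘ Prod.swap := by
  have := submatrix_mulVec_equiv M (tket η L J i j) (Prod.swap) (Equiv.prodComm (Fin (L + 1)) _)
  simp only [Equiv.coe_prodComm] at this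
  rw [show (Prod.swap : Fin (L + 1) × Fin (J + 1) → _) = Equiv.prodComm _ _ from rfl] at this ⊢
  rw [this]
  congr 2
  ext p
  simp [tket, mul_comm]

theorem tket_comp_swap (i j : ℤ) : tket η J L j i ∘ Prod.swap = tket η L J i j := by
  ext p
  simp [tket, mul_comm]

/-- The flip exchanges the two coproducts and moves `z` to the other factor, which amounts to `z⁻¹`
together with an overall factor `z`; hence `w` becomes `z * w`. -/
theorem flip_dynRaise (hz0 : z ≠ 0) (X w : ℂ) :
    ((dynRaise η X z⁻¹ (z * w) J L).submatrix Prod.swap Prod.swap : TMat L J) =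
      z • dynRaise' η X z w L J := by
  have e1 : ((raisePos η J L z).submatrix Prod.swap Prod.swap : TMat L J) =
      z • raiseNeg η L J z⁻¹ := by
    rw [raisePos, flip_skewSum, raiseNeg, neg_div]
    have := skewSum_smul_snd (η := η) (L := L) (J := J) (inv_ne_zero hz0) (-(1 / 2)) (raising η L)
      (raising η J)
    rw [inv_inv] at this
    exact this
  have e2 : ((raiseNeg η J L 1).submatrix Prod.swap Prod.swap : TMat L J) = raisePos η L J 1 := by
    rw [raiseNeg, flip_skewSum, raisePos, neg_div, neg_neg, one_smul, one_smul]
  have e3 : ((lowerNeg η J L 1).submatrix Prod.swap Prod.swap : TMat L J) = lowerPos η L J 1 := by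
    rw [lowerNeg, flip_skewSum, lowerPos, neg_div, neg_neg, one_smul, one_smul]
  have eG : levG η X J L = levG η X L J := by
    ext n; simp only [levG]; ring
  have eC : levC η X z⁻¹ J L = fun n => z * levC η X z L J n := by
    ext n
    simp only [levC]
    generalize (qpow η 1 * qhalf η L ^ 2 + (qpow η 1 * qhalf η L ^ 2)⁻¹) = c1
    generalize (qpow η 1 * qhalf η J ^ 2 + (qpow η 1 * qhalf η J ^ 2)⁻¹) = c2
    rw [inv_inv]
    field_simp
    ring
  have eL : lev L J (fun n => z * levC η X z L J n) = z • lev L J (levC η X z L J) := by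
    rw [lev, lev, ← diagonal_smul]; rfl
  rw [dynRaise, dynRaise', inv_inv]
  simp only [submatrix_add, submatrix_sub, submatrix_smul, Pi.add_apply, Pi.sub_apply,
    Pi.smul_apply, flip_mul, e1, e2, e3, eG, eC, flip_lev, eL]
  simp only [mul_smul_comm, smul_mul_assoc, smul_sub, smul_add, mul_smul, mul_sub, sub_mul]
  simp only [smul_comm z]

end

/-! ### The exchange relation for the twisted `R`-matrix -/

section

variable {η : ℂ} {L J : ℕ} {z : ℂ}

/-- `dynDiag` for the opposite twist. -/
def dynDiag' (η X z w : ℂ) (L J : ℕ) : TMat L J :=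
  z⁻¹ • (dynDiag η X z⁻¹ (z * w) J L).submatrix Prod.swap Prod.swap

theorem dynDiag'_tket (h : Generic (qpow η 1)) (X z w : ℂ) (i j : ℤ) :
    dynDiag' η X z w L J *ᵥ tket η L J i j =
      (z⁻¹ * dynFst η X z⁻¹ (z * w) J L j i) • tket η L J i (j + 1) +
      (z⁻¹ * dynSnd η X z⁻¹ (z * w) J L j i) • tket η L J (i + 1) j := by
  rw [dynDiag', smul_mulVec, flip_tket, dynDiag_tket h, mul_smul, mul_smul, ← smul_add]
  congr 1
  rw [← tket_comp_swap (L := L) (J := J) i (j + 1), ← tket_comp_swap (L := L) (J := J) (i + 1) j]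
  rfl

theorem twist21_dynRaise' (h : Generic (qpow η 1)) (hz0 : z ≠ 0) {lam : ℂ}
    (hX : ∀ k : ℤ, dynX lam ≠ qpow η 1 ^ (2 * k)) (w : ℂ) :
    twist21 η lam L J * dynRaise' η (dynX lam) z w L J =
      dynDiag' η (dynX lam) z w L J * twist21 η (lam - 2 * η) L J := by
  have e := congrArg (fun M : TMat J L => (M.submatrix Prod.swap Prod.swap : TMat L J))
    (twist_dynRaise (L := J) (J := L) h (inv_ne_zero hz0) hX (z * w))
  simp only [flip_mul, flip_dynRaise hz0, mul_smul_comm] at e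
  rw [twist21, twist21, dynDiag', smul_mul_assoc, ← e, inv_smul_smul₀ hz0]

/-- `F₁₂` links `dynDiag` with `dynRaise`, the spectral `R`-matrix links `dynRaise` with
`dynRaise'`, and `F₂₁` links that with `dynDiag'`. Only the twists move `λ` to `λ - 2η`. -/
theorem twistedR_exchange (h : Generic (qpow η 1)) (hz0 : z ≠ 0) (hz : ∀ k : ℤ, z ≠ qpow η 1 ^ k)
    {lam : ℂ} (hX : ∀ k : ℤ, dynX lam ≠ qpow η 1 ^ (2 * k)) (w : ℂ) :
    twistedR η lam (spectralR η L J z) * dynDiag η (dynX lam) z w L J =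
      dynDiag' η (dynX lam) z w L J * twistedR η (lam - 2 * η) (spectralR η L J z) := by
  have hS := isSpectralR_spectralR (L := L) (J := J) h hz0 hz
  have dR := (Matrix.isUnit_iff_isUnit_det _).1 (hS.isUnit h hz0 hz (hS.mulVec_zero h))
  have dF := (Matrix.isUnit_iff_isUnit_det _).1 (isUnit_twist (L := L) (J := J) h lam)
  have dF' := (Matrix.isUnit_iff_isUnit_det _).1 (isUnit_twist (L := L) (J := J) h (lam - 2 * η))
  have e1 : (twist η lam L J)⁻¹ * dynDiag η (dynX lam) z w L J =
      dynRaise η (dynX lam) z w L J * (twist η (lam - 2 * η) L J)⁻¹ := by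
    rw [← mul_nonsing_inv_cancel_right _ (dynDiag η (dynX lam) z w L J) dF',
      ← twist_dynRaise h hz0 hX, mul_assoc, nonsing_inv_mul_cancel_left _ _ dF]
  have e2 : (spectralR η L J z)⁻¹ * dynRaise η (dynX lam) z w L J =
      dynRaise' η (dynX lam) z w L J * (spectralR η L J z)⁻¹ := by
    rw [← mul_nonsing_inv_cancel_right _ (dynRaise η (dynX lam) z w L J) dR,
      ← spectralR_dynRaise h hz0 hz, mul_assoc, nonsing_inv_mul_cancel_left _ _ dR]
  rw [twistedR, twistedR, mul_assoc, e1, ← mul_assoc, mul_assoc (twist21 _ _ _ _), e2,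
    ← mul_assoc, twist21_dynRaise' h hz0 hX]
  simp only [mul_assoc]

/-! ### Coordinates with respect to the rescaled basis -/

/-- The coordinate of a vector at `f_i ⊗ f_j`, zero out of range. -/
def coord (η : ℂ) (L J : ℕ) (i j : ℤ) : Tens L J →ₗ[ℂ] ℂ where
  toFun v := ∑ p : Fin (L + 1) × Fin (J + 1), if ((p.1 : ℕ) : ℤ) = i ∧ ((p.2 : ℕ) : ℤ) = j then
    v p / (basisScale η L p.1 * basisScale η J p.2) else 0
  map_add' v w := by
    rw [← Finset.sum_add_distrib]
    refine Finset.sum_congr rfl fun p _ => ?_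
    split_ifs
    · rw [Pi.add_apply, add_div]
    · rw [add_zero]
  map_smul' c v := by
    rw [RingHom.id_apply, smul_eq_mul, Finset.mul_sum]
    refine Finset.sum_congr rfl fun p _ => ?_
    split_ifs
    · rw [Pi.smul_apply, smul_eq_mul, mul_div_assoc]
    · rw [mul_zero]

theorem coord_apply (v : Tens L J) (p : Fin (L + 1) × Fin (J + 1)) :
    coord η L J ((p.1 : ℕ) : ℤ) ((p.2 : ℕ) : ℤ) v =
      v p / (basisScale η L p.1 * basisScale η J p.2) := by
  simp only [coord, LinearMap.coe_mk, AddHom.coe_mk]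
  rw [Finset.sum_eq_single p, if_pos ⟨rfl, rfl⟩]
  · intro r _ hr
    rw [if_neg]
    rintro ⟨h1, h2⟩
    exact hr (Prod.ext (Fin.ext (by exact_mod_cast h1)) (Fin.ext (by exact_mod_cast h2)))
  · intro hp; exact absurd (Finset.mem_univ _) hp

theorem coord_eq_zero {i j : ℤ} (hij : i < 0 ∨ (L : ℤ) < i ∨ j < 0 ∨ (J : ℤ) < j) (v : Tens L J) :
    coord η L J i j v = 0 := by
  simp only [coord, LinearMap.coe_mk, AddHom.coe_mk]
  refine Finset.sum_eq_zero fun p _ => if_neg ?_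
  have h1 := p.1.2
  have h2 := p.2.2
  rintro ⟨h3, h4⟩
  omega

theorem coord_tket (h : Generic (qpow η 1)) {i j : ℤ} (hi : 0 ≤ i ∧ i ≤ L) (hj : 0 ≤ j ∧ j ≤ J)
    (i' j' : ℤ) : coord η L J i j (tket η L J i' j') = if i = i' ∧ j = j' then 1 else 0 := by
  obtain ⟨m, rfl⟩ := Int.eq_ofNat_of_zero_le hi.1
  obtain ⟨n, rfl⟩ := Int.eq_ofNat_of_zero_le hj.1
  have e := coord_apply (η := η) (tket η L J i' j')
    (⟨m, by omega⟩, ⟨n, by omega⟩)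
  simp only at e
  rw [e]
  have h1 := basisScale_ne_zero h L m
  have h2 := basisScale_ne_zero h J n
  simp only [tket, ket]
  by_cases a : (m : ℤ) = i'
  · by_cases b : (n : ℤ) = j'
    · simp only [a, b, if_true, and_self]; exact div_self (mul_ne_zero h1 h2)
    · simp [a, b]
  · simp [a]

theorem tens_induction (h : Generic (qpow η 1)) {f g : Tens L J →ₗ[ℂ] ℂ}
    (H : ∀ i j : ℕ, i ≤ L → j ≤ J → f (tket η L J i j) = g (tket η L J i j)) : f = g := by
  refine LinearMap.pi_ext' fun p => LinearMap.ext_ring ?_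
  have := H p.1 p.2 (Nat.lt_succ_iff.1 p.1.2) (Nat.lt_succ_iff.1 p.2.2)
  rw [tket_nat, map_smul, map_smul] at this
  exact smul_right_injective ℂ
    (mul_ne_zero (basisScale_ne_zero h L p.1) (basisScale_ne_zero h J p.2)) this

theorem coord_dynDiag' (h : Generic (qpow η 1)) (X z w : ℂ) {i j : ℤ} (hi : 0 ≤ i ∧ i ≤ L)
    (hj : 0 ≤ j ∧ j ≤ J) (v : Tens L J) :
    coord η L J i j (dynDiag' η X z w L J *ᵥ v) =
      z⁻¹ * dynFst η X z⁻¹ (z * w) J L (j - 1) i * coord η L J i (j - 1) v +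
      z⁻¹ * dynSnd η X z⁻¹ (z * w) J L j (i - 1) * coord η L J (i - 1) j v := by
  have key : (coord η L J i j) ∘ₗ (dynDiag' η X z w L J).mulVecLin =
      (z⁻¹ * dynFst η X z⁻¹ (z * w) J L (j - 1) i) • coord η L J i (j - 1) +
      (z⁻¹ * dynSnd η X z⁻¹ (z * w) J L j (i - 1)) • coord η L J (i - 1) j := by
    refine tens_induction h fun i' j' hi' hj' => ?_
    simp only [LinearMap.comp_apply, mulVecLin_apply, LinearMap.add_apply, LinearMap.smul_apply,
      smul_eq_mul]
    rw [dynDiag'_tket h, map_add, map_smul, map_smul, smul_eq_mul, smul_eq_mul,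
      coord_tket h hi hj, coord_tket h hi hj]
    congr 1
    · by_cases e : i = i' ∧ j = j' + 1
      · rw [if_pos e, coord_tket h hi (by omega), if_pos (by omega), e.1, e.2,
          add_sub_cancel_right]
      · rw [if_neg e, mul_zero]
        by_cases hj2 : 0 ≤ j - 1
        · rw [coord_tket h hi (by omega), if_neg (by omega), mul_zero]
        · rw [coord_eq_zero (by omega), mul_zero]
    · by_cases e : i = i' + 1 ∧ j = j'
      · rw [if_pos e, coord_tket h (by omega) hj, if_pos (by omega), e.1, e.2,
          add_sub_cancel_right]
      · rw [if_neg e, mul_zero]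
        by_cases hi2 : 0 ≤ i - 1
        · rw [coord_tket h (by omega) hj, if_neg (by omega), mul_zero]
        · rw [coord_eq_zero (by omega), mul_zero]
  exact LinearMap.congr_fun key v

/-- The matrix coefficients of the twisted `R`-matrix in the rescaled basis. -/
def rCoeff (η lam z : ℂ) (L J : ℕ) (i₁ j₁ i₂ j₂ : ℤ) : ℂ :=
  coord η L J i₁ j₁ (twistedR η lam (spectralR η L J z) *ᵥ tket η L J i₂ j₂)

/-- A four-term relation for every `w`; the freedom in `w` is used later to remove one of the terms
on the left. -/
theorem rCoeff_exchange (h : Generic (qpow η 1)) (hz0 : z ≠ 0) (hz : ∀ k : ℤ, z ≠ qpow η 1 ^ k)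
    {lam : ℂ} (hX : ∀ k : ℤ, dynX lam ≠ qpow η 1 ^ (2 * k)) (w : ℂ) {i₁ j₁ : ℤ}
    (hi : 0 ≤ i₁ ∧ i₁ ≤ L) (hj : 0 ≤ j₁ ∧ j₁ ≤ J) (i₂ j₂ : ℤ) :
    dynFst η (dynX lam) z w L J i₂ j₂ * rCoeff η lam z L J i₁ j₁ (i₂ + 1) j₂ +
      dynSnd η (dynX lam) z w L J i₂ j₂ * rCoeff η lam z L J i₁ j₁ i₂ (j₂ + 1) =
    z⁻¹ * dynFst η (dynX lam) z⁻¹ (z * w) J L (j₁ - 1) i₁ *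
        rCoeff η (lam - 2 * η) z L J i₁ (j₁ - 1) i₂ j₂ +
      z⁻¹ * dynSnd η (dynX lam) z⁻¹ (z * w) J L j₁ (i₁ - 1) *
        rCoeff η (lam - 2 * η) z L J (i₁ - 1) j₁ i₂ j₂ := by
  have e := congrArg (fun M => coord η L J i₁ j₁ (M *ᵥ tket η L J i₂ j₂))
    (twistedR_exchange (L := L) (J := J) h hz0 hz hX w)
  simp only [← mulVec_mulVec, coord_dynDiag' h _ _ _ hi hj, dynDiag_tket h, mulVec_add, mulVec_smul,
    map_add, map_smul, smul_eq_mul] at e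
  exact e

theorem twist_tket_zero (h : Generic (qpow η 1)) (lam : ℂ) (j : ℤ) :
    twist η lam L J *ᵥ tket η L J 0 j = tket η L J 0 j := by
  rw [twist_tket h lam _ _ (N := L + 1) le_rfl, Finset.sum_range_succ']
  simp only [Nat.cast_zero, sub_zero, add_zero, twistCoeff_zero, one_smul]
  refine (congrArg (· + tket η L J 0 j) (Finset.sum_eq_zero fun k _ => ?_)).trans (zero_add _)
  rw [tket_eq_zero _ _ _ (by omega), smul_zero]

theorem twistedR_tket_zero (h : Generic (qpow η 1)) (hz0 : z ≠ 0) (hz : ∀ k : ℤ, z ≠ qpow η 1 ^ k)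
    (lam : ℂ) : twistedR η lam (spectralR η L J z) *ᵥ tket η L J 0 0 = tket η L J 0 0 := by
  have hS := isSpectralR_spectralR (L := L) (J := J) h hz0 hz
  have h00 := hS.mulVec_zero h
  have dR := (Matrix.isUnit_iff_isUnit_det _).1 (hS.isUnit h hz0 hz h00)
  have dF := (Matrix.isUnit_iff_isUnit_det _).1 (isUnit_twist (L := L) (J := J) h lam)
  have e1 : (twist η lam L J)⁻¹ *ᵥ tket η L J 0 0 = tket η L J 0 0 := by
    conv_lhs => rw [← twist_tket_zero h lam 0]
    rw [mulVec_mulVec, nonsing_inv_mul _ dF, one_mulVec]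
  have e2 : (spectralR η L J z)⁻¹ *ᵥ tket η L J 0 0 = tket η L J 0 0 := by
    conv_lhs => rw [← h00]
    rw [mulVec_mulVec, nonsing_inv_mul _ dR, one_mulVec]
  rw [twistedR, ← mulVec_mulVec, ← mulVec_mulVec, e1, e2, twist21, flip_tket,
    twist_tket_zero h, tket_comp_swap]

end

/-! ### Pochhammer symbols with integer index -/

section Pochhammer

variable {a h : ℂ}

theorem qPoch_zero (a h : ℂ) : qPoch a h 0 = 1 := by
  change ∏ j ∈ Finset.range 0, (1 - h ^ j * a) = 1
  simp

theorem qPoch_nat (a h : ℂ) (n : ℕ) : qPoch a h n = ∏ j ∈ Finset.range n, (1 - h ^ j * a) := rfl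

theorem qPoch_neg_nat (a h : ℂ) (n : ℕ) :
    qPoch a h (-n) = ∏ j ∈ Finset.range n, 1 / (1 - h ^ (-((j : ℤ) + 1)) * a) := by
  rcases n with _ | n
  · simpa using qPoch_zero a h
  · rfl

/-- For negative index the symbol is a product of reciprocals, so the new factor has to be nonzero
for the cancellation. -/
theorem qPoch_add_one (n : ℤ) (H : 0 ≤ n ∨ 1 - h ^ n * a ≠ 0) :
    qPoch a h (n + 1) = qPoch a h n * (1 - h ^ n * a) := by
  rcases Int.le_total 0 n with hn | hn
  · obtain ⟨m, rfl⟩ := Int.eq_ofNat_of_zero_le hn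
    rw [show (m : ℤ) + 1 = (m + 1 : ℕ) by push_cast; ring, qPoch_nat, qPoch_nat,
      Finset.prod_range_succ, zpow_natCast]
  · obtain ⟨m, hm⟩ := Int.eq_ofNat_of_zero_le (neg_nonneg.2 hn)
    obtain rfl : n = -(m : ℤ) := by omega
    rcases m with _ | m
    · rw [Nat.cast_zero, neg_zero, zero_add, zpow_zero, one_mul, qPoch_zero, one_mul]
      change qPoch a h ((1 : ℕ) : ℤ) = _
      rw [qPoch_nat]; simp
    · have hne : 1 - h ^ (-((m + 1 : ℕ) : ℤ)) * a ≠ 0 := H.resolve_left (by push_cast; omega)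
      rw [show -((m + 1 : ℕ) : ℤ) + 1 = -(m : ℤ) by push_cast; ring, qPoch_neg_nat, qPoch_neg_nat,
        Finset.prod_range_succ, mul_assoc]
      push_cast at hne ⊢
      rw [one_div_mul_cancel hne, mul_one]

theorem qPoch_add_one' (hh : h ≠ 0) (n : ℤ) (H : 0 ≤ n ∨ 1 - a ≠ 0) :
    qPoch a h (n + 1) = (1 - a) * qPoch (h * a) h n := by
  rcases Int.le_total 0 n with hn | hn
  · obtain ⟨m, rfl⟩ := Int.eq_ofNat_of_zero_le hn
    rw [show (m : ℤ) + 1 = (m + 1 : ℕ) by push_cast; ring, qPoch_nat, qPoch_nat,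
      Finset.prod_range_succ', pow_zero, one_mul, mul_comm]
    simp only [pow_succ, mul_assoc]
  · obtain ⟨m, hm⟩ := Int.eq_ofNat_of_zero_le (neg_nonneg.2 hn)
    obtain rfl : n = -(m : ℤ) := by omega
    rcases m with _ | m
    · rw [Nat.cast_zero, neg_zero, zero_add, qPoch_zero, mul_one]
      change qPoch a h ((1 : ℕ) : ℤ) = _
      rw [qPoch_nat]; simp
    · have hne : 1 - a ≠ 0 := H.resolve_left (by push_cast; omega)
      rw [show -((m + 1 : ℕ) : ℤ) + 1 = -(m : ℤ) by push_cast; ring, qPoch_neg_nat, qPoch_neg_nat,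
        Finset.prod_range_succ', mul_comm, mul_assoc]
      have e0 : h ^ (-(((0 : ℕ) : ℤ) + 1)) * (h * a) = a := by
        rw [← mul_assoc]; simp [hh]
      rw [e0, one_div_mul_cancel hne, mul_one]
      refine Finset.prod_congr rfl fun j _ => ?_
      congr 2
      rw [← mul_assoc]
      congr 1
      rw [← zpow_add_one₀ hh]
      exact congrArg _ (by push_cast; ring)

theorem qPoch_ne_zero (H : ∀ j : ℤ, 1 - h ^ j * a ≠ 0) (n : ℤ) : qPoch a h n ≠ 0 := by
  rcases Int.eq_nat_or_neg n with ⟨m, rfl | rfl⟩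
  · rw [qPoch_nat]
    refine Finset.prod_ne_zero_iff.2 fun j _ => ?_
    exact_mod_cast H j
  · rw [qPoch_neg_nat]
    exact Finset.prod_ne_zero_iff.2 fun j _ => one_div_ne_zero (H _)

/-- Shifting the base of a Pochhammer symbol. -/
theorem qPoch_shift (hh : h ≠ 0) (H : ∀ j : ℤ, 1 - h ^ j * a ≠ 0) (n : ℤ) :
    qPoch (h * a) h n = qPoch a h n * (1 - h ^ n * a) / (1 - a) := by
  have h0 : 1 - a ≠ 0 := by simpa using H 0
  rw [eq_div_iff h0, mul_comm, ← qPoch_add_one' hh n (Or.inr h0), qPoch_add_one n (Or.inr (H n))]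

end Pochhammer

/-! ### The ground state transformation -/

/-- The ground state transformation without its factorials. -/
def gauge (η X : ℂ) (L₁ L₂ : ℕ) (m n : ℤ) : ℂ :=
  (qhalf η L₁ * qhalf η L₂ ^ 2) ^ m * qhalf η L₂ ^ n /
    (qPoch (X * (qhalf η L₁ ^ 4)⁻¹ * (qpow η 1 ^ m) ^ 4 * qpow η 1 ^ 2) (qpow η 1 ^ 2) (L₁ - m) *
      qPoch (X * (qhalf η L₁ ^ 4 * qhalf η L₂ ^ 4)⁻¹ * (qpow η 1 ^ m * qpow η 1 ^ n) ^ 4 *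
        qpow η 1 ^ 2) (qpow η 1 ^ 2) (L₂ - n))

section Gauge

variable {η X : ℂ} {L₁ L₂ : ℕ}

theorem qhalf_pow_four (η : ℂ) (L : ℕ) : qhalf η L ^ 4 = qpow η 1 ^ (2 * (L : ℤ)) := by
  rw [show qhalf η L ^ 4 = (qhalf η L ^ 2) ^ 2 by ring, qhalf_sq, two_mul,
    zpow_add₀ (qpow_ne_zero _ _)]
  ring

theorem gauge_fst_ne (hX : ∀ k : ℤ, X ≠ qpow η 1 ^ (2 * k)) (L₁ : ℕ) (m j : ℤ) :
    1 - (qpow η 1 ^ 2) ^ j * (X * (qhalf η L₁ ^ 4)⁻¹ * (qpow η 1 ^ m) ^ 4 * qpow η 1 ^ 2) ≠ 0 := by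
  have h0 := qpow_ne_zero η 1
  have := dyn_ne hX (j + 2 * m + 1 - L₁)
  convert this using 2
  rw [qhalf_pow_four, ← zpow_natCast _ 2, ← zpow_natCast _ 4, ← _root_.zpow_mul, ← _root_.zpow_mul,
    ← _root_.zpow_neg, mul_comm, mul_assoc, mul_assoc, mul_assoc, ← zpow_add₀ h0, ← zpow_add₀ h0,
    ← zpow_add₀ h0]
  congr 2
  push_cast
  ring

theorem gauge_snd_ne (hX : ∀ k : ℤ, X ≠ qpow η 1 ^ (2 * k)) (L₁ L₂ : ℕ) (m n j : ℤ) :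
    1 - (qpow η 1 ^ 2) ^ j * (X * (qhalf η L₁ ^ 4 * qhalf η L₂ ^ 4)⁻¹ *
      (qpow η 1 ^ m * qpow η 1 ^ n) ^ 4 * qpow η 1 ^ 2) ≠ 0 := by
  have h0 := qpow_ne_zero η 1
  have := dyn_ne hX (j + 2 * (m + n) + 1 - L₁ - L₂)
  convert this using 2
  rw [qhalf_pow_four, qhalf_pow_four, ← zpow_add₀ h0, ← zpow_add₀ h0, ← zpow_natCast _ 2,
    ← zpow_natCast _ 4, ← _root_.zpow_mul, ← _root_.zpow_mul,
    ← _root_.zpow_neg, mul_comm, mul_assoc, mul_assoc, mul_assoc, ← zpow_add₀ h0, ← zpow_add₀ h0,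
    ← zpow_add₀ h0]
  congr 2
  push_cast
  ring

theorem gauge_ne_zero (hX : ∀ k : ℤ, X ≠ qpow η 1 ^ (2 * k)) (L₁ L₂ : ℕ) (m n : ℤ) :
    gauge η X L₁ L₂ m n ≠ 0 :=
  div_ne_zero (mul_ne_zero (zpow_ne_zero _ (mul_ne_zero (qhalf_ne_zero _ _)
    (pow_ne_zero _ (qhalf_ne_zero _ _)))) (zpow_ne_zero _ (qhalf_ne_zero _ _)))
    (mul_ne_zero (qPoch_ne_zero (gauge_fst_ne hX L₁ m) _)
      (qPoch_ne_zero (gauge_snd_ne hX L₁ L₂ m n) _))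

theorem shift_ne (hX : ∀ k : ℤ, X ≠ qpow η 1 ^ (2 * k)) (k : ℤ) :
    X * qpow η 1 ^ 2 ≠ qpow η 1 ^ (2 * k) := fun e => by
  apply hX (k - 1)
  have h0 := qpow_ne_zero η 1
  rw [mul_sub, zpow_sub₀ h0, ← e, mul_one, show qpow η 1 ^ (2 : ℤ) = qpow η 1 ^ 2 from
    zpow_ofNat _ 2]
  field_simp

/-- Together with `n → n + 1`, the shift of `λ` changes the arguments of the two Pochhammer symbols
by at most one step in base `q²`, so the quotient is a finite product of linear factors. -/
theorem gauge_snd_succ (hX : ∀ k : ℤ, X ≠ qpow η 1 ^ (2 * k)) (L₁ L₂ : ℕ) (m n : ℤ) :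
    gauge η X L₁ L₂ m (n + 1) = gauge η (X * qpow η 1 ^ 2) L₁ L₂ m n *
      (qhalf η L₂ * (1 - X * (qpow η 1 ^ m) ^ 2 * qpow η 1 ^ 2) *
        (1 - X * (qhalf η L₁ ^ 4 * qhalf η L₂ ^ 4)⁻¹ * (qpow η 1 ^ m * qpow η 1 ^ n) ^ 4 *
          qpow η 1 ^ 4) /
        (1 - X * (qhalf η L₁ ^ 4)⁻¹ * (qpow η 1 ^ m) ^ 4 * qpow η 1 ^ 2)) := by
  have h0 := qpow_ne_zero η 1
  have hh : qpow η 1 ^ 2 ≠ 0 := pow_ne_zero 2 h0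
  have ha := qhalf_ne_zero η L₁
  have hb := qhalf_ne_zero η L₂
  have d1 := gauge_fst_ne hX L₁ m
  have d2 := gauge_snd_ne (shift_ne hX) L₁ L₂ m n
  have e1 : X * qpow η 1 ^ 2 * (qhalf η L₁ ^ 4)⁻¹ * (qpow η 1 ^ m) ^ 4 * qpow η 1 ^ 2 =
      qpow η 1 ^ 2 * (X * (qhalf η L₁ ^ 4)⁻¹ * (qpow η 1 ^ m) ^ 4 * qpow η 1 ^ 2) := by ring
  have e2 : X * (qhalf η L₁ ^ 4 * qhalf η L₂ ^ 4)⁻¹ * (qpow η 1 ^ m * qpow η 1 ^ (n + 1)) ^ 4 *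
        qpow η 1 ^ 2 = qpow η 1 ^ 2 * (X * qpow η 1 ^ 2 * (qhalf η L₁ ^ 4 * qhalf η L₂ ^ 4)⁻¹ *
          (qpow η 1 ^ m * qpow η 1 ^ n) ^ 4 * qpow η 1 ^ 2) := by
    rw [zpow_add_one₀ h0]; ring
  have p1 := qPoch_ne_zero d1 (L₁ - m)
  have p2 := qPoch_ne_zero d2 (L₂ - n)
  have r1 := qPoch_shift hh d1 (L₁ - m)
  have d1' := d1 (L₁ - m)
  have d2' := d2 0
  have d10 := d1 0
  rw [zpow_zero, one_mul] at d2' d10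
  have r2 := qPoch_add_one' hh (L₂ - (n + 1)) (Or.inr d2')
  rw [show (L₂ : ℤ) - (n + 1) + 1 = L₂ - n by ring] at r2
  have e3 : (qpow η 1 ^ 2) ^ ((L₁ : ℤ) - m) * (X * (qhalf η L₁ ^ 4)⁻¹ * (qpow η 1 ^ m) ^ 4 *
      qpow η 1 ^ 2) = X * (qpow η 1 ^ m) ^ 2 * qpow η 1 ^ 2 := by
    rw [qhalf_pow_four, zpow_sub₀ hh, _root_.zpow_mul, show qpow η 1 ^ (2 : ℤ) = qpow η 1 ^ 2 from
      zpow_ofNat _ 2, show (qpow η 1 ^ 2) ^ m = (qpow η 1 ^ m) ^ 2 by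
        rw [← zpow_natCast, ← zpow_natCast, ← _root_.zpow_mul, ← _root_.zpow_mul, mul_comm]]
    field_simp
  rw [gauge, gauge, e1, e2, r1, e3, r2]
  rw [e3] at d1'
  rw [r2] at p2
  have p2' := right_ne_zero_of_mul p2
  have e4 : X * (qhalf η L₁ ^ 4 * qhalf η L₂ ^ 4)⁻¹ * (qpow η 1 ^ m * qpow η 1 ^ n) ^ 4 *
      qpow η 1 ^ 4 = X * qpow η 1 ^ 2 * (qhalf η L₁ ^ 4 * qhalf η L₂ ^ 4)⁻¹ *
        (qpow η 1 ^ m * qpow η 1 ^ n) ^ 4 * qpow η 1 ^ 2 := by ring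
  rw [e4]
  generalize 1 - X * qpow η 1 ^ 2 * (qhalf η L₁ ^ 4 * qhalf η L₂ ^ 4)⁻¹ *
        (qpow η 1 ^ m * qpow η 1 ^ n) ^ 4 * qpow η 1 ^ 2 = D2 at *
  generalize 1 - X * (qhalf η L₁ ^ 4)⁻¹ * (qpow η 1 ^ m) ^ 4 * qpow η 1 ^ 2 = D1 at *
  generalize 1 - X * (qpow η 1 ^ m) ^ 2 * qpow η 1 ^ 2 = D3 at *
  generalize qPoch _ _ ((L₁ : ℤ) - m) = P1 at *
  generalize qPoch _ _ ((L₂ : ℤ) - (n + 1)) = P2 at *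
  rw [zpow_add_one₀ hb]
  field_simp

theorem gauge_fst_succ (hX : ∀ k : ℤ, X ≠ qpow η 1 ^ (2 * k)) (L₁ L₂ : ℕ) (m n : ℤ) :
    gauge η X L₁ L₂ (m + 1) n = gauge η (X * qpow η 1 ^ 2) L₁ L₂ m n *
      (qhalf η L₁ * qhalf η L₂ ^ 2 *
        (1 - X * (qhalf η L₁ ^ 4)⁻¹ * (qpow η 1 ^ m) ^ 4 * qpow η 1 ^ 4) *
        (1 - X * (qhalf η L₁ ^ 4 * qhalf η L₂ ^ 4)⁻¹ * (qpow η 1 ^ m * qpow η 1 ^ n) ^ 4 *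
          qpow η 1 ^ 4) /
        (1 - X * (qhalf η L₁ ^ 4)⁻¹ * (qpow η 1 ^ m) ^ 4 * (qpow η 1 ^ n) ^ 2 * qpow η 1 ^ 4)) := by
  have h0 := qpow_ne_zero η 1
  have hh : qpow η 1 ^ 2 ≠ 0 := pow_ne_zero 2 h0
  have ha := qhalf_ne_zero η L₁
  have hb := qhalf_ne_zero η L₂
  have d1 := gauge_fst_ne (shift_ne hX) L₁ m
  have d2 := gauge_snd_ne (shift_ne hX) L₁ L₂ m n
  have e1 : X * (qhalf η L₁ ^ 4)⁻¹ * (qpow η 1 ^ (m + 1)) ^ 4 * qpow η 1 ^ 2 =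
      qpow η 1 ^ 2 * (X * qpow η 1 ^ 2 * (qhalf η L₁ ^ 4)⁻¹ * (qpow η 1 ^ m) ^ 4 *
        qpow η 1 ^ 2) := by rw [zpow_add_one₀ h0]; ring
  have e2 : X * (qhalf η L₁ ^ 4 * qhalf η L₂ ^ 4)⁻¹ * (qpow η 1 ^ (m + 1) * qpow η 1 ^ n) ^ 4 *
        qpow η 1 ^ 2 = qpow η 1 ^ 2 * (X * qpow η 1 ^ 2 * (qhalf η L₁ ^ 4 * qhalf η L₂ ^ 4)⁻¹ *
          (qpow η 1 ^ m * qpow η 1 ^ n) ^ 4 * qpow η 1 ^ 2) := by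
    rw [zpow_add_one₀ h0]; ring
  have p1 := qPoch_ne_zero d1 (L₁ - m)
  have p2 := qPoch_ne_zero d2 (L₂ - n)
  have d2' := d2 (L₂ - n)
  have d20 := d2 0
  have d10 := d1 0
  rw [zpow_zero, one_mul] at d20 d10
  have r1 := qPoch_add_one' hh (L₁ - (m + 1)) (Or.inr d10)
  have r2 := qPoch_shift hh d2 (L₂ - n)
  rw [show (L₁ : ℤ) - (m + 1) + 1 = L₁ - m by ring] at r1
  have e3 : (qpow η 1 ^ 2) ^ ((L₂ : ℤ) - n) * (X * qpow η 1 ^ 2 *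
      (qhalf η L₁ ^ 4 * qhalf η L₂ ^ 4)⁻¹ * (qpow η 1 ^ m * qpow η 1 ^ n) ^ 4 * qpow η 1 ^ 2) =
      X * (qhalf η L₁ ^ 4)⁻¹ * (qpow η 1 ^ m) ^ 4 * (qpow η 1 ^ n) ^ 2 * qpow η 1 ^ 4 := by
    rw [qhalf_pow_four η L₂, zpow_sub₀ hh, _root_.zpow_mul,
      show qpow η 1 ^ (2 : ℤ) = qpow η 1 ^ 2 from
      zpow_ofNat _ 2, show (qpow η 1 ^ 2) ^ n = (qpow η 1 ^ n) ^ 2 by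
        rw [← zpow_natCast, ← zpow_natCast, ← _root_.zpow_mul, ← _root_.zpow_mul, mul_comm]]
    field_simp
  rw [gauge, gauge, e1, e2, r2, e3, r1]
  rw [e3] at d2'
  rw [r1] at p1
  have p1' := right_ne_zero_of_mul p1
  have e4 : X * (qhalf η L₁ ^ 4 * qhalf η L₂ ^ 4)⁻¹ * (qpow η 1 ^ m * qpow η 1 ^ n) ^ 4 *
      qpow η 1 ^ 4 = X * qpow η 1 ^ 2 * (qhalf η L₁ ^ 4 * qhalf η L₂ ^ 4)⁻¹ *
        (qpow η 1 ^ m * qpow η 1 ^ n) ^ 4 * qpow η 1 ^ 2 := by ring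
  have e5 : X * (qhalf η L₁ ^ 4)⁻¹ * (qpow η 1 ^ m) ^ 4 * qpow η 1 ^ 4 =
      X * qpow η 1 ^ 2 * (qhalf η L₁ ^ 4)⁻¹ * (qpow η 1 ^ m) ^ 4 * qpow η 1 ^ 2 := by ring
  rw [e4, e5]
  generalize 1 - X * qpow η 1 ^ 2 * (qhalf η L₁ ^ 4 * qhalf η L₂ ^ 4)⁻¹ *
        (qpow η 1 ^ m * qpow η 1 ^ n) ^ 4 * qpow η 1 ^ 2 = D2 at *
  generalize 1 - X * qpow η 1 ^ 2 * (qhalf η L₁ ^ 4)⁻¹ * (qpow η 1 ^ m) ^ 4 * qpow η 1 ^ 2 = D1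
    at *
  generalize 1 - X * (qhalf η L₁ ^ 4)⁻¹ * (qpow η 1 ^ m) ^ 4 * (qpow η 1 ^ n) ^ 2 * qpow η 1 ^ 4 =
    D3 at *
  generalize qPoch _ _ ((L₂ : ℤ) - n) = P2 at *
  generalize qPoch _ _ ((L₁ : ℤ) - (m + 1)) = P1 at *
  rw [zpow_add_one₀ (mul_ne_zero ha (pow_ne_zero 2 hb))]
  field_simp

theorem groundState_eq (η lam : ℂ) (L₁ L₂ : ℕ) : groundState η lam L₁ L₂ =
    Matrix.diagonal fun p => (qfactSqrt η (L₁ - p.1) * qfactSqrt η (L₂ - p.2) * qfactSqrt η p.2 *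
      qfactSqrt η p.1)⁻¹ * gauge η (dynX lam) L₁ L₂ (p.1 : ℕ) (p.2 : ℕ) := by
  rw [groundState]
  congr 1
  ext p
  have e0 : qpow η 2 = qpow η 1 ^ 2 := by
    have := qpow_nat η 2
    exact_mod_cast this
  have e1 : qpow η (((L₁ : ℂ) / 2 + L₂) * ((p.1 : ℕ) : ℂ) + (L₂ : ℂ) / 2 * ((p.2 : ℕ) : ℂ)) =
      (qhalf η L₁ * qhalf η L₂ ^ 2) ^ (((p.1 : ℕ)) : ℤ) * qhalf η L₂ ^ (((p.2 : ℕ)) : ℤ) := by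
    rw [← zpow_natCast _ 2, qhalf, qhalf, ← qpow_int_mul, ← qpow_add, ← qpow_int_mul,
      ← qpow_int_mul, ← qpow_add]
    congr 1
    push_cast
    ring
  have e2 : dynX lam * qpow η (4 * ((p.1 : ℕ) : ℂ) - 2 * L₁ + 2) =
      dynX lam * (qhalf η L₁ ^ 4)⁻¹ * (qpow η 1 ^ (((p.1 : ℕ)) : ℤ)) ^ 4 * qpow η 1 ^ 2 := by
    rw [mul_assoc, mul_assoc, qhalf_pow_four, ← zpow_natCast _ 2, ← zpow_natCast _ 4,
      ← _root_.zpow_mul, ← _root_.zpow_neg, ← zpow_add₀ (qpow_ne_zero _ _),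
      ← zpow_add₀ (qpow_ne_zero _ _), ← qpow_int]
    congr 2
    push_cast
    ring
  have e3 : dynX lam * qpow η (4 * (((p.1 : ℕ) : ℂ) + ((p.2 : ℕ) : ℂ)) - 2 * ((L₁ : ℂ) + L₂) + 2) =
      dynX lam * (qhalf η L₁ ^ 4 * qhalf η L₂ ^ 4)⁻¹ *
        (qpow η 1 ^ (((p.1 : ℕ)) : ℤ) * qpow η 1 ^ (((p.2 : ℕ)) : ℤ)) ^ 4 * qpow η 1 ^ 2 := by
    rw [mul_assoc, mul_assoc, qhalf_pow_four, qhalf_pow_four, ← zpow_add₀ (qpow_ne_zero _ _),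
      ← zpow_add₀ (qpow_ne_zero _ _), ← zpow_natCast _ 2, ← zpow_natCast _ 4,
      ← _root_.zpow_mul, ← _root_.zpow_neg, ← zpow_add₀ (qpow_ne_zero _ _),
      ← zpow_add₀ (qpow_ne_zero _ _), ← qpow_int]
    congr 2
    push_cast
    ring
  rw [gauge, e0, e1, e2, e3, mul_div_assoc]

/-- The square roots of factorials in the ground state transformation cancel against the rescaling
of the basis; only `gauge` survives. -/
theorem stochS_eq (h : Generic (qpow η 1)) {lam z : ℂ} {L J : ℕ}
    (hX : ∀ k : ℤ, dynX lam ≠ qpow η 1 ^ (2 * k)) (i₁ i₂ : Fin (L + 1)) (j₁ j₂ : Fin (J + 1)) :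
    stochS η lam (spectralR η L J z) (i₁, j₁) (i₂, j₂) =
      rCoeff η lam z L J (i₁ : ℕ) (j₁ : ℕ) (i₂ : ℕ) (j₂ : ℕ) *
        gauge η (dynX lam) L J (i₂ : ℕ) (j₂ : ℕ) / gauge η (dynX lam) J L (j₁ : ℕ) (i₁ : ℕ) := by
  have eR : rCoeff η lam z L J (i₁ : ℕ) (j₁ : ℕ) (i₂ : ℕ) (j₂ : ℕ) =
      twistedR η lam (spectralR η L J z) (i₁, j₁) (i₂, j₂) *
        (basisScale η L i₂ * basisScale η J j₂) / (basisScale η L i₁ * basisScale η J j₁) := by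
    rw [rCoeff, tket_nat η ((i₂, j₂) : Fin (L + 1) × Fin (J + 1)),
      coord_apply _ ((i₁, j₁) : Fin (L + 1) × Fin (J + 1)), mulVec_smul, mulVec_single_one]
    simp only [Pi.smul_apply, smul_eq_mul, col_apply]
    rw [mul_comm (_ * _) (twistedR _ _ _ _ _)]
  have f := qfactSqrt_ne_zero h
  have g1 := gauge_ne_zero hX J L (j₁ : ℕ) (i₁ : ℕ)
  rw [eR, stochS, checkS, submatrix_apply, id, groundState_eq, groundState_eq, inv_diagonal,
    mul_diagonal, diagonal_mul, checkR, submatrix_apply, id, Prod.swap_prod_mk, Prod.swap_prod_mk]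
  have hu : IsUnit (fun p : Fin (J + 1) × Fin (L + 1) => (qfactSqrt η (J - p.1) *
      qfactSqrt η (L - p.2) * qfactSqrt η p.2 * qfactSqrt η p.1)⁻¹ *
        gauge η (dynX lam) J L (p.1 : ℕ) (p.2 : ℕ)) := by
    rw [Pi.isUnit_iff]
    intro p
    rw [isUnit_iff_ne_zero]
    exact mul_ne_zero (inv_ne_zero (mul_ne_zero (mul_ne_zero (mul_ne_zero (f _) (f _)) (f _))
      (f _))) (gauge_ne_zero hX _ _ _ _)
  have e := congrFun (Ring.inverse_mul_cancel _ hu) (j₁, i₁)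
  simp only [Pi.mul_apply, Pi.one_apply] at e
  rw [eq_inv_of_mul_eq_one_left e, basisScale, basisScale, basisScale, basisScale]
  have f1 := f L
  have f2 := f J
  have f3 := f (L - i₁)
  have f4 := f (J - j₁)
  have f5 := f (L - i₂)
  have f6 := f (J - j₂)
  have f7 := f i₁
  have f8 := f i₂
  have f9 := f j₁
  have f10 := f j₂
  field_simp

end Gauge

/-! ### The summands of the fused weights -/

/-- `(h ^ n x; h)_m`. -/
def qp (h x : ℂ) (n m : ℤ) : ℂ := qPoch (h ^ n * x) h m

/-- `1 - h ^ n x`. -/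
def lin (h x : ℂ) (n : ℤ) : ℂ := 1 - h ^ n * x

section Factors

variable {h x : ℂ}

theorem qp_zero (h x : ℂ) (n : ℤ) : qp h x n 0 = 1 := qPoch_zero _ _

/-- The indices are free variables tied by equations, so that the rule applies to any integer
expressions for them. -/
theorem qp_succ (hh : h ≠ 0) {n n' m m' : ℤ} (hn : n' = n) (hm : m' = m + 1)
    (H : 0 ≤ m ∨ lin h x (n + m) ≠ 0) : qp h x n' m' = qp h x n m * lin h x (n + m) := by
  have e : h ^ m * (h ^ n * x) = h ^ (n + m) * x := by rw [zpow_add₀ hh]; ring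
  subst hn hm
  rw [qp, qPoch_add_one m (by rw [e]; exact H), e]; rfl

theorem qp_succ' (hh : h ≠ 0) {n n' m m' : ℤ} (hn : n = n' + 1) (hm : m' = m + 1)
    (H : 0 ≤ m ∨ lin h x n' ≠ 0) : qp h x n' m' = lin h x n' * qp h x n m := by
  subst hn hm
  rw [qp, qPoch_add_one' hh m H, qp, zpow_add_one₀ hh, lin]
  congr 2
  ring

theorem qp_shift (hh : h ≠ 0) {n n' m m' : ℤ} (hn : n' = n + 1) (hm : m' = m)
    (h0 : lin h x n ≠ 0) (H : 0 ≤ m ∨ lin h x (n + m) ≠ 0) :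
    qp h x n' m' = qp h x n m * lin h x (n + m) / lin h x n := by
  rw [eq_div_iff h0, ← qp_succ hh rfl rfl H, mul_comm, hm,
    ← qp_succ' (n' := n) hh hn rfl (Or.inr h0)]

theorem qp_shift' (hh : h ≠ 0) {n n' m m' : ℤ} (hn : n = n' + 1) (hm : m' = m) (hm0 : 0 ≤ m)
    (h0 : lin h x (n' + m) ≠ 0) : qp h x n' m' = qp h x n m * lin h x n' / lin h x (n' + m) := by
  rw [eq_div_iff h0, hm, ← qp_succ hh rfl rfl (Or.inl hm0), mul_comm,
    ← qp_succ' (n' := n') hh hn rfl (Or.inl hm0)]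

theorem qp_congr (h x : ℂ) {n n' m m' : ℤ} (hn : n' = n) (hm : m' = m) :
    qp h x n' m' = qp h x n m := by rw [hn, hm]

theorem lin_congr (h x : ℂ) {n n' : ℤ} (hn : n' = n) : lin h x n' = lin h x n := by rw [hn]

theorem qp_ne_zero (hh : h ≠ 0) (H : ∀ n, lin h x n ≠ 0) (n m : ℤ) : qp h x n m ≠ 0 := by
  refine qPoch_ne_zero (fun j => ?_) m
  have := H (n + j)
  rwa [lin, zpow_add₀ hh, mul_comm (h ^ n), mul_assoc] at this

end Factors

/-- The monomial prefactor. -/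
def termMonomial (h S : ℂ) (L N I J M : ℤ) : ℂ :=
  h ^ ((M - I) * N) * (S * h ^ L) ^ J * ((-1) ^ M * h ^ (M * (J - N) + M * (M - 1) / 2))

/-- The part of a summand that is regular and does not vanish identically at the boundary. -/
def termCore (h Y S : ℂ) (L N I J M k e : ℤ) : ℂ :=
  termMonomial h S L N I J M * qp h S N (I - M + k) * qp h 1 (I - M + k - L) (J - k) *
    qp h Y (M - 2 * I + 1 + L + e) (I - M + k) * qp h Y (k + 1 + e) (J - k) *
    (lin h Y (2 * k - M + e) / qp h Y (k - M + e) (J + 1)) /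
    (qp h S 0 (I + J) * qp h 1 1 M * qp h Y (M - I - N + 1 + L + e) J *
      qp h Y (M - 2 * I - N + L + e) M * qp h Y (2 * M - 2 * I - N + 1 + L + e) (I - M)) *
    (h ^ k / qp h 1 1 k) * (qp h 1 (-J) k * qp h 1 (-M) k) * qp h Y (J - N + e) k *
    qp h S⁻¹ (I - M + 1 - L) k * qp h Y (-I + e) k * qp h (S⁻¹ * Y) (1 - I - N + k + e) (J - k)

/-- The part of a summand that may vanish. -/
def termEdge (h Y S : ℂ) (L N I J M k e : ℤ) : ℂ :=
  qp h 1 (I - M + 1 + k) (M - k) * qp h 1 (N - J - M + 1 + k) (M - k) *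
    qp h (S * Y) (L + k - I + e) (M - k)

section Ratios

variable {h Y S : ℂ} {L N I J m k e : ℤ}

theorem termMonomial_fst (hh : h ≠ 0) : termMonomial h S L N I J (m + 1) =
    termMonomial h S L N (I - 1) J m * -h ^ (m + J - N) := by
  -- The exponent contains integer division; adding the even number `2m` to the numerator commutes
  -- with it, whatever the parity.
  have e2 : (m + 1) * (m + 1 - 1) / 2 = m * (m - 1) / 2 + m := by
    rw [show (m + 1) * (m + 1 - 1) = m * (m - 1) + m * 2 by ring,
      Int.add_mul_ediv_right _ _ (by norm_num)]
  rw [termMonomial, termMonomial, e2, zpow_add_one₀ (by norm_num : (-1 : ℂ) ≠ 0),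
    show (m + 1 - I) * N = (m - (I - 1)) * N by ring,
    show (m + 1) * (J - N) + (m * (m - 1) / 2 + m) =
      (m * (J - N) + m * (m - 1) / 2) + (m + J - N) by ring, zpow_add₀ hh _ (m + J - N)]
  ring

theorem termMonomial_snd (hh : h ≠ 0) (hS : S ≠ 0) : termMonomial h S L N I J (m + 1) =
    termMonomial h S L N I (J - 1) m * (-h ^ N * (S * h ^ L) * h ^ (2 * m + J - N)) := by
  have e2 : (m + 1) * (m + 1 - 1) / 2 = m * (m - 1) / 2 + m := by
    rw [show (m + 1) * (m + 1 - 1) = m * (m - 1) + m * 2 by ring,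
      Int.add_mul_ediv_right _ _ (by norm_num)]
  have hz : S * h ^ L ≠ 0 := mul_ne_zero hS (zpow_ne_zero _ hh)
  have e3 : (S * h ^ L) ^ J = (S * h ^ L) ^ (J - 1) * (S * h ^ L) := by
    rw [← zpow_add_one₀ hz, sub_add_cancel]
  rw [termMonomial, termMonomial, e2, e3, zpow_add_one₀ (by norm_num : (-1 : ℂ) ≠ 0),
    show (m + 1 - I) * N = (m - I) * N + N by ring,
    show (m + 1) * (J - N) + (m * (m - 1) / 2 + m) =
      (m * (J - 1 - N) + m * (m - 1) / 2) + (2 * m + J - N) by ring,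
    zpow_add₀ hh _ (2 * m + J - N), zpow_add₀ hh _ N]
  ring

/-- The factors occurring in the ratios of summands. -/
def ratioFst (h Y S : ℂ) (L N I J m k e : ℤ) : ℂ :=
  -h ^ (m + J - N) * (lin h Y (e + J) / lin h Y (k + e)) / lin h S (I - 1 + J) / lin h 1 (1 + m) *
    (lin h Y (m + 1 - I - N + L + e) / lin h Y (m + 1 - I - N + L + e + J)) /
    lin h Y (2 * m + 1 - 2 * I - N + L + e) *
    (lin h Y (2 * m + 2 - 2 * I - N + L + e) / lin h Y (m + 1 - I - N + L + e)) *
    (lin h 1 (-(m + 1)) / lin h 1 (-(m + 1) + k)) *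
    (lin h Y (J - 1 - N + e + k) / lin h Y (J - 1 - N + e))

/-- When `M`, `I` and `e` all drop by one, the combinations `I - M`, `k - M + e` and `-I + e` do not
change, so only a bounded number of linear factors survives in the quotient. -/
theorem termCore_fst (hh : h ≠ 0) (hY : ∀ n, lin h Y n ≠ 0) (hS : ∀ n, lin h S n ≠ 0)
    (h1 : ∀ n, n ≠ 0 → lin h 1 n ≠ 0) (hm : 0 ≤ m) (hk : 0 ≤ k) (hkm : k ≤ m) :
    termCore h Y S L N I J (m + 1) k e =
      termCore h Y S L N (I - 1) J m k (e - 1) * ratioFst h Y S L N I J m k e := by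
  have f1 := termMonomial_fst (S := S) (L := L) (N := N) (I := I) (J := J) (m := m) hh
  have f2 := qp_congr h S (n' := N) (n := N) (m' := I - (m + 1) + k) (m := I - 1 - m + k) rfl
    (by ring)
  have f3 := qp_congr h 1 (n' := I - (m + 1) + k - L) (n := I - 1 - m + k - L) (m' := J - k)
    (m := J - k) (by ring) rfl
  have f4 := qp_congr h Y (n' := m + 1 - 2 * I + 1 + L + e)
    (n := m - 2 * (I - 1) + 1 + L + (e - 1)) (m' := I - (m + 1) + k) (m := I - 1 - m + k) (by ring)
    (by ring)
  have f5 := qp_shift hh (x := Y) (n' := k + 1 + e) (n := k + 1 + (e - 1)) (m' := J - k)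
    (m := J - k) (by ring) rfl (hY _) (Or.inr (hY _))
  have f6 := lin_congr h Y (n' := 2 * k - (m + 1) + e) (n := 2 * k - m + (e - 1)) (by ring)
  have f7 := qp_congr h Y (n' := k - (m + 1) + e) (n := k - m + (e - 1)) (m' := J + 1)
    (m := J + 1) (by ring) rfl
  have f8 := qp_succ hh (x := S) (n' := 0) (n := 0) (m' := I + J) (m := I - 1 + J) rfl (by ring)
    (Or.inr (hS _))
  have f9 := qp_succ hh (x := 1) (n' := 1) (n := 1) (m' := m + 1) (m := m) rfl rfl (Or.inl hm)
  have f10 := qp_shift hh (x := Y) (n' := m + 1 - I - N + 1 + L + e)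
    (n := m - (I - 1) - N + 1 + L + (e - 1)) (m' := J) (m := J) (by ring) rfl (hY _) (Or.inr (hY _))
  have f11 := qp_succ hh (x := Y) (n' := m + 1 - 2 * I - N + L + e)
    (n := m - 2 * (I - 1) - N + L + (e - 1)) (m' := m + 1) (m := m) (by ring) rfl (Or.inl hm)
  have f12 := qp_shift hh (x := Y) (n' := 2 * (m + 1) - 2 * I - N + 1 + L + e)
    (n := 2 * m - 2 * (I - 1) - N + 1 + L + (e - 1)) (m' := I - (m + 1)) (m := I - 1 - m)
    (by ring) (by ring) (hY _) (Or.inr (hY _))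
  have f13 := qp_shift' hh (x := 1) (n' := -(m + 1)) (n := -m) (m' := k) (m := k) (by ring) rfl hk
    (h1 _ (by omega))
  have f14 := qp_shift hh (x := Y) (n' := J - N + e) (n := J - N + (e - 1)) (m' := k) (m := k)
    (by ring) rfl (hY _) (Or.inr (hY _))
  have f15 := qp_congr h S⁻¹ (n' := I - (m + 1) + 1 - L) (n := I - 1 - m + 1 - L) (m' := k)
    (m := k) (by ring) rfl
  have f16 := qp_congr h Y (n' := -I + e) (n := -(I - 1) + (e - 1)) (m' := k) (m := k) (by ring) rfl
  have f17 := qp_congr h (S⁻¹ * Y) (n' := 1 - I - N + k + e) (n := 1 - (I - 1) - N + k + (e - 1))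
    (m' := J - k) (m := J - k) (by ring) rfl
  rw [termCore, f1, f2, f3, f4, f5, f6, f7, f8, f9, f10, f11, f12, f13, f14, f15, f16, f17,
    termCore, ratioFst]
  rw [show k + 1 + (e - 1) + (J - k) = e + J by ring, show k + 1 + (e - 1) = k + e by ring,
    show 0 + (I - 1 + J) = I - 1 + J by ring,
    show m - (I - 1) - N + 1 + L + (e - 1) = m + 1 - I - N + L + e by ring,
    show m - 2 * (I - 1) - N + L + (e - 1) + m = 2 * m + 1 - 2 * I - N + L + e by ring,
    show 2 * m - 2 * (I - 1) - N + 1 + L + (e - 1) = 2 * m + 2 - 2 * I - N + L + e by ring,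
    show 2 * m + 2 - 2 * I - N + L + e + (I - 1 - m) = m + 1 - I - N + L + e by ring,
    show J - N + (e - 1) = J - 1 - N + e by ring]
  simp only [div_eq_mul_inv, mul_inv, inv_inv]
  ring

/-- The quotient by the neighbour with `J - 1`, `M - 1` and `e + 1`, in which the summation index is
`k - 1`. -/
def ratioSnd (h Y S : ℂ) (L N I J m k e : ℤ) : ℂ :=
  -h ^ N * (S * h ^ L) * h ^ (2 * m + J - N) / lin h Y (k - (m + 1) + e) / lin h S (I - 1 + J) /
    lin h 1 (1 + m) / lin h Y (m + 1 - I - N + L + e + J) / lin h Y (2 * m + 1 - 2 * I - N + L + e) *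
    lin h Y (2 * m + 2 - 2 * I - N + L + e) * (h / lin h 1 k) *
    (lin h 1 (-J) * lin h 1 (-(m + 1))) * lin h Y (J - 1 - N + e + k) * lin h S⁻¹ (I - m - L) *
    lin h Y (-I + e)

theorem termCore_snd (hh : h ≠ 0) (hY : ∀ n, lin h Y n ≠ 0) (hS : ∀ n, lin h S n ≠ 0)
    (hS0 : S ≠ 0) (hm : 0 ≤ m) (hk : 1 ≤ k) :
    termCore h Y S L N I J (m + 1) k e =
      termCore h Y S L N I (J - 1) m (k - 1) (e + 1) * ratioSnd h Y S L N I J m k e := by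
  have f1 := termMonomial_snd (S := S) (L := L) (N := N) (I := I) (J := J) (m := m) hh hS0
  have f2 := qp_congr h S (n' := N) (n := N) (m' := I - (m + 1) + k) (m := I - m + (k - 1)) rfl
    (by ring)
  have f3 := qp_congr h 1 (n' := I - (m + 1) + k - L) (n := I - m + (k - 1) - L) (m' := J - k)
    (m := J - 1 - (k - 1)) (by ring) (by ring)
  have f4 := qp_congr h Y (n' := m + 1 - 2 * I + 1 + L + e)
    (n := m - 2 * I + 1 + L + (e + 1)) (m' := I - (m + 1) + k) (m := I - m + (k - 1)) (by ring)
    (by ring)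
  have f5 := qp_congr h Y (n' := k + 1 + e) (n := k - 1 + 1 + (e + 1)) (m' := J - k)
    (m := J - 1 - (k - 1)) (by ring) (by ring)
  have f6 := lin_congr h Y (n' := 2 * k - (m + 1) + e) (n := 2 * (k - 1) - m + (e + 1)) (by ring)
  have f7 := qp_succ' hh (x := Y) (n' := k - (m + 1) + e) (n := k - 1 - m + (e + 1)) (m' := J + 1)
    (m := J - 1 + 1) (by ring) (by ring) (Or.inr (hY _))
  have f8 := qp_succ hh (x := S) (n' := 0) (n := 0) (m' := I + J) (m := I + (J - 1)) rfl (by ring)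
    (Or.inr (hS _))
  have f9 := qp_succ hh (x := 1) (n' := 1) (n := 1) (m' := m + 1) (m := m) rfl rfl (Or.inl hm)
  have f10 := qp_succ hh (x := Y) (n' := m + 1 - I - N + 1 + L + e)
    (n := m - I - N + 1 + L + (e + 1)) (m' := J) (m := J - 1) (by ring) (by ring) (Or.inr (hY _))
  have f11 := qp_succ hh (x := Y) (n' := m + 1 - 2 * I - N + L + e)
    (n := m - 2 * I - N + L + (e + 1)) (m' := m + 1) (m := m) (by ring) rfl (Or.inl hm)
  have f12 := qp_succ' hh (x := Y) (n := 2 * (m + 1) - 2 * I - N + 1 + L + e)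
    (n' := 2 * m - 2 * I - N + 1 + L + (e + 1)) (m := I - (m + 1)) (m' := I - m)
    (by ring) (by ring) (Or.inr (hY _))
  have f13 : h ^ k / qp h 1 1 k = h ^ (k - 1) / qp h 1 1 (k - 1) * (h / lin h 1 k) := by
    rw [qp_succ hh (x := 1) (n' := 1) (n := 1) (m' := k) (m := k - 1) rfl (by ring)
      (Or.inl (by omega)), show 1 + (k - 1) = k by ring]
    conv_lhs => rw [show k = k - 1 + 1 by ring, zpow_add_one₀ hh]
    rw [sub_add_cancel]
    ring
  have f14 := qp_succ' hh (x := 1) (n' := -J) (n := -(J - 1)) (m' := k) (m := k - 1) (by ring)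
    (by ring) (Or.inl (by omega))
  have f15 := qp_succ' hh (x := 1) (n' := -(m + 1)) (n := -m) (m' := k) (m := k - 1) (by ring)
    (by ring) (Or.inl (by omega))
  have f16 := qp_succ hh (x := Y) (n' := J - N + e) (n := J - 1 - N + (e + 1)) (m' := k)
    (m := k - 1) (by ring) (by ring) (Or.inr (hY _))
  have f17 := qp_succ' hh (x := S⁻¹) (n' := I - (m + 1) + 1 - L) (n := I - m + 1 - L) (m' := k)
    (m := k - 1) (by ring) (by ring) (Or.inl (by omega))
  have f18 := qp_succ' hh (x := Y) (n' := -I + e) (n := -I + (e + 1)) (m' := k) (m := k - 1)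
    (by ring) (by ring) (Or.inl (by omega))
  have f19 := qp_congr h (S⁻¹ * Y) (n' := 1 - I - N + k + e) (n := 1 - I - N + (k - 1) + (e + 1))
    (m' := J - k) (m := J - 1 - (k - 1)) (by ring) (by ring)
  have g12 := eq_div_of_mul_eq (hY _) ((mul_comm _ _).trans f12.symm)
  rw [termCore, f1, f2, f3, f4, f5, f6, f7, f8, f9, f10, f11, g12, f13, f14, f15, f16, f17, f18,
    f19, termCore, ratioSnd]
  rw [show 0 + (I + (J - 1)) = I - 1 + J by ring,
    show m - I - N + 1 + L + (e + 1) + (J - 1) = m + 1 - I - N + L + e + J by ring,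
    show m - 2 * I - N + L + (e + 1) + m = 2 * m + 1 - 2 * I - N + L + e by ring,
    show 2 * m - 2 * I - N + 1 + L + (e + 1) = 2 * m + 2 - 2 * I - N + L + e by ring,
    show J - 1 - N + (e + 1) + (k - 1) = J - 1 - N + e + k by ring,
    show I - (m + 1) + 1 - L = I - m - L by ring]
  simp only [div_eq_mul_inv, mul_inv, inv_inv]
  ring

/-- The common part of `termEdge` in the three summands that are compared. -/
theorem termEdge_fst (hh : h ≠ 0) (hkm : k ≤ m) : termEdge h Y S L N I J (m + 1) k e =
    termEdge h Y S L N (I - 1) J m k (e - 1) * (lin h 1 I * lin h 1 (N - J - m + k) *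
      lin h (S * Y) (L - I + e + m)) := by
  have f1 := qp_succ hh (x := 1) (n' := I - (m + 1) + 1 + k) (n := I - 1 - m + 1 + k)
    (m' := m + 1 - k) (m := m - k) (by ring) (by ring) (Or.inl (by omega))
  have f2 := qp_succ' hh (x := 1) (n' := N - J - (m + 1) + 1 + k) (n := N - J - m + 1 + k)
    (m' := m + 1 - k) (m := m - k) (by ring) (by ring) (Or.inl (by omega))
  have f3 := qp_succ hh (x := S * Y) (n' := L + k - I + e) (n := L + k - (I - 1) + (e - 1))
    (m' := m + 1 - k) (m := m - k) (by ring) (by ring) (Or.inl (by omega))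
  rw [termEdge, f1, f2, f3, termEdge, show I - 1 - m + 1 + k + (m - k) = I by ring,
    show N - J - (m + 1) + 1 + k = N - J - m + k by ring,
    show L + k - (I - 1) + (e - 1) + (m - k) = L - I + e + m by ring]
  ring

theorem termEdge_snd (hh : h ≠ 0) (hkm : k ≤ m) :
    termEdge h Y S L N I (J - 1) m (k - 1) (e + 1) =
    termEdge h Y S L N (I - 1) J m k (e - 1) * (lin h 1 I * lin h 1 (N - J + 1) *
      lin h (S * Y) (L - I + e + m)) := by
  have f1 := qp_succ hh (x := 1) (n' := I - m + 1 + (k - 1)) (n := I - 1 - m + 1 + k)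
    (m' := m - (k - 1)) (m := m - k) (by ring) (by ring) (Or.inl (by omega))
  have f2 := qp_succ hh (x := 1) (n' := N - (J - 1) - m + 1 + (k - 1)) (n := N - J - m + 1 + k)
    (m' := m - (k - 1)) (m := m - k) (by ring) (by ring) (Or.inl (by omega))
  have f3 := qp_succ hh (x := S * Y) (n' := L + (k - 1) - I + (e + 1))
    (n := L + k - (I - 1) + (e - 1))
    (m' := m - (k - 1)) (m := m - k) (by ring) (by ring) (Or.inl (by omega))
  rw [termEdge, f1, f2, f3, termEdge, show I - 1 - m + 1 + k + (m - k) = I by ring,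
    show N - J - m + 1 + k + (m - k) = N - J + 1 by ring,
    show L + k - (I - 1) + (e - 1) + (m - k) = L - I + e + m by ring]
  ring

theorem termEdge_self (h Y S : ℂ) (L N I J m e : ℤ) : termEdge h Y S L N I J m m e = 1 := by
  rw [termEdge, sub_self, qp_zero, qp_zero, qp_zero]; ring

end Ratios

/-! ### The three-term relation between the summands -/

/-- In the coefficients of the recursion the letters `x`, `y`, `m`, `a`, `b` stand for the powers of
`h` with exponents `I`, `J`, `m`, `L`, `N`, and `W` is the rescaled free parameter `w / q^L`. -/
def coefLhs (h X S x y m a : ℂ) : ℂ :=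
  (1 - (m * h)⁻¹) * (1 - X * (x * y / (m * h)) / a) * ((x * y / (m * h))⁻¹ - S * m) *
    (1 - X * (x * y / (m * h)) ^ 2 * h / a) / (1 - X * (x * y / (m * h)) ^ 2 / a)

def recFst (X S x y a b W : ℂ) : ℂ :=
  (1 - x⁻¹) * (1 - X * y / b) / (1 - X * y ^ 2 / b) *
    (S * b / y + X * y ^ 2 * x / (b * a) - W)

def recSnd (X S x y a b W : ℂ) : ℂ :=
  (1 - y⁻¹) / x * (1 - X * y ^ 2 * x / b) / (1 - X * y ^ 2 / b) * (x / a + S * X * y - W)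

/-- The value substituted for `W` is the one for which the first coefficient of `dynDiag` vanishes.
-/
def coefFst (X S x y m a b : ℂ) : ℂ := recFst X S x y a b (S * m + X * x * y / (m * a))

def coefSnd (X S x y m a b : ℂ) : ℂ := recSnd X S x y a b (S * m + X * x * y / (m * a))

/-- The rational identity to which the recursion reduces for `k ≠ 0`. The denominators carry names
so that they can be cleared as units. -/
theorem threeTerm_aux {x y m k a b S h X D1 D2 D3 D4 D5 D6 D7 : ℂ} (hx : x ≠ 0) (hy : y ≠ 0)
    (hm : m ≠ 0) (ha : a ≠ 0) (hb : b ≠ 0) (hS : S ≠ 0) (hh : h ≠ 0) (hX : X ≠ 0)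
    (n1 : D1 ≠ 0) (n2 : D2 ≠ 0) (n3 : D3 ≠ 0) (n4 : D4 ≠ 0) (n5 : D5 ≠ 0) (n6 : D6 ≠ 0)
    (n7 : D7 ≠ 0)
    (d1 : D1 = X * y ^ 2 - k * b) (d2 : D2 = m * h - k) (d3 : D3 = X * h * y - 1)
    (d4 : D4 = b - X * y ^ 2) (_d5 : D5 = y - 1) (d6 : D6 = m * S * a - x)
    (d7 : D7 = X * x * y ^ 2 - b) :
    -(X * y / (a * b)) * ((X * y - b) * y / D1) * ((m * h - 1) / D2) * ((X * h * y - k) / D3) *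
      ((1 - x) * ((y * m - b * k) / (y * m)) * ((X * x * y ^ 2 - S * a * b * m) / (X * x * y ^ 2))) =
    (x - 1) / x * (b - X * y) / D4 *
      (S * b / y + X * y ^ 2 * x / (b * a) - (S * m + X * x * y / (m * a))) +
    D5 / y / x * (b - X * y ^ 2 * x) / D4 *
      (x / a + S * X * y - (S * m + X * x * y / (m * a))) *
      (1 / (b * m * S * a) * ((X * y - b) * y / D1) * ((X * m * h * y ^ 2 - k * b) / (X * m * h * y ^ 2)) *
        (1 - k) / (h * (D5 / y) * (D2 / (m * h)) * (D3 / (X * h * y)) * (D6 / (m * S * a)) *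
          (D7 / (X * x * y ^ 2)))) * 
      ((1 - x) * ((y - b * h) / y) * ((X * x * y ^ 2 - S * a * b * m) / (X * x * y ^ 2))) := by
  have e7 : b - X * y ^ 2 * x = - D7 := by rw [d7]; ring
  rw [e7]
  field_simp
  rw [d1,d2,d3,d4,d6]
  ring

/-! ### Factorization of the coefficients and the three-term identity. -/

section

variable {h X S : ℂ} {L N I J m k : ℤ}

theorem lin_inv_ne_zero (hh : h ≠ 0) (hS0 : S ≠ 0) (hS : ∀ n, lin h S n ≠ 0) (n : ℤ) :
    lin h S⁻¹ n ≠ 0 := fun e => hS (-n) (by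
  have : h ^ n ≠ 0 := zpow_ne_zero _ hh
  rw [lin, sub_eq_zero] at e ⊢
  rw [_root_.zpow_neg]
  field_simp at e ⊢
  exact e.symm)

/-- A factorization into the linear factors that occur in `ratioFst` and `ratioSnd`, so that they
cancel there. The right side does not depend on `N`, which enters only through `-N + (N - 2J)`. -/
theorem coefLhs_eq (hh : h ≠ 0) (hX0 : X ≠ 0) (hY : ∀ n, lin h X⁻¹ n ≠ 0) :
    coefLhs h X S (h ^ I) (h ^ J) (h ^ m) (h ^ L) =
      X / (h ^ m * h ^ L) * (lin h 1 (1 + m) * lin h X⁻¹ (m + 1 - I - N + L + (N - 2 * J) + J) *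
        lin h S (I - 1 + J) * lin h X⁻¹ (2 * m + 1 - 2 * I - N + L + (N - 2 * J)) /
        lin h X⁻¹ (2 * m + 2 - 2 * I - N + L + (N - 2 * J))) := by
  have nx : h ^ I ≠ 0 := zpow_ne_zero _ hh
  have ny : h ^ J ≠ 0 := zpow_ne_zero _ hh
  have nm : h ^ m ≠ 0 := zpow_ne_zero _ hh
  have na : h ^ L ≠ 0 := zpow_ne_zero _ hh
  have g3 := hY (2 * m + 2 - 2 * I - N + L + (N - 2 * J))
  have e1 : 1 - X * (h ^ I * h ^ J / (h ^ m * h)) / h ^ L =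
      -(X * (h ^ I * h ^ J / (h ^ m * h)) / h ^ L) *
        lin h X⁻¹ (m + 1 - I - N + L + (N - 2 * J) + J) := by
    rw [lin, show m + 1 - I - N + L + (N - 2 * J) + J = m + 1 - I + L - J by ring]
    simp only [zpow_add₀ hh, zpow_sub₀ hh, zpow_one]
    field_simp
    ring
  have e2 : 1 - X * (h ^ I * h ^ J / (h ^ m * h)) ^ 2 * h / h ^ L =
      -(X * (h ^ I * h ^ J / (h ^ m * h)) ^ 2 * h / h ^ L) *
        lin h X⁻¹ (2 * m + 1 - 2 * I - N + L + (N - 2 * J)) := by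
    rw [lin, show 2 * m + 1 - 2 * I - N + L + (N - 2 * J) = (m + m + 1 + L) - (I + I + J + J) by ring]
    simp only [zpow_add₀ hh, zpow_sub₀ hh, zpow_one]
    field_simp
    ring
  have e3 : 1 - X * (h ^ I * h ^ J / (h ^ m * h)) ^ 2 / h ^ L =
      -(X * (h ^ I * h ^ J / (h ^ m * h)) ^ 2 / h ^ L) *
        lin h X⁻¹ (2 * m + 2 - 2 * I - N + L + (N - 2 * J)) := by
    rw [lin, show 2 * m + 2 - 2 * I - N + L + (N - 2 * J) =
      (m + m + 1 + 1 + L) - (I + I + J + J) by ring]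
    simp only [zpow_add₀ hh, zpow_sub₀ hh, zpow_one]
    field_simp
    ring
  have e4 : (h ^ I * h ^ J / (h ^ m * h))⁻¹ - S * h ^ m =
      (h ^ I * h ^ J / (h ^ m * h))⁻¹ * lin h S (I - 1 + J) := by
    rw [lin]
    simp only [zpow_add₀ hh, zpow_sub₀ hh, zpow_one]
    field_simp
  have e5 : 1 - (h ^ m * h)⁻¹ = -(h ^ m * h)⁻¹ * lin h 1 (1 + m) := by
    rw [lin]
    simp only [zpow_add₀ hh, zpow_one]
    field_simp
    ring
  rw [coefLhs, e1, e2, e3, e4, e5]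
  generalize lin h X⁻¹ (2 * m + 2 - 2 * I - N + L + (N - 2 * J)) = D6 at *
  field_simp

theorem coefLhs_mul_ratioFst (hh : h ≠ 0) (hX0 : X ≠ 0) (hY : ∀ n, lin h X⁻¹ n ≠ 0)
    (hS : ∀ n, lin h S n ≠ 0) (h1 : ∀ n, n ≠ 0 → lin h 1 n ≠ 0) (hm : 0 ≤ m) :
    coefLhs h X S (h ^ I) (h ^ J) (h ^ m) (h ^ L) *
        ratioFst h X⁻¹ S L N I J m k (N - 2 * J) =
      -(X * h ^ J / (h ^ L * h ^ N)) * (lin h X⁻¹ (N - J) / lin h X⁻¹ (k + N - 2 * J)) *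
        (lin h 1 (-(m + 1)) / lin h 1 (-(m + 1) + k)) *
        (lin h X⁻¹ (k - 1 - J) / lin h X⁻¹ (-1 - J)) := by
  have g0 := hY (m + 1 - I - N + L + (N - 2 * J))
  have u1 := hY (m + 1 - I - N + L + (N - 2 * J) + J)
  have u2 := hY (2 * m + 1 - 2 * I - N + L + (N - 2 * J))
  have u3 := hY (2 * m + 2 - 2 * I - N + L + (N - 2 * J))
  have u4 := hS (I - 1 + J)
  have u5 := h1 (1 + m) (by omega)
  have nm : h ^ m ≠ 0 := zpow_ne_zero _ hh
  have e6 : h ^ (m + J - N) = h ^ m * h ^ J / h ^ N := by rw [zpow_sub₀ hh, zpow_add₀ hh]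
  rw [coefLhs_eq (N := N) hh hX0 hY, ratioFst, e6,
    show N - 2 * J + J = N - J by ring, show k + (N - 2 * J) = k + N - 2 * J by ring,
    show J - 1 - N + (N - 2 * J) = -1 - J by ring, show -1 - J + k = k - 1 - J by ring]
  generalize lin h X⁻¹ (m + 1 - I - N + L + (N - 2 * J)) = A5 at *
  generalize lin h X⁻¹ (m + 1 - I - N + L + (N - 2 * J) + J) = A0 at *
  generalize lin h X⁻¹ (2 * m + 1 - 2 * I - N + L + (N - 2 * J)) = A1 at *
  generalize lin h X⁻¹ (2 * m + 2 - 2 * I - N + L + (N - 2 * J)) = A2 at *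
  generalize lin h S (I - 1 + J) = A3 at *
  generalize lin h 1 (1 + m) = A4 at *
  have c : A0 / A0 * (A1 / A1) * (A2 / A2) * (A3 / A3) * (A4 / A4) * (A5 / A5) *
      (h ^ m / h ^ m) = 1 := by
    field_simp
  refine Eq.trans ?_ ((congrArg (· * _) c).trans (one_mul _))
  ring

/-- The quotient of `ratioFst` by `ratioSnd`. -/
def ratioQuot (h Y S : ℂ) (L N I J m k : ℤ) : ℂ :=
  (h ^ N * h ^ m * S * h ^ L)⁻¹ * (lin h Y (N - J) / lin h Y (k + N - 2 * J)) *
    lin h Y (k - (m + 1) + (N - 2 * J)) * lin h 1 k /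
    (h * lin h 1 (-J) * lin h 1 (-(m + 1) + k) * lin h Y (-1 - J) * lin h S⁻¹ (I - m - L) *
      lin h Y (-I + (N - 2 * J)))

/-- This expresses both summands on the right of the recursion through one and the same value of
`termCore`. The conditions on `k` and `J` keep factors of `ratioSnd` away from zero. -/
theorem ratioFst_eq (hh : h ≠ 0) (hY : ∀ n, lin h X⁻¹ n ≠ 0)
    (hS0 : S ≠ 0) (hS : ∀ n, lin h S n ≠ 0) (h1 : ∀ n, n ≠ 0 → lin h 1 n ≠ 0)
    (hk : k ≠ 0) (hJ : J ≠ 0) :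
    ratioFst h X⁻¹ S L N I J m k (N - 2 * J) =
      ratioQuot h X⁻¹ S L N I J m k * ratioSnd h X⁻¹ S L N I J m k (N - 2 * J) := by
  have ny : h ^ J ≠ 0 := zpow_ne_zero _ hh
  have nm : h ^ m ≠ 0 := zpow_ne_zero _ hh
  have na : h ^ L ≠ 0 := zpow_ne_zero _ hh
  have nb : h ^ N ≠ 0 := zpow_ne_zero _ hh
  have e6 : h ^ (m + J - N) = h ^ m * h ^ J / h ^ N := by rw [zpow_sub₀ hh, zpow_add₀ hh]
  have e7 : h ^ (2 * m + J - N) = h ^ m * h ^ m * h ^ J / h ^ N := by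
    rw [zpow_sub₀ hh, zpow_add₀ hh, two_mul, zpow_add₀ hh]
  rw [ratioFst, ratioQuot, ratioSnd, e6, e7,
    show N - 2 * J + J = N - J by ring, show k + (N - 2 * J) = k + N - 2 * J by ring,
    show J - 1 - N + (N - 2 * J) = -1 - J by ring]
  have u0 := hY (m + 1 - I - N + L + (N - 2 * J))
  have u1 := hY (k - (m + 1) + (N - 2 * J))
  have u2 := h1 k hk
  have u3 := h1 (-J) (by omega)
  have u4 := lin_inv_ne_zero hh hS0 hS (I - m - L)
  have u5 := hY (-I + (N - 2 * J))
  generalize lin h X⁻¹ (m + 1 - I - N + L + (N - 2 * J)) = D0 at *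
  generalize lin h X⁻¹ (k - (m + 1) + (N - 2 * J)) = D1 at *
  generalize lin h 1 k = D2 at *
  generalize lin h 1 (-J) = D3 at *
  generalize lin h S⁻¹ (I - m - L) = D4 at *
  generalize lin h X⁻¹ (-I + (N - 2 * J)) = D5 at *
  generalize lin h X⁻¹ (m + 1 - I - N + L + (N - 2 * J) + J) = A0 
  generalize lin h X⁻¹ (2 * m + 1 - 2 * I - N + L + (N - 2 * J)) = A1
  generalize lin h S (I - 1 + J) = A2 
  generalize lin h 1 (1 + m) = A3 
  generalize lin h 1 (-(m + 1) + k) = A4 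
  generalize lin h X⁻¹ (-1 - J) = A5
  generalize lin h X⁻¹ (k + N - 2 * J) = A6
  generalize lin h X⁻¹ (2 * m + 2 - 2 * I - N + L + (N - 2 * J)) = A7
  generalize lin h 1 (-(m + 1)) = A8
  generalize lin h X⁻¹ (-1 - J + k) = A9
  generalize lin h X⁻¹ (N - J) = A10
  have key : -(h ^ m * h ^ J / h ^ N) * (D0 / D0) =
      (h ^ N * h ^ m * S * h ^ L)⁻¹ * D1 * D2 / (h * D3 * D4 * D5) *
        (-h ^ N * (S * h ^ L) * (h ^ m * h ^ m * h ^ J / h ^ N) / D1 * (h / D2) * D3 * D4 * D5) := by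
    field_simp
  calc _ = -(h ^ m * h ^ J / h ^ N) * (D0 / D0) *
        (A10 * A9 * A8 * A7 / (A0 * A1 * A2 * A3 * A4 * A5 * A6)) := by ring
    _ = _ := by rw [key]; ring

theorem ratioSnd_ne_zero (hh : h ≠ 0) (hY : ∀ n, lin h X⁻¹ n ≠ 0)
    (hS0 : S ≠ 0) (hS : ∀ n, lin h S n ≠ 0) (h1 : ∀ n, n ≠ 0 → lin h 1 n ≠ 0)
    (hm : 0 ≤ m) (hk : k ≠ 0) (hJ : J ≠ 0) (e : ℤ) :
    ratioSnd h X⁻¹ S L N I J m k e ≠ 0 := by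
  have := lin_inv_ne_zero hh hS0 hS
  have z : ∀ n : ℤ, h ^ n ≠ 0 := fun n => zpow_ne_zero n hh
  have j1 := h1 (-J) (by omega)
  have j2 := h1 (-(m + 1)) (by omega)
  have j3 := h1 k hk
  have j4 := h1 (1 + m) (by omega)
  simp only [ratioSnd, ne_eq, mul_eq_zero, div_eq_zero_iff, neg_eq_zero, hY, hS, this, z, hS0, j1,
    j2, j3, j4, hh, or_self, not_false_eq_true]

/-- The boundary case `k = m + 1`, where the neighbour with `I - 1` contributes nothing. -/
theorem coefLhs_mul_ratioSnd (hh : h ≠ 0) (hX0 : X ≠ 0) (hY : ∀ n, lin h X⁻¹ n ≠ 0)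
    (hS0 : S ≠ 0) (hS : ∀ n, lin h S n ≠ 0) (h1 : ∀ n, n ≠ 0 → lin h 1 n ≠ 0) (hm : 0 ≤ m) :
    coefLhs h X S (h ^ I) (h ^ J) (h ^ m) (h ^ L) *
        ratioSnd h X⁻¹ S L N I J m (m + 1) (N - 2 * J) =
      coefSnd X S (h ^ I) (h ^ J) (h ^ m) (h ^ L) (h ^ N) := by
  have nx : h ^ I ≠ 0 := zpow_ne_zero _ hh
  have ny : h ^ J ≠ 0 := zpow_ne_zero _ hh
  have nm : h ^ m ≠ 0 := zpow_ne_zero _ hh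
  have na : h ^ L ≠ 0 := zpow_ne_zero _ hh
  have nb : h ^ N ≠ 0 := zpow_ne_zero _ hh
  have e7 : h ^ (2 * m + J - N) = h ^ m * h ^ m * h ^ J / h ^ N := by
    rw [zpow_sub₀ hh, zpow_add₀ hh, two_mul, zpow_add₀ hh]
  have key : coefSnd X S (h ^ I) (h ^ J) (h ^ m) (h ^ L) (h ^ N) =
      X / (h ^ m * h ^ L) * (-h ^ N * (S * h ^ L) * (h ^ m * h ^ m * h ^ J / h ^ N)) /
        lin h X⁻¹ (m + 1 - (m + 1) + (N - 2 * J)) * (h / lin h 1 (1 + m)) *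
        (lin h 1 (-J) * lin h 1 (-(m + 1))) * lin h X⁻¹ (J - 1 - N + (N - 2 * J) + (m + 1)) *
        lin h S⁻¹ (I - m - L) * lin h X⁻¹ (-I + (N - 2 * J)) := by
    have g0 := hY (N - 2 * J)
    have g1 := h1 (1 + m) (by omega)
    have E1 : 1 - X * (h ^ J) ^ 2 / h ^ N = -(X * (h ^ J) ^ 2 / h ^ N) * lin h X⁻¹ (N - 2 * J) := by
      rw [lin, zpow_sub₀ hh, two_mul, zpow_add₀ hh]
      field_simp
      ring
    have E2 : lin h 1 (-(m + 1)) = -(h ^ m * h)⁻¹ * lin h 1 (1 + m) := by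
      rw [lin, lin]
      simp only [_root_.zpow_neg, zpow_add₀ hh, zpow_one]
      field_simp
      ring
    have E3 : lin h 1 (-J) = 1 - (h ^ J)⁻¹ := by rw [lin, _root_.zpow_neg, mul_one]
    have E4 : lin h X⁻¹ (J - 1 - N + (N - 2 * J) + (m + 1)) = 1 - h ^ m / h ^ J * X⁻¹ := by
      rw [lin, show J - 1 - N + (N - 2 * J) + (m + 1) = m - J by ring, zpow_sub₀ hh]
    have E5 : lin h S⁻¹ (I - m - L) = 1 - h ^ I / h ^ m / h ^ L * S⁻¹ := by
      rw [lin, zpow_sub₀ hh, zpow_sub₀ hh]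
    have E6 : lin h X⁻¹ (-I + (N - 2 * J)) = 1 - h ^ N / (h ^ I * (h ^ J) ^ 2) * X⁻¹ := by
      rw [lin, show -I + (N - 2 * J) = N - (I + (J + J)) by ring, zpow_sub₀ hh, zpow_add₀ hh,
        zpow_add₀ hh, ← pow_two]
    rw [coefSnd, recSnd, E1, show m + 1 - (m + 1) + (N - 2 * J) = N - 2 * J by ring, E2, E3, E4, E5, E6]
    generalize lin h X⁻¹ (N - 2 * J) = D0 at *
    generalize lin h 1 (1 + m) = D1 at *
    field_simp
    ring
  have u1 := hY (m + 1 - I - N + L + (N - 2 * J) + J)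
  have u2 := hY (2 * m + 1 - 2 * I - N + L + (N - 2 * J))
  have u3 := hY (2 * m + 2 - 2 * I - N + L + (N - 2 * J))
  have u4 := hS (I - 1 + J)
  have u5 := h1 (1 + m) (by omega)
  rw [key, coefLhs_eq (N := N) hh hX0 hY, ratioSnd, e7, lin_congr h 1 (show m + 1 = 1 + m by ring)]
  generalize lin h X⁻¹ (m + 1 - I - N + L + (N - 2 * J) + J) = A0 at *
  generalize lin h X⁻¹ (2 * m + 1 - 2 * I - N + L + (N - 2 * J)) = A1 at *
  generalize lin h X⁻¹ (2 * m + 2 - 2 * I - N + L + (N - 2 * J)) = A2 at *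
  generalize lin h S (I - 1 + J) = A3 at *
  generalize lin h 1 (1 + m) = A4 at *
  have c : A0 / A0 * (A1 / A1) * (A2 / A2) * (A3 / A3) * (A4 / A4) = 1 := by
    field_simp
  refine Eq.trans ?_ ((congrArg (· * _) c).trans (one_mul _))
  ring

theorem coef_threeTerm (hh : h ≠ 0) (hX0 : X ≠ 0) (hY : ∀ n, lin h X⁻¹ n ≠ 0)
    (hS0 : S ≠ 0) (hS : ∀ n, lin h S n ≠ 0) (h1 : ∀ n, n ≠ 0 → lin h 1 n ≠ 0) (hm : 0 ≤ m)
    (hkm : k ≤ m) (hJ : k = 0 ∨ J ≠ 0) :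
    coefLhs h X S (h ^ I) (h ^ J) (h ^ m) (h ^ L) * ratioFst h X⁻¹ S L N I J m k (N - 2 * J) *
        (lin h 1 I * lin h 1 (N - J - m + k) * lin h (S * X⁻¹) (L - I + (N - 2 * J) + m)) =
      coefFst X S (h ^ I) (h ^ J) (h ^ m) (h ^ L) (h ^ N) +
        coefSnd X S (h ^ I) (h ^ J) (h ^ m) (h ^ L) (h ^ N) * ratioQuot h X⁻¹ S L N I J m k *
          (lin h 1 I * lin h 1 (N - J + 1) * lin h (S * X⁻¹) (L - I + (N - 2 * J) + m)) := by
  have nx : h ^ I ≠ 0 := zpow_ne_zero _ hh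
  have ny : h ^ J ≠ 0 := zpow_ne_zero _ hh
  have nm : h ^ m ≠ 0 := zpow_ne_zero _ hh
  have na : h ^ L ≠ 0 := zpow_ne_zero _ hh
  have nb : h ^ N ≠ 0 := zpow_ne_zero _ hh
  have l0 : lin h 1 I = 1 - h ^ I := by rw [lin, mul_one]
  have l1 : lin h 1 (N - J - m + k) = 1 - h ^ N * h ^ k / (h ^ J * h ^ m) := by
    rw [lin, zpow_add₀ hh, zpow_sub₀ hh, zpow_sub₀ hh]; field_simp
  have l2 : lin h (S * X⁻¹) (L - I + (N - 2 * J) + m) =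
      1 - S * h ^ L * h ^ N * h ^ m / (X * h ^ I * (h ^ J) ^ 2) := by
    rw [lin, show L - I + (N - 2 * J) + m = L + N + m - (I + (J + J)) by ring, zpow_sub₀ hh,
      zpow_add₀ hh, zpow_add₀ hh, zpow_add₀ hh, zpow_add₀ hh]
    field_simp
  have l3 : lin h 1 (N - J + 1) = 1 - h ^ N * h / h ^ J := by
    rw [lin, zpow_add₀ hh, zpow_sub₀ hh, zpow_one]; field_simp
  have l4 : lin h X⁻¹ (N - J) = (X * h ^ J - h ^ N) / (X * h ^ J) := by
    rw [lin, zpow_sub₀ hh]; field_simp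
  have l5 : lin h X⁻¹ (k + N - 2 * J) = (X * (h ^ J) ^ 2 - h ^ k * h ^ N) / (X * (h ^ J) ^ 2) := by
    rw [lin, two_mul, zpow_sub₀ hh, zpow_add₀ hh, zpow_add₀ hh]; field_simp
  have l6 : lin h 1 (-(m + 1) + k) = (h ^ m * h - h ^ k) / (h ^ m * h) := by
    rw [lin, zpow_add₀ hh, _root_.zpow_neg, zpow_add_one₀ hh]; field_simp
  have l7 : lin h 1 (-(m + 1)) = (h ^ m * h - 1) / (h ^ m * h) := by
    rw [lin, _root_.zpow_neg, zpow_add_one₀ hh]; field_simp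
  have l8 : lin h X⁻¹ (-1 - J) = (X * h * h ^ J - 1) / (X * h * h ^ J) := by
    rw [lin, zpow_sub₀ hh, _root_.zpow_neg_one]; field_simp
  have l9 : lin h X⁻¹ (k - 1 - J) = (X * h * h ^ J - h ^ k) / (X * h * h ^ J) := by
    rw [lin, zpow_sub₀ hh, zpow_sub₀ hh, zpow_one]; field_simp
  have l10 : lin h X⁻¹ (k - (m + 1) + (N - 2 * J)) =
      (X * h ^ m * h * (h ^ J) ^ 2 - h ^ k * h ^ N) / (X * h ^ m * h * (h ^ J) ^ 2) := by
    rw [lin, show k - (m + 1) + (N - 2 * J) = k + N - (m + 1 + (J + J)) by ring, zpow_sub₀ hh,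
      zpow_add₀ hh, zpow_add₀ hh, zpow_add₀ hh, zpow_add₀ hh, zpow_one]; field_simp
  have l11 : lin h 1 k = 1 - h ^ k := by rw [lin, mul_one]
  have l12 : lin h 1 (-J) = (h ^ J - 1) / h ^ J := by rw [lin, _root_.zpow_neg]; field_simp
  have l13 : lin h S⁻¹ (I - m - L) = (h ^ m * S * h ^ L - h ^ I) / (h ^ m * S * h ^ L) := by
    rw [lin, zpow_sub₀ hh, zpow_sub₀ hh]; field_simp
  have l14 : lin h X⁻¹ (-I + (N - 2 * J)) =
      (X * h ^ I * (h ^ J) ^ 2 - h ^ N) / (X * h ^ I * (h ^ J) ^ 2) := by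
    rw [lin, show -I + (N - 2 * J) = N - (I + (J + J)) by ring, zpow_sub₀ hh,
      zpow_add₀ hh, zpow_add₀ hh]; field_simp
  have l15 : lin h X⁻¹ (N - 2 * J) = (X * (h ^ J) ^ 2 - h ^ N) / (X * (h ^ J) ^ 2) := by
    rw [lin, two_mul, zpow_sub₀ hh, zpow_add₀ hh]; field_simp
  have num : ∀ {a b c : ℂ}, c = a / b → c ≠ 0 → a ≠ 0 := fun e hc ha => hc (by rw [e, ha, zero_div])
  have n1 := num l5 (hY _)
  have n2 := num l6 (h1 _ (by omega))
  have n3 := num l8 (hY _)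
  have n4 : h ^ N - X * (h ^ J) ^ 2 ≠ 0 := by
    rw [← neg_ne_zero, neg_sub]; exact num l15 (hY _)
  have n6 := num l13 (lin_inv_ne_zero hh hS0 hS _)
  have n7 := num l14 (hY _)
  rw [coefLhs_mul_ratioFst hh hX0 hY hS h1 hm, ratioQuot, l0, l1, l2, l3, l4, l5, l6, l7, l8, l9,
    l10, l11, l12, l13, l14]
  clear l0 l1 l2 l3 l4 l5 l6 l7 l8 l9 l10 l11 l13 l14 l15 num
  -- For `k = 0` the second summand is absent, since `ratioQuot` contains the factor `1 - h^k`; the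
  -- remaining identity also covers `J = 0`.
  rcases eq_or_ne k 0 with rfl | hk
  · rw [zpow_zero] at *
    rw [coefFst, recFst]
    generalize h ^ I = x at *
    generalize h ^ J = y at *
    generalize h ^ m = m' at *
    generalize h ^ L = a at *
    generalize h ^ N = b at *
    generalize d1 : X * y ^ 2 - 1 * b = D1 at *
    generalize d4 : b - X * y ^ 2 = D4 at *
    generalize X * h * y - 1 = D3 at *
    obtain rfl : D1 = -D4 := by rw [← d1, ← d4]; ring
    have e4 : 1 - X * y ^ 2 / b = D4 / b := by rw [← d4]; field_simp
    rw [e4, sub_self, mul_zero, zero_div, mul_zero, zero_mul, add_zero]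
    field_simp
    ring
  · have n5 := h1 (-J) (by omega)
    rw [l12] at n5
    have n5 : h ^ J - 1 ≠ 0 := fun e => n5 (by rw [e, zero_div])
    have := threeTerm_aux nx ny nm na nb hS0 hh hX0 n1 n2 n3 n4 n5 n6 n7 rfl rfl rfl rfl rfl rfl rfl
    rw [coefFst, coefSnd, recFst, recSnd]
    clear l12
    generalize h ^ I = x at *
    generalize h ^ J = y at *
    generalize h ^ m = m' at *
    generalize h ^ L = a at *
    generalize h ^ N = b at *
    generalize h ^ k = k' at *
    generalize d1 : X * y ^ 2 - k' * b = D1 at *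
    generalize d2 : m' * h - k' = D2 at *
    generalize d3 : X * h * y - 1 = D3 at *
    generalize d4 : b - X * y ^ 2 = D4 at *
    generalize d6 : m' * S * a - x = D6 at *
    generalize d7 : X * x * y ^ 2 - b = D7 at *
    convert this using 1
    · field_simp
    · congr 1
      · congr 1
        rw [← d4]
        field_simp
      · congr 1
        · rw [← d4]
          field_simp
        · field_simp

end

/-- A summand of the fused weight. -/
def term (h Y S : ℂ) (L N I J M e k : ℤ) : ℂ :=
  termCore h Y S L N I J M k e * termEdge h Y S L N I J M k e

/-! ### The recursion for the summands and for the series. -/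

section

variable {h X S : ℂ} {L N I J M m k e : ℤ}

theorem qp_one_neg (h : ℂ) {M k : ℤ} (hh : h ≠ 0) (hM : 0 ≤ M) (hk : M < k) : qp h 1 (-M) k = 0 := by
  obtain ⟨M, rfl⟩ := Int.eq_ofNat_of_zero_le hM
  obtain ⟨k, rfl⟩ := Int.eq_ofNat_of_zero_le (hM.trans hk.le)
  rw [qp, qPoch_nat]
  refine Finset.prod_eq_zero (i := M) (Finset.mem_range.2 (by omega)) ?_
  rw [← zpow_natCast, mul_one, ← zpow_add₀ hh, add_neg_cancel, zpow_zero, sub_self]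

theorem term_eq_zero (hh : h ≠ 0) (Y : ℂ) (hM : 0 ≤ M) (hk : M < k) :
    term h Y S L N I J M e k = 0 := by
  rw [term, termCore, qp_one_neg h hh hM hk]; ring

theorem term_eq_zero' (hh : h ≠ 0) (Y : ℂ) (hJ : 0 ≤ J) (hk : J < k) :
    term h Y S L N I J M e k = 0 := by
  rw [term, termCore, qp_one_neg h hh hJ hk]; ring

theorem coefSnd_zero (X S x m a b : ℂ) : coefSnd X S x 1 m a b = 0 := by simp [coefSnd, recSnd]

/-- The relation holds for each `k` separately, so no telescoping certificate is needed. -/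
theorem term_threeTerm (hh : h ≠ 0) (hX0 : X ≠ 0) (hY : ∀ n, lin h X⁻¹ n ≠ 0)
    (hS0 : S ≠ 0) (hS : ∀ n, lin h S n ≠ 0) (h1 : ∀ n, n ≠ 0 → lin h 1 n ≠ 0) (hm : 0 ≤ m)
    (hk : 0 ≤ k) (hJ : 0 ≤ J) :
    coefLhs h X S (h ^ I) (h ^ J) (h ^ m) (h ^ L) * term h X⁻¹ S L N I J (m + 1) (N - 2 * J) k =
      coefFst X S (h ^ I) (h ^ J) (h ^ m) (h ^ L) (h ^ N) *
        term h X⁻¹ S L N (I - 1) J m (N - 2 * J - 1) k +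
      coefSnd X S (h ^ I) (h ^ J) (h ^ m) (h ^ L) (h ^ N) *
        (if k = 0 then 0 else term h X⁻¹ S L N I (J - 1) m (N - 2 * J + 1) (k - 1)) := by
  rcases lt_trichotomy k (m + 1) with hkm | rfl | hkm
  · have hkm : k ≤ m := by omega
    by_cases hJk : k = 0 ∨ J ≠ 0
    · have := coef_threeTerm (L := L) (N := N) (I := I) hh hX0 hY hS0 hS h1 hm hkm hJk
      have eR : (if k = 0 then 0 else term h X⁻¹ S L N I (J - 1) m (N - 2 * J + 1) (k - 1)) =
          termCore h X⁻¹ S L N (I - 1) J m k (N - 2 * J - 1) * ratioQuot h X⁻¹ S L N I J m k *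
          (termEdge h X⁻¹ S L N (I - 1) J m k (N - 2 * J - 1) *
          (lin h 1 I * lin h 1 (N - J + 1) * lin h (S * X⁻¹) (L - I + (N - 2 * J) + m))) := by
        split_ifs with h0
        · have : lin h 1 k = 0 := by rw [h0, lin]; simp
          rw [ratioQuot, this]; ring
        · have hJ0 : J ≠ 0 := hJk.resolve_left h0
          have e1 := termCore_fst (L := L) (N := N) (I := I) (J := J) (e := N - 2 * J)
            hh hY hS h1 hm hk hkm
          rw [termCore_snd (L := L) (N := N) (I := I) (J := J) (e := N - 2 * J) hh hY hS hS0 hm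
            (by omega), ratioFst_eq hh hY hS0 hS h1 h0 hJ0, ← mul_assoc] at e1
          rw [term, mul_right_cancel₀ (ratioSnd_ne_zero hh hY hS0 hS h1 hm h0 hJ0 _) e1,
            termEdge_snd hh hkm]
      rw [eR, term, term, termCore_fst hh hY hS h1 hm hk hkm, termEdge_fst hh hkm]
      linear_combination termCore h X⁻¹ S L N (I - 1) J m k (N - 2 * J - 1) *
        termEdge h X⁻¹ S L N (I - 1) J m k (N - 2 * J - 1) * this
    -- For `J = 0 < k` both terms with this `J` vanish, and the coefficient of the other one
    -- contains `1 - y⁻¹ = 0`.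
    · push Not at hJk
      obtain ⟨hk0, rfl⟩ := hJk
      rw [term_eq_zero' hh _ le_rfl (by omega), term_eq_zero' hh _ le_rfl (by omega), zpow_zero,
        coefSnd_zero]
      ring
  · rw [if_neg (by omega), term_eq_zero hh _ hm (by omega : m < m + 1)]
    by_cases hJ0 : J = 0
    · subst hJ0
      rw [term_eq_zero' hh _ le_rfl (by omega), zpow_zero, coefSnd_zero]
      ring
    · rw [add_sub_cancel_right, term, term, termEdge_self, termEdge_self,
        ← coefLhs_mul_ratioSnd (N := N) hh hX0 hY hS0 hS h1 hm, termCore_snd hh hY hS hS0 hm (by omega),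
        add_sub_cancel_right]
      ring
  · rw [if_neg (by omega), term_eq_zero hh _ (by omega) hkm, term_eq_zero hh _ hm (by omega),
      term_eq_zero hh _ hm (by omega)]
    ring

/-- The fused weight with `M` horizontal incoming particles, up to the conservation law. -/
def termSum (h Y S : ℂ) (L : ℤ) (N : ℕ) (I J M e : ℤ) : ℂ :=
  ∑ k ∈ Finset.range (N + 1), term h Y S L N I J M e k

theorem termSum_threeTerm {N : ℕ} (hh : h ≠ 0) (hX0 : X ≠ 0) (hY : ∀ n, lin h X⁻¹ n ≠ 0)
    (hS0 : S ≠ 0) (hS : ∀ n, lin h S n ≠ 0) (h1 : ∀ n, n ≠ 0 → lin h 1 n ≠ 0) (hm : 0 ≤ m)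
    (hmN : m < N) (hJ : 0 ≤ J) :
    coefLhs h X S (h ^ I) (h ^ J) (h ^ m) (h ^ L) * termSum h X⁻¹ S L N I J (m + 1) (N - 2 * J) =
      coefFst X S (h ^ I) (h ^ J) (h ^ m) (h ^ L) (h ^ (N : ℤ)) *
        termSum h X⁻¹ S L N (I - 1) J m (N - 2 * J - 1) +
      coefSnd X S (h ^ I) (h ^ J) (h ^ m) (h ^ L) (h ^ (N : ℤ)) *
        termSum h X⁻¹ S L N I (J - 1) m (N - 2 * J + 1) := by
  have e2 : termSum h X⁻¹ S L N I (J - 1) m (N - 2 * J + 1) = ∑ k ∈ Finset.range (N + 1),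
      (if (k : ℤ) = 0 then 0 else term h X⁻¹ S L N I (J - 1) m (N - 2 * J + 1) ((k : ℤ) - 1)) := by
    -- Shifting `k` by one drops the term `k = N`, which vanishes because `m < N`.
    rw [Finset.sum_range_succ', termSum, Finset.sum_range_succ, term_eq_zero hh _ hm hmN,
      if_pos Nat.cast_zero]
    refine congrArg (· + (0 : ℂ)) (Finset.sum_congr rfl fun k _ => ?_)
    rw [if_neg (by push_cast; omega)]
    exact congrArg (term h X⁻¹ S L N I (J - 1) m (N - 2 * J + 1)) (by push_cast; ring)
  rw [e2, termSum, termSum, Finset.mul_sum, Finset.mul_sum, Finset.mul_sum, ← Finset.sum_add_distrib]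
  exact Finset.sum_congr rfl fun k _ =>
    term_threeTerm hh hX0 hY hS0 hS h1 hm (Int.natCast_nonneg k) hJ

end

/-! ### The recursion for the entries of the stochastic matrix -/

section

variable {η : ℂ} {X z : ℂ}

/-- The spectral parameter of the fused weights. -/
def specS (η z : ℂ) (L N : ℕ) : ℂ := z⁻¹ / (qhalf η L ^ 2 * qhalf η N ^ 2)

theorem lin_dynX_ne (hX : ∀ k : ℤ, X ≠ qpow η 1 ^ (2 * k)) (hX0 : X ≠ 0) (n : ℤ) :
    lin (qpow η 1 ^ 2) X⁻¹ n ≠ 0 := fun e => hX n (by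
  rw [lin, sub_eq_zero] at e
  rw [_root_.zpow_mul, zpow_ofNat]
  field_simp at e
  exact e)

theorem specS_ne_zero (hz0 : z ≠ 0) (L N : ℕ) : specS η z L N ≠ 0 :=
  div_ne_zero (inv_ne_zero hz0) (mul_ne_zero (pow_ne_zero _ (qhalf_ne_zero _ _))
    (pow_ne_zero _ (qhalf_ne_zero _ _)))

theorem lin_specS_ne (hz0 : z ≠ 0) (hz : ∀ k : ℤ, z ≠ qpow η 1 ^ k) (L N : ℕ) (n : ℤ) :
    lin (qpow η 1 ^ 2) (specS η z L N) n ≠ 0 := fun e => hz (2 * n - L - N) (by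
  have h0 := qpow_ne_zero η 1
  rw [lin, sub_eq_zero, specS, qhalf_sq, qhalf_sq] at e
  rw [zpow_sub₀ h0, zpow_sub₀ h0, _root_.zpow_mul, zpow_ofNat]
  have e1 : qpow η 1 ^ (L : ℤ) ≠ 0 := zpow_ne_zero _ h0
  have e2 : qpow η 1 ^ (N : ℤ) ≠ 0 := zpow_ne_zero _ h0
  generalize (qpow η 1 ^ 2) ^ n = A at *
  generalize qpow η 1 ^ (L : ℤ) = B at *
  generalize qpow η 1 ^ (N : ℤ) = C at *
  field_simp at e ⊢
  rw [← e])

theorem lin_one_ne (h : Generic (qpow η 1)) {n : ℤ} (hn : n ≠ 0) :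
    lin (qpow η 1 ^ 2) 1 n ≠ 0 := fun e => h.zpow_ne_one (mul_ne_zero two_ne_zero hn) (by
  rw [lin, sub_eq_zero, mul_one] at e
  rw [_root_.zpow_mul, zpow_ofNat, ← e])

theorem sq_zpow (η : ℂ) (n : ℤ) : (qpow η 1 ^ 2) ^ n = (qpow η 1 ^ n) ^ 2 := by
  rw [← zpow_natCast, ← zpow_natCast, ← _root_.zpow_mul, ← _root_.zpow_mul, mul_comm]

theorem sq_zpow_nat (η : ℂ) (L : ℕ) : (qpow η 1 ^ 2) ^ (L : ℤ) = qhalf η L ^ 4 := by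
  rw [sq_zpow, ← qhalf_sq]; ring

/-- The common factor of the coefficients of the recursion. -/
def recFactor (η X : ℂ) (L N : ℕ) (x y : ℂ) : ℂ :=
  x * y * qhalf η L / (qhalf η N * (1 - X * (qhalf η L ^ 4 * qhalf η N ^ 4)⁻¹ * (x * y) ^ 4) *
    (qpow η 1 - (qpow η 1)⁻¹))

/-- The value of `w` that decouples the second tensor factor. -/
def sndShift (η X z : ℂ) (L N : ℕ) (xy m : ℂ) : ℂ :=
  z⁻¹ * m ^ 2 * (qhalf η N ^ 2)⁻¹ + X * (xy / m) ^ 2 * (qhalf η L ^ 2)⁻¹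

theorem dynFst_sndShift (L N : ℕ) (i m : ℤ) :
    dynFst η X z (sndShift η X z L N (qpow η 1 ^ (i + m + 1)) (qpow η 1 ^ m)) L N i m = 0 := by
  have h0 := qpow_ne_zero η 1
  have hm : qpow η 1 ^ m ≠ 0 := zpow_ne_zero _ h0
  rw [dynFst, sndShift, zpow_add₀ h0, zpow_add₀ h0, zpow_one]
  field_simp
  ring

/-- The last factor is exactly the quotient in `gauge_snd_succ`, so the gauge absorbs it. The other
two depend on `I` and `J` only through `I + J`. -/
theorem dynSnd_sndShift (hX : ∀ k : ℤ, X ≠ qpow η 1 ^ (2 * k)) (h : Generic (qpow η 1))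
    (hz0 : z ≠ 0) (L N : ℕ) {I J i m : ℤ} (hc : I + J = i + (m + 1)) :
    dynSnd η X z (sndShift η X z L N (qpow η 1 ^ I * qpow η 1 ^ J) (qpow η 1 ^ m)) L N i m =
      recFactor η X L N (qpow η 1 ^ I) (qpow η 1 ^ J) *
        coefLhs (qpow η 1 ^ 2) X (specS η z L N) ((qpow η 1 ^ 2) ^ I) ((qpow η 1 ^ 2) ^ J)
          ((qpow η 1 ^ 2) ^ m) ((qpow η 1 ^ 2) ^ (L : ℤ)) *
        (qhalf η N * (1 - X * (qpow η 1 ^ i) ^ 2 * qpow η 1 ^ 2) *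
        (1 - X * (qhalf η L ^ 4 * qhalf η N ^ 4)⁻¹ * (qpow η 1 ^ i * qpow η 1 ^ m) ^ 4 *
          qpow η 1 ^ 4) /
        (1 - X * (qhalf η L ^ 4)⁻¹ * (qpow η 1 ^ i) ^ 4 * qpow η 1 ^ 2)) := by
  have h0 := qpow_ne_zero η 1
  have hm : qpow η 1 ^ m ≠ 0 := zpow_ne_zero _ h0
  have hi : qpow η 1 ^ i ≠ 0 := zpow_ne_zero _ h0
  have ha := qhalf_ne_zero η L
  have hb := qhalf_ne_zero η N
  have hd := h.sub_inv_ne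
  have exy : qpow η 1 ^ I * qpow η 1 ^ J = qpow η 1 ^ i * (qpow η 1 ^ m * qpow η 1) := by
    rw [← zpow_add₀ h0, hc, zpow_add₀ h0, zpow_add_one₀ h0]
  have eP : (qpow η 1 ^ 2) ^ I * (qpow η 1 ^ 2) ^ J / ((qpow η 1 ^ 2) ^ m * qpow η 1 ^ 2) =
      (qpow η 1 ^ i) ^ 2 := by
    rw [sq_zpow, sq_zpow, sq_zpow, ← mul_pow, exy]
    field_simp
  have n1 := gauge_fst_ne hX L i 0
  have n2 := gauge_fst_ne hX L i (-1)
  have n3 := gauge_snd_ne hX L N i m 1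
  rw [zpow_zero, one_mul] at n1
  rw [zpow_one] at n3
  have n2' : 1 - X * (qhalf η L ^ 4)⁻¹ * (qpow η 1 ^ i) ^ 4 ≠ 0 := by
    convert n2 using 2
    rw [_root_.zpow_neg_one]
    field_simp
  have n3' : 1 - X * (qhalf η L ^ 4 * qhalf η N ^ 4)⁻¹ * (qpow η 1 ^ i * qpow η 1 ^ m) ^ 4 *
      qpow η 1 ^ 4 ≠ 0 := by
    convert n3 using 2
    ring
  rw [coefLhs, eP, sq_zpow_nat, sq_zpow, dynSnd, qn, sndShift, recFactor, exy, specS,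
    _root_.zpow_neg, zpow_add_one₀ h0]
  have e3 : (qpow η 1 ^ i * (qpow η 1 ^ m * qpow η 1)) ^ 4 =
    (qpow η 1 ^ i * qpow η 1 ^ m) ^ 4 * qpow η 1 ^ 4 := by ring
  rw [e3, ← mul_assoc (X * (qhalf η L ^ 4 * qhalf η N ^ 4)⁻¹)]
  generalize qpow η 1 ^ i = p at *
  generalize qpow η 1 ^ m = μ at *
  generalize qhalf η L = a at *
  generalize qhalf η N = b at *
  have c1 : 1 - X * (p ^ 2) ^ 2 / a ^ 4 = 1 - X * (a ^ 4)⁻¹ * p ^ 4 := by ring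
  have c2 : 1 - X * (p ^ 2) ^ 2 * qpow η 1 ^ 2 / a ^ 4 = 1 - X * (a ^ 4)⁻¹ * p ^ 4 * qpow η 1 ^ 2 := by
    ring
  rw [c1, c2]
  generalize d3 : 1 - X * (a ^ 4 * b ^ 4)⁻¹ * (p * μ) ^ 4 * qpow η 1 ^ 4 = D3 at *
  generalize d2 : 1 - X * (a ^ 4)⁻¹ * p ^ 4 = D2 at *
  generalize d1 : 1 - X * (a ^ 4)⁻¹ * p ^ 4 * qpow η 1 ^ 2 = D1 at *
  generalize dq : qpow η 1 - (qpow η 1)⁻¹ = Dq at *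
  -- For this `w` the bracket of `dynSnd` factors, and one of its factors cancels a denominator.
  have key : p⁻¹ ^ 2 * a ^ 2 + z⁻¹ * X * p ^ 4 * μ ^ 2 * qpow η 1 ^ 2 * (a ^ 4)⁻¹ * (b ^ 2)⁻¹ -
      (z⁻¹ * μ ^ 2 * (b ^ 2)⁻¹ + X * (p * (μ * qpow η 1) / μ) ^ 2 * (a ^ 2)⁻¹) =
      a ^ 2 * D1 * ((p ^ 2)⁻¹ - z⁻¹ / (a ^ 2 * b ^ 2) * μ ^ 2) := by
    rw [← d1]
    field_simp
    ring
  rw [key]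
  generalize (p ^ 2)⁻¹ - z⁻¹ / (a ^ 2 * b ^ 2) * μ ^ 2 = W
  field_simp

/-- Here and in `dynFst_swap` the last factor is the quotient of gauge values from `gauge_snd_succ`
or `gauge_fst_succ` with the two spaces exchanged. -/
theorem dynSnd_swap (hX : ∀ k : ℤ, X ≠ qpow η 1 ^ (2 * k)) (h : Generic (qpow η 1))
    (hz0 : z ≠ 0) (L N : ℕ) (w : ℂ) (I J : ℤ) :
    z⁻¹ * dynSnd η X z⁻¹ (z * w) N L J (I - 1) =
      recFactor η X L N (qpow η 1 ^ I) (qpow η 1 ^ J) *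
        recFst X (specS η z L N) ((qpow η 1 ^ 2) ^ I) ((qpow η 1 ^ 2) ^ J)
          ((qpow η 1 ^ 2) ^ (L : ℤ)) ((qpow η 1 ^ 2) ^ (N : ℤ)) (w / qhalf η L ^ 2) *
        (qhalf η L * (1 - X * (qpow η 1 ^ J) ^ 2 * qpow η 1 ^ 2) *
        (1 - X * (qhalf η N ^ 4 * qhalf η L ^ 4)⁻¹ * (qpow η 1 ^ J * qpow η 1 ^ (I - 1)) ^ 4 *
          qpow η 1 ^ 4) /
        (1 - X * (qhalf η N ^ 4)⁻¹ * (qpow η 1 ^ J) ^ 4 * qpow η 1 ^ 2)) := by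
  have h0 := qpow_ne_zero η 1
  have hI : qpow η 1 ^ I ≠ 0 := zpow_ne_zero _ h0
  have hJ : qpow η 1 ^ J ≠ 0 := zpow_ne_zero _ h0
  have ha := qhalf_ne_zero η L
  have hb := qhalf_ne_zero η N
  have hd := h.sub_inv_ne
  have n1 := gauge_fst_ne hX N J 0
  have n2 := gauge_fst_ne hX N J (-1)
  have n3 := gauge_snd_ne hX N L J (I - 1) 1
  rw [zpow_zero, one_mul] at n1
  rw [zpow_one] at n3
  have n2' : 1 - X * (qhalf η N ^ 4)⁻¹ * (qpow η 1 ^ J) ^ 4 ≠ 0 := by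
    convert n2 using 2
    rw [_root_.zpow_neg_one]
    field_simp
  have e3 : X * (qhalf η N ^ 4 * qhalf η L ^ 4)⁻¹ * (qpow η 1 ^ J * qpow η 1 ^ (I - 1)) ^ 4 *
      qpow η 1 ^ 4 =
      X * (qhalf η L ^ 4 * qhalf η N ^ 4)⁻¹ * (qpow η 1 ^ I * qpow η 1 ^ J) ^ 4 := by
    rw [zpow_sub_one₀ h0]
    field_simp
  have n3' : 1 - X * (qhalf η L ^ 4 * qhalf η N ^ 4)⁻¹ * (qpow η 1 ^ I * qpow η 1 ^ J) ^ 4 ≠ 0 := by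
    rw [← e3]
    convert n3 using 2
    ring
  rw [e3, recFst, sq_zpow_nat, sq_zpow_nat, sq_zpow, sq_zpow, dynSnd, qn, recFactor, specS, sub_add_cancel, zpow_sub_one₀ h0, _root_.zpow_neg]
  generalize qpow η 1 ^ I = x at *
  generalize qpow η 1 ^ J = y at *
  generalize qhalf η L = a at *
  generalize qhalf η N = b at *
  have c1 : 1 - X * (y ^ 2) ^ 2 / b ^ 4 = 1 - X * (b ^ 4)⁻¹ * y ^ 4 := by ring
  rw [c1]
  generalize d3 : 1 - X * (a ^ 4 * b ^ 4)⁻¹ * (x * y) ^ 4 = D3 at *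
  generalize d2 : 1 - X * (b ^ 4)⁻¹ * y ^ 4 = D2 at *
  generalize d1 : 1 - X * (b ^ 4)⁻¹ * y ^ 4 * qpow η 1 ^ 2 = D1 at *
  generalize dq : qpow η 1 - (qpow η 1)⁻¹ = Dq at *
  have key : z⁻¹ * (y⁻¹ ^ 2 * b ^ 2 + z⁻¹⁻¹ * X * y ^ 4 * (x * (qpow η 1)⁻¹) ^ 2 * qpow η 1 ^ 2 *
      (b ^ 4)⁻¹ * (a ^ 2)⁻¹ - z * w) =
      a ^ 2 * (z⁻¹ / (a ^ 2 * b ^ 2) * b ^ 4 / y ^ 2 + X * (y ^ 2) ^ 2 * x ^ 2 / (b ^ 4 * a ^ 4) -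
        w / a ^ 2) := by
    field_simp
  rw [mul_comm, mul_assoc, mul_comm _ z⁻¹, key]
  generalize z⁻¹ / (a ^ 2 * b ^ 2) * b ^ 4 / y ^ 2 + X * (y ^ 2) ^ 2 * x ^ 2 / (b ^ 4 * a ^ 4) -
        w / a ^ 2 = W
  field_simp

theorem dynFst_swap (hX : ∀ k : ℤ, X ≠ qpow η 1 ^ (2 * k)) (h : Generic (qpow η 1))
    (hz0 : z ≠ 0) (L N : ℕ) (w : ℂ) (I J : ℤ) :
    z⁻¹ * dynFst η X z⁻¹ (z * w) N L (J - 1) I =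
      recFactor η X L N (qpow η 1 ^ I) (qpow η 1 ^ J) *
        recSnd X (specS η z L N) ((qpow η 1 ^ 2) ^ I) ((qpow η 1 ^ 2) ^ J)
          ((qpow η 1 ^ 2) ^ (L : ℤ)) ((qpow η 1 ^ 2) ^ (N : ℤ)) (w / qhalf η L ^ 2) *
      (qhalf η N * qhalf η L ^ 2 *
        (1 - X * (qhalf η N ^ 4)⁻¹ * (qpow η 1 ^ (J - 1)) ^ 4 * qpow η 1 ^ 4) *
        (1 - X * (qhalf η N ^ 4 * qhalf η L ^ 4)⁻¹ * (qpow η 1 ^ (J - 1) * qpow η 1 ^ I) ^ 4 *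
          qpow η 1 ^ 4) /
        (1 - X * (qhalf η N ^ 4)⁻¹ * (qpow η 1 ^ (J - 1)) ^ 4 * (qpow η 1 ^ I) ^ 2 *
          qpow η 1 ^ 4)) := by
  have h0 := qpow_ne_zero η 1
  have hI : qpow η 1 ^ I ≠ 0 := zpow_ne_zero _ h0
  have hJ : qpow η 1 ^ J ≠ 0 := zpow_ne_zero _ h0
  have ha := qhalf_ne_zero η L
  have hb := qhalf_ne_zero η N
  have hd := h.sub_inv_ne
  have n2 := gauge_fst_ne hX N J (-1)
  have n1 := gauge_fst_ne hX N J (-1 + I)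
  have n3 := gauge_snd_ne hX N L J I (-1)
  have n2' : 1 - X * (qhalf η N ^ 4)⁻¹ * (qpow η 1 ^ J) ^ 4 ≠ 0 := by
    convert n2 using 2
    rw [_root_.zpow_neg_one]
    field_simp
  have n1' : 1 - X * (qhalf η N ^ 4)⁻¹ * (qpow η 1 ^ J) ^ 4 * (qpow η 1 ^ I) ^ 2 ≠ 0 := by
    convert n1 using 2
    rw [zpow_add₀ (pow_ne_zero 2 h0), _root_.zpow_neg_one, sq_zpow]
    field_simp
  have n3' : 1 - X * (qhalf η L ^ 4 * qhalf η N ^ 4)⁻¹ * (qpow η 1 ^ I * qpow η 1 ^ J) ^ 4 ≠ 0 := by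
    convert n3 using 2
    rw [_root_.zpow_neg_one]
    field_simp
  have e1 : X * (qhalf η N ^ 4)⁻¹ * (qpow η 1 ^ (J - 1)) ^ 4 * (qpow η 1 ^ I) ^ 2 * qpow η 1 ^ 4 =
      X * (qhalf η N ^ 4)⁻¹ * (qpow η 1 ^ J) ^ 4 * (qpow η 1 ^ I) ^ 2 := by
    rw [zpow_sub_one₀ h0]
    field_simp
  have e2 : X * (qhalf η N ^ 4)⁻¹ * (qpow η 1 ^ (J - 1)) ^ 4 * qpow η 1 ^ 4 =
      X * (qhalf η N ^ 4)⁻¹ * (qpow η 1 ^ J) ^ 4 := by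
    rw [zpow_sub_one₀ h0]
    field_simp
  have e3 : X * (qhalf η N ^ 4 * qhalf η L ^ 4)⁻¹ * (qpow η 1 ^ (J - 1) * qpow η 1 ^ I) ^ 4 *
      qpow η 1 ^ 4 =
      X * (qhalf η L ^ 4 * qhalf η N ^ 4)⁻¹ * (qpow η 1 ^ I * qpow η 1 ^ J) ^ 4 := by
    rw [zpow_sub_one₀ h0]
    field_simp
  rw [e1, e2, e3, recSnd, sq_zpow_nat, sq_zpow_nat, sq_zpow, sq_zpow, dynFst, qn,
    recFactor, specS, sub_add_cancel, zpow_sub_one₀ h0, _root_.zpow_neg]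
  generalize qpow η 1 ^ I = x at *
  generalize qpow η 1 ^ J = y at *
  generalize qhalf η L = a at *
  generalize qhalf η N = b at *
  have c1 : 1 - X * (y ^ 2) ^ 2 / b ^ 4 = 1 - X * (b ^ 4)⁻¹ * y ^ 4 := by ring
  have c2 : 1 - X * (y ^ 2) ^ 2 * x ^ 2 / b ^ 4 = 1 - X * (b ^ 4)⁻¹ * y ^ 4 * x ^ 2 := by ring
  rw [c1, c2]
  generalize d3 : 1 - X * (a ^ 4 * b ^ 4)⁻¹ * (x * y) ^ 4 = D3 at *
  generalize d2 : 1 - X * (b ^ 4)⁻¹ * y ^ 4 = D2 at *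
  generalize d1 : 1 - X * (b ^ 4)⁻¹ * y ^ 4 * x ^ 2 = D1 at *
  generalize dq : qpow η 1 - (qpow η 1)⁻¹ = Dq at *
  have key : z⁻¹ * (z⁻¹⁻¹ * x ^ 2 * (a ^ 2)⁻¹ + X * (y * (qpow η 1)⁻¹) ^ 2 * qpow η 1 ^ 2 *
      (b ^ 2)⁻¹ - z * w) =
      a ^ 2 * (x ^ 2 / a ^ 4 + z⁻¹ / (a ^ 2 * b ^ 2) * X * y ^ 2 -
        w / a ^ 2) := by
    field_simp
  rw [mul_comm, mul_assoc, mul_comm _ z⁻¹, key]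
  generalize x ^ 2 / a ^ 4 + z⁻¹ / (a ^ 2 * b ^ 2) * X * y ^ 2 -
        w / a ^ 2 = W
  field_simp

end

/-! ### The recursion after the gauge transformation. -/

section

variable {η z lam : ℂ} {L N : ℕ}

/-- The entries of the stochastic matrix, for arbitrary integer indices. -/
def sCoeff (η lam z : ℂ) (L N : ℕ) (I J i m : ℤ) : ℂ :=
  rCoeff η lam z L N I J i m * gauge η (dynX lam) L N i m / gauge η (dynX lam) N L J I

theorem dynX_ne_shift (hX : ∀ k : ℤ, dynX lam ≠ qpow η 1 ^ (2 * k)) (k : ℤ) :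
    dynX (lam - 2 * η) ≠ qpow η 1 ^ (2 * k) := by
  rw [dynX_shift]; exact shift_ne hX k

theorem sCoeff_eq_zero {I J : ℤ} (hIJ : I < 0 ∨ (L : ℤ) < I ∨ J < 0 ∨ (N : ℤ) < J) (i m : ℤ) :
    sCoeff η lam z L N I J i m = 0 := by
  rw [sCoeff, rCoeff, coord_eq_zero hIJ]; ring

theorem sCoeff_exchange (h : Generic (qpow η 1)) (hz0 : z ≠ 0) (hz : ∀ k : ℤ, z ≠ qpow η 1 ^ k)
    (hX : ∀ k : ℤ, dynX lam ≠ qpow η 1 ^ (2 * k)) (w : ℂ) {I J : ℤ}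
    (hI : 0 ≤ I ∧ I ≤ L) (hJ : 0 ≤ J ∧ J ≤ N) (i m : ℤ) :
    (dynFst η (dynX lam) z w L N i m * rCoeff η lam z L N I J (i + 1) m +
      dynSnd η (dynX lam) z w L N i m * rCoeff η lam z L N I J i (m + 1)) *
        gauge η (dynX lam * qpow η 1 ^ 2) L N i m =
    recFactor η (dynX lam) L N (qpow η 1 ^ I) (qpow η 1 ^ J) *
      (recSnd (dynX lam) (specS η z L N) ((qpow η 1 ^ 2) ^ I) ((qpow η 1 ^ 2) ^ J)
          ((qpow η 1 ^ 2) ^ (L : ℤ)) ((qpow η 1 ^ 2) ^ (N : ℤ)) (w / qhalf η L ^ 2) *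
        sCoeff η (lam - 2 * η) z L N I (J - 1) i m +
      recFst (dynX lam) (specS η z L N) ((qpow η 1 ^ 2) ^ I) ((qpow η 1 ^ 2) ^ J)
          ((qpow η 1 ^ 2) ^ (L : ℤ)) ((qpow η 1 ^ 2) ^ (N : ℤ)) (w / qhalf η L ^ 2) *
        sCoeff η (lam - 2 * η) z L N (I - 1) J i m) * gauge η (dynX lam) N L J I := by
  have g1 := gauge_ne_zero (shift_ne hX) N L J (I - 1)
  have g2 := gauge_ne_zero (shift_ne hX) N L (J - 1) I
  have e1 := gauge_snd_succ hX N L J (I - 1)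
  have e2 := gauge_fst_succ hX N L (J - 1) I
  rw [sub_add_cancel] at e1 e2
  rw [rCoeff_exchange h hz0 hz hX w hI hJ, dynSnd_swap hX h hz0, dynFst_swap hX h hz0,
    eq_div_of_mul_eq g1 ((mul_comm _ _).trans e1.symm),
    eq_div_of_mul_eq g2 ((mul_comm _ _).trans e2.symm)]
  simp only [sCoeff, dynX_shift]
  ring

theorem recFactor_ne_zero {X : ℂ} (h : Generic (qpow η 1))
    (hX : ∀ k : ℤ, X ≠ qpow η 1 ^ (2 * k)) (L N : ℕ) (I J : ℤ) :
    recFactor η X L N (qpow η 1 ^ I) (qpow η 1 ^ J) ≠ 0 := by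
  have h0 := qpow_ne_zero η 1
  have n3 := gauge_snd_ne hX L N I J (-1)
  have e : (qpow η 1 ^ 2) ^ (-1 : ℤ) * (X * (qhalf η L ^ 4 * qhalf η N ^ 4)⁻¹ *
      (qpow η 1 ^ I * qpow η 1 ^ J) ^ 4 * qpow η 1 ^ 2) =
      X * (qhalf η L ^ 4 * qhalf η N ^ 4)⁻¹ * (qpow η 1 ^ I * qpow η 1 ^ J) ^ 4 := by
    rw [_root_.zpow_neg_one, mul_comm, mul_assoc _ (qpow η 1 ^ 2), mul_inv_cancel₀ (pow_ne_zero 2 h0),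
      mul_one]
  rw [e] at n3
  exact div_ne_zero (mul_ne_zero (mul_ne_zero (zpow_ne_zero _ h0) (zpow_ne_zero _ h0))
    (qhalf_ne_zero _ _)) (mul_ne_zero (mul_ne_zero (qhalf_ne_zero _ _) n3) h.sub_inv_ne)

theorem coefLhs_ne_zero {X : ℂ} (h : Generic (qpow η 1)) (hz0 : z ≠ 0)
    (hz : ∀ k : ℤ, z ≠ qpow η 1 ^ k) (hX : ∀ k : ℤ, X ≠ qpow η 1 ^ (2 * k)) (hX0 : X ≠ 0)
    (I J : ℤ) {m : ℤ} (hm : 0 ≤ m) :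
    coefLhs (qpow η 1 ^ 2) X (specS η z L N) ((qpow η 1 ^ 2) ^ I) ((qpow η 1 ^ 2) ^ J)
      ((qpow η 1 ^ 2) ^ m) ((qpow η 1 ^ 2) ^ (L : ℤ)) ≠ 0 := by
  have hh : qpow η 1 ^ 2 ≠ 0 := pow_ne_zero 2 (qpow_ne_zero η 1)
  have hY := lin_dynX_ne hX hX0
  rw [coefLhs_eq (N := 0) hh hX0 hY]
  exact mul_ne_zero (div_ne_zero hX0 (mul_ne_zero (zpow_ne_zero _ hh) (zpow_ne_zero _ hh)))
    (div_ne_zero (mul_ne_zero (mul_ne_zero (mul_ne_zero (lin_one_ne h (by omega)) (hY _))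
      (lin_specS_ne hz0 hz L N _)) (hY _)) (hY _))

/-- The value of `w` that decouples the first tensor factor. -/
def fstShift (η X z : ℂ) (L N : ℕ) (p : ℂ) : ℂ :=
  p⁻¹ ^ 2 * qhalf η L ^ 2 +
    z⁻¹ * X * p ^ 4 * qpow η 1 ^ 2 * (qhalf η L ^ 4)⁻¹ * (qhalf η N ^ 2)⁻¹

theorem dynSnd_fstShift (X : ℂ) (L N : ℕ) (i : ℤ) :
    dynSnd η X z (fstShift η X z L N (qpow η 1 ^ i)) L N i 0 = 0 := by
  rw [dynSnd, fstShift, zpow_zero]; ring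

/-- The counterpart of `coefLhs` in the column without horizontal incoming particles; `n` stands for
`h^{I+J}`. -/
def baseLhs (h X S n a : ℂ) : ℂ :=
  (1 - n⁻¹) * (S - (n / h)⁻¹) * (1 - X * (n / h) ^ 2 * h / a)

theorem dynFst_fstShift {X : ℂ} (hX : ∀ k : ℤ, X ≠ qpow η 1 ^ (2 * k)) (h : Generic (qpow η 1))
    (hz0 : z ≠ 0) (L N : ℕ) {I J i : ℤ} (hc : I + J = i + 1) :
    dynFst η X z (fstShift η X z L N (qpow η 1 ^ i)) L N i 0 =
      recFactor η X L N (qpow η 1 ^ I) (qpow η 1 ^ J) *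
        baseLhs (qpow η 1 ^ 2) X (specS η z L N) ((qpow η 1 ^ 2) ^ (i + 1))
          ((qpow η 1 ^ 2) ^ (L : ℤ)) *
        (qhalf η L * qhalf η N ^ 2 *
          (1 - X * (qhalf η L ^ 4)⁻¹ * (qpow η 1 ^ i) ^ 4 * qpow η 1 ^ 4) *
          (1 - X * (qhalf η L ^ 4 * qhalf η N ^ 4)⁻¹ * (qpow η 1 ^ i * qpow η 1 ^ (0 : ℤ)) ^ 4 *
            qpow η 1 ^ 4) /
          (1 - X * (qhalf η L ^ 4)⁻¹ * (qpow η 1 ^ i) ^ 4 * (qpow η 1 ^ (0 : ℤ)) ^ 2 *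
            qpow η 1 ^ 4)) := by
  have h0 := qpow_ne_zero η 1
  have hi : qpow η 1 ^ i ≠ 0 := zpow_ne_zero _ h0
  have ha := qhalf_ne_zero η L
  have hb := qhalf_ne_zero η N
  have hd := h.sub_inv_ne
  have exy : qpow η 1 ^ I * qpow η 1 ^ J = qpow η 1 ^ i * qpow η 1 := by
    rw [← zpow_add₀ h0, hc, zpow_add_one₀ h0]
  have n1 := gauge_fst_ne hX L i 1
  have n3 := gauge_snd_ne hX L N i 0 1
  have n1' : 1 - X * (qhalf η L ^ 4)⁻¹ * (qpow η 1 ^ i) ^ 4 * qpow η 1 ^ 4 ≠ 0 := by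
    convert n1 using 2
    rw [zpow_one]; ring
  have n3' : 1 - X * (qhalf η L ^ 4 * qhalf η N ^ 4)⁻¹ * (qpow η 1 ^ i) ^ 4 * qpow η 1 ^ 4 ≠ 0 := by
    convert n3 using 2
    rw [zpow_one, zpow_zero]; ring
  rw [dynFst, fstShift, recFactor, baseLhs, specS, exy, sq_zpow_nat, sq_zpow, qn, _root_.zpow_neg,
    zpow_add_one₀ h0, zpow_zero]
  have e3 : X * (qhalf η L ^ 4 * qhalf η N ^ 4)⁻¹ * (qpow η 1 ^ i * qpow η 1) ^ 4 =
    X * (qhalf η L ^ 4 * qhalf η N ^ 4)⁻¹ * (qpow η 1 ^ i) ^ 4 * qpow η 1 ^ 4 := by ring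
  rw [e3]
  simp only [mul_one, one_pow]
  generalize qpow η 1 ^ i = p at *
  generalize qhalf η L = a at *
  generalize qhalf η N = b at *
  generalize 1 - X * (a ^ 4 * b ^ 4)⁻¹ * p ^ 4 * qpow η 1 ^ 4 = D3 at *
  generalize 1 - X * (a ^ 4)⁻¹ * p ^ 4 * qpow η 1 ^ 4 = D1 at *
  generalize qpow η 1 - (qpow η 1)⁻¹ = Dq at *
  field_simp
  ring

theorem fstShift_div (X : ℂ) (L N : ℕ) (i : ℤ) :
    fstShift η X z L N (qpow η 1 ^ i) / qhalf η L ^ 2 =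
      ((qpow η 1 ^ 2) ^ (i + 1) / qpow η 1 ^ 2)⁻¹ + specS η z L N * X *
        ((qpow η 1 ^ 2) ^ (i + 1) / qpow η 1 ^ 2) ^ 2 * qpow η 1 ^ 2 /
          (qpow η 1 ^ 2) ^ (L : ℤ) := by
  have h0 := qpow_ne_zero η 1
  have hi : qpow η 1 ^ i ≠ 0 := zpow_ne_zero _ h0
  have ha := qhalf_ne_zero η L
  have hb := qhalf_ne_zero η N
  rw [fstShift, specS, sq_zpow_nat, sq_zpow, zpow_add_one₀ h0]
  field_simp

theorem sndShift_div (X : ℂ) (L N : ℕ) (I J m : ℤ) :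
    sndShift η X z L N (qpow η 1 ^ I * qpow η 1 ^ J) (qpow η 1 ^ m) / qhalf η L ^ 2 =
      specS η z L N * (qpow η 1 ^ 2) ^ m + X * (qpow η 1 ^ 2) ^ I * (qpow η 1 ^ 2) ^ J /
        ((qpow η 1 ^ 2) ^ m * (qpow η 1 ^ 2) ^ (L : ℤ)) := by
  have h0 := qpow_ne_zero η 1
  have hm : qpow η 1 ^ m ≠ 0 := zpow_ne_zero _ h0
  have ha := qhalf_ne_zero η L
  have hb := qhalf_ne_zero η N
  rw [sndShift, specS, sq_zpow_nat, sq_zpow, sq_zpow, sq_zpow]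
  field_simp

theorem baseLhs_ne_zero {X : ℂ} (h : Generic (qpow η 1)) (hz0 : z ≠ 0)
    (hz : ∀ k : ℤ, z ≠ qpow η 1 ^ k) (hX : ∀ k : ℤ, X ≠ qpow η 1 ^ (2 * k)) {i : ℤ} (hi : 0 ≤ i) :
    baseLhs (qpow η 1 ^ 2) X (specS η z L N) ((qpow η 1 ^ 2) ^ (i + 1))
      ((qpow η 1 ^ 2) ^ (L : ℤ)) ≠ 0 := by
  have h0 := qpow_ne_zero η 1
  have hh : qpow η 1 ^ 2 ≠ 0 := pow_ne_zero 2 h0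
  have hp : (qpow η 1 ^ 2) ^ i ≠ 0 := zpow_ne_zero _ hh
  have e : (qpow η 1 ^ 2) ^ (i + 1) / qpow η 1 ^ 2 = (qpow η 1 ^ 2) ^ i := by
    rw [zpow_add_one₀ hh, mul_div_assoc, div_self hh, mul_one]
  rw [baseLhs, e]
  refine mul_ne_zero (mul_ne_zero (fun e1 => ?_) (fun e1 => ?_)) (fun e1 => ?_)
  · have := lin_one_ne h (n := i + 1) (by omega)
    rw [sub_eq_zero, eq_comm, inv_eq_one] at e1
    exact this (by rw [lin, e1]; ring)
  · refine lin_specS_ne hz0 hz L N i ?_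
    rw [lin, sub_eq_zero.1 e1, mul_inv_cancel₀ hp, sub_self]
  · have := gauge_fst_ne hX L i 0
    apply this
    rw [← e1, zpow_zero, one_mul, sq_zpow_nat, sq_zpow]
    ring

/-- The auxiliary pair `I', J'` only records the incoming level. When particle number is conserved
it is `I, J` and the common factor cancels; otherwise the relation serves to prove that the entry
vanishes. -/
theorem sCoeff_snd (h : Generic (qpow η 1)) (hz0 : z ≠ 0) (hz : ∀ k : ℤ, z ≠ qpow η 1 ^ k)
    (hX : ∀ k : ℤ, dynX lam ≠ qpow η 1 ^ (2 * k)) {I J I' J' : ℤ}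
    (hI : 0 ≤ I ∧ I ≤ L) (hJ : 0 ≤ J ∧ J ≤ N) {i m : ℤ} (hc : I' + J' = i + (m + 1)) :
    recFactor η (dynX lam) L N (qpow η 1 ^ I') (qpow η 1 ^ J') *
      coefLhs (qpow η 1 ^ 2) (dynX lam) (specS η z L N) ((qpow η 1 ^ 2) ^ I') ((qpow η 1 ^ 2) ^ J')
      ((qpow η 1 ^ 2) ^ m) ((qpow η 1 ^ 2) ^ (L : ℤ)) * sCoeff η lam z L N I J i (m + 1) =
    recFactor η (dynX lam) L N (qpow η 1 ^ I) (qpow η 1 ^ J) *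
      (recSnd (dynX lam) (specS η z L N) ((qpow η 1 ^ 2) ^ I) ((qpow η 1 ^ 2) ^ J)
          ((qpow η 1 ^ 2) ^ (L : ℤ)) ((qpow η 1 ^ 2) ^ (N : ℤ))
          (sndShift η (dynX lam) z L N (qpow η 1 ^ I' * qpow η 1 ^ J') (qpow η 1 ^ m) /
            qhalf η L ^ 2) * sCoeff η (lam - 2 * η) z L N I (J - 1) i m +
      recFst (dynX lam) (specS η z L N) ((qpow η 1 ^ 2) ^ I) ((qpow η 1 ^ 2) ^ J)
          ((qpow η 1 ^ 2) ^ (L : ℤ)) ((qpow η 1 ^ 2) ^ (N : ℤ))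
          (sndShift η (dynX lam) z L N (qpow η 1 ^ I' * qpow η 1 ^ J') (qpow η 1 ^ m) /
            qhalf η L ^ 2) * sCoeff η (lam - 2 * η) z L N (I - 1) J i m) := by
  have h0 := qpow_ne_zero η 1
  have e := sCoeff_exchange h hz0 hz hX
    (sndShift η (dynX lam) z L N (qpow η 1 ^ I' * qpow η 1 ^ J') (qpow η 1 ^ m)) hI hJ i m
  have e0 : dynFst η (dynX lam) z
      (sndShift η (dynX lam) z L N (qpow η 1 ^ I' * qpow η 1 ^ J') (qpow η 1 ^ m)) L N i m = 0 := by
    rw [← zpow_add₀ h0, hc, ← add_assoc]; exact dynFst_sndShift L N i m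
  rw [e0, zero_mul, zero_add, dynSnd_sndShift hX h hz0 L N hc] at e
  have g := gauge_snd_succ hX L N i m
  have n := gauge_ne_zero hX N L J I
  refine mul_right_cancel₀ n (Eq.trans ?_ e)
  rw [sCoeff, g]
  field_simp

theorem sCoeff_fst (h : Generic (qpow η 1)) (hz0 : z ≠ 0) (hz : ∀ k : ℤ, z ≠ qpow η 1 ^ k)
    (hX : ∀ k : ℤ, dynX lam ≠ qpow η 1 ^ (2 * k)) {I J I' J' : ℤ}
    (hI : 0 ≤ I ∧ I ≤ L) (hJ : 0 ≤ J ∧ J ≤ N) {i : ℤ} (hc : I' + J' = i + 1) :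
    recFactor η (dynX lam) L N (qpow η 1 ^ I') (qpow η 1 ^ J') *
      baseLhs (qpow η 1 ^ 2) (dynX lam) (specS η z L N) ((qpow η 1 ^ 2) ^ (i + 1))
      ((qpow η 1 ^ 2) ^ (L : ℤ)) * sCoeff η lam z L N I J (i + 1) 0 =
    recFactor η (dynX lam) L N (qpow η 1 ^ I) (qpow η 1 ^ J) *
      (recSnd (dynX lam) (specS η z L N) ((qpow η 1 ^ 2) ^ I) ((qpow η 1 ^ 2) ^ J)
          ((qpow η 1 ^ 2) ^ (L : ℤ)) ((qpow η 1 ^ 2) ^ (N : ℤ))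
          (fstShift η (dynX lam) z L N (qpow η 1 ^ i) / qhalf η L ^ 2) *
          sCoeff η (lam - 2 * η) z L N I (J - 1) i 0 +
      recFst (dynX lam) (specS η z L N) ((qpow η 1 ^ 2) ^ I) ((qpow η 1 ^ 2) ^ J)
          ((qpow η 1 ^ 2) ^ (L : ℤ)) ((qpow η 1 ^ 2) ^ (N : ℤ))
          (fstShift η (dynX lam) z L N (qpow η 1 ^ i) / qhalf η L ^ 2) *
          sCoeff η (lam - 2 * η) z L N (I - 1) J i 0) := by
  have e := sCoeff_exchange h hz0 hz hX (fstShift η (dynX lam) z L N (qpow η 1 ^ i)) hI hJ i 0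
  rw [dynSnd_fstShift, zero_mul, add_zero, dynFst_fstShift hX h hz0 L N hc] at e
  have g := gauge_fst_succ hX L N i 0
  have n := gauge_ne_zero hX N L J I
  refine mul_right_cancel₀ n (Eq.trans ?_ e)
  rw [sCoeff, g]
  field_simp

end

/-! ### The column without horizontal incoming particles -/

section

variable {h X S : ℂ} {L N I J e : ℤ}

/-- The fused weight without horizontal incoming particles. -/
def baseTerm (h Y S : ℂ) (L N I J e : ℤ) : ℂ :=
  h ^ (-I * N) * (S * h ^ L) ^ J * (qp h S N I * qp h 1 (I - L) J *
    qp h Y (-2 * I + 1 + L + e) I * qp h (S⁻¹ * Y) (1 - I - N + e) J) /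
    (qp h S 0 (I + J) * qp h Y (-I - N + 1 + L + e) J * qp h Y (-2 * I - N + 1 + L + e) I)

/-- The very-well-poised factor cancels against the symbol next to it. -/
theorem term_zero_zero (hh : h ≠ 0) {Y : ℂ} (hY : ∀ n, lin h Y n ≠ 0) :
    term h Y S L N I J 0 e 0 = baseTerm h Y S L N I J e := by
  have f1 := qp_succ' hh (x := Y) (n' := 0 - 0 + e) (n := 0 + 1 + e) (m' := J + 1) (m := J)
    (by ring) rfl (Or.inr (hY _))
  have f2 : (0 : ℤ) - 2 * I - N + L + e = -2 * I - N + L + e := by ring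
  have n1 := hY (0 - 0 + e)
  have n2 := qp_ne_zero hh hY (0 + 1 + e) J
  rw [term, termEdge_self, termCore, baseTerm, termMonomial, f1]
  simp only [qp_zero, sub_zero, add_zero, zero_sub, mul_zero, zero_mul, zero_add, mul_one,
    Int.zero_ediv, zpow_zero, div_one] at *
  rw [← neg_mul]
  have c : lin h Y e / lin h Y e * (qp h Y (1 + e) J / qp h Y (1 + e) J) = 1 := by
    rw [div_self n1, div_self n2, one_mul]
  refine Eq.trans ?_ ((congrArg (· * _) c).trans (one_mul _))
  ring_nf

theorem baseTerm_fst (hh : h ≠ 0) {Y : ℂ} (hY : ∀ n, lin h Y n ≠ 0) (hS : ∀ n, lin h S n ≠ 0)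
    (h1 : ∀ n, n ≠ 0 → lin h 1 n ≠ 0) (hI : I ≤ L) (hJ : 0 ≤ J) :
    baseTerm h Y S L N I J e = baseTerm h Y S L N (I - 1) J (e - 1) *
      ((h ^ N)⁻¹ * lin h S (N + (I - 1)) * (lin h 1 (I - 1 - L + J) / lin h 1 (I - 1 - L)) *
        lin h Y (-2 * I + 1 + L + e) / (lin h S (I - 1 + J) * lin h Y (-2 * I - N + 1 + L + e))) := by
  have f1 := qp_succ hh (x := S) (n' := N) (n := N) (m' := I) (m := I - 1) rfl (by ring)
    (Or.inr (hS _))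
  have f2 := qp_shift hh (x := 1) (n' := I - L) (n := I - 1 - L) (m' := J) (m := J) (by ring) rfl
    (h1 _ (by omega)) (Or.inl hJ)
  have f3 := qp_succ' hh (x := Y) (n' := -2 * I + 1 + L + e) (n := -2 * (I - 1) + 1 + L + (e - 1))
    (m' := I) (m := I - 1) (by ring) (by ring) (Or.inr (hY _))
  have f4 := qp_congr h (S⁻¹ * Y) (n' := 1 - I - N + e) (n := 1 - (I - 1) - N + (e - 1)) (m' := J)
    (m := J) (by ring) rfl
  have f5 := qp_succ hh (x := S) (n' := 0) (n := 0) (m' := I + J) (m := I - 1 + J) rfl (by ring)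
    (Or.inr (hS _))
  have f6 := qp_congr h Y (n' := -I - N + 1 + L + e) (n := -(I - 1) - N + 1 + L + (e - 1))
    (m' := J) (m := J) (by ring) rfl
  have f7 := qp_succ' hh (x := Y) (n' := -2 * I - N + 1 + L + e)
    (n := -2 * (I - 1) - N + 1 + L + (e - 1)) (m' := I) (m := I - 1) (by ring) (by ring)
    (Or.inr (hY _))
  have f8 : h ^ (-I * N) = h ^ (-(I - 1) * N) * (h ^ N)⁻¹ := by
    rw [← _root_.zpow_neg, ← zpow_add₀ hh]; ring_nf
  rw [baseTerm, f1, f2, f3, f4, f5, f6, f7, f8, baseTerm, zero_add]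
  ring

theorem baseTerm_snd (hh : h ≠ 0) {Y : ℂ} (hY : ∀ n, lin h Y n ≠ 0) (hS0 : S ≠ 0)
    (hS : ∀ n, lin h S n ≠ 0) (hJ : 1 ≤ J) :
    baseTerm h Y S L N I J e = baseTerm h Y S L N I (J - 1) (e + 1) *
      (S * h ^ L * lin h 1 (I - L + (J - 1)) * lin h Y (-2 * I + 1 + L + e) *
        lin h (S⁻¹ * Y) (1 - I - N + e) / (lin h Y (-I + 1 + L + e) * lin h S (I - 1 + J) *
          lin h Y (-2 * I - N + 1 + L + e))) := by
  have f2 := qp_succ hh (x := 1) (n' := I - L) (n := I - L) (m' := J) (m := J - 1) rfl (by ring)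
    (Or.inl (by omega))
  have f3 := qp_shift hh (x := Y) (n := -2 * I + 1 + L + e) (n' := -2 * I + 1 + L + (e + 1))
    (m' := I) (m := I) (by ring) rfl (hY _) (Or.inr (hY _))
  have f4 := qp_succ' hh (x := S⁻¹ * Y) (n' := 1 - I - N + e) (n := 1 - I - N + (e + 1)) (m' := J)
    (m := J - 1) (by ring) (by ring) (Or.inl (by omega))
  have f5 := qp_succ hh (x := S) (n' := 0) (n := 0) (m' := I + J) (m := I + (J - 1)) rfl (by ring)
    (Or.inr (hS _))
  have f6 := qp_succ' hh (x := Y) (n' := -I - N + 1 + L + e) (n := -I - N + 1 + L + (e + 1))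
    (m' := J) (m := J - 1) (by ring) (by ring) (Or.inr (hY _))
  have f7 := qp_shift hh (x := Y) (n := -2 * I - N + 1 + L + e)
    (n' := -2 * I - N + 1 + L + (e + 1)) (m' := I) (m := I) (by ring) rfl
    (hY _) (Or.inr (hY _))
  have hz : S * h ^ L ≠ 0 := mul_ne_zero hS0 (zpow_ne_zero _ hh)
  have f8 : (S * h ^ L) ^ J = (S * h ^ L) ^ (J - 1) * (S * h ^ L) := by
    rw [← zpow_add_one₀ hz, sub_add_cancel]
  rw [show -2 * I + 1 + L + e + I = -I + 1 + L + e by ring] at f3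
  rw [show -2 * I - N + 1 + L + e + I = -I - N + 1 + L + e by ring] at f7
  have n1 := hY (-2 * I + 1 + L + e)
  have n2 := hY (-I + 1 + L + e)
  have n3 := hY (-I - N + 1 + L + e)
  have n4 := hY (-2 * I - N + 1 + L + e)
  rw [baseTerm, f2, f4, f5, f6, f8, baseTerm, f3, f7,
    show 0 + (I + (J - 1)) = I - 1 + J by ring]
  generalize lin h Y (-2 * I + 1 + L + e) = D1 at *
  generalize lin h Y (-I + 1 + L + e) = D2 at *
  generalize lin h Y (-I - N + 1 + L + e) = D3 at *
  generalize lin h Y (-2 * I - N + 1 + L + e) = D4 at *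
  simp only [div_eq_mul_inv, mul_inv, inv_inv]
  have c : D1 * D1⁻¹ * (D2 * D2⁻¹) * (D4 * D4⁻¹) = 1 := by
    rw [mul_inv_cancel₀ n1, mul_inv_cancel₀ n2, mul_inv_cancel₀ n4, one_mul, one_mul]
  refine Eq.symm (Eq.trans ?_ ((congrArg (· * _) c).trans (one_mul _)))
  ring

theorem baseTerm_snd_fst (hh : h ≠ 0) {Y : ℂ} (hY : ∀ n, lin h Y n ≠ 0) (hS0 : S ≠ 0)
    (hS : ∀ n, lin h S n ≠ 0) (hJ : 1 ≤ J) :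
    baseTerm h Y S L N (I - 1) J (e - 1) = baseTerm h Y S L N I (J - 1) (e + 1) *
      (h ^ N * (S * h ^ L) * lin h 1 (I - 1 - L) * lin h (S⁻¹ * Y) (1 - I - N + e) /
        (lin h Y (-I + 1 + L + e) * lin h S (N + (I - 1)))) := by
  have f1 := qp_succ hh (x := S) (n' := N) (n := N) (m' := I) (m := I - 1) rfl (by ring)
    (Or.inr (hS _))
  have f2 := qp_succ' hh (x := 1) (n' := I - 1 - L) (n := I - L) (m' := J) (m := J - 1)
    (by ring) (by ring) (Or.inl (by omega))
  have f3 := qp_succ hh (x := Y) (n := -2 * (I - 1) + 1 + L + (e - 1))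
    (n' := -2 * I + 1 + L + (e + 1))
    (m' := I) (m := I - 1) (by ring) (by ring) (Or.inr (hY _))
  have f4 := qp_succ' hh (x := S⁻¹ * Y) (n' := 1 - (I - 1) - N + (e - 1))
    (n := 1 - I - N + (e + 1)) (m' := J)
    (m := J - 1) (by ring) (by ring) (Or.inl (by omega))
  have f5 := qp_congr h S (n' := 0) (n := 0) (m' := I - 1 + J) (m := I + (J - 1)) rfl (by ring)
  have f6 := qp_succ' hh (x := Y) (n' := -(I - 1) - N + 1 + L + (e - 1))
    (n := -I - N + 1 + L + (e + 1))
    (m' := J) (m := J - 1) (by ring) (by ring) (Or.inr (hY _))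
  have f7 := qp_succ hh (x := Y) (n := -2 * (I - 1) - N + 1 + L + (e - 1))
    (n' := -2 * I - N + 1 + L + (e + 1)) (m' := I) (m := I - 1) (by ring) (by ring)
    (Or.inr (hY _))
  have hz : S * h ^ L ≠ 0 := mul_ne_zero hS0 (zpow_ne_zero _ hh)
  have f8 : (S * h ^ L) ^ J = (S * h ^ L) ^ (J - 1) * (S * h ^ L) := by
    rw [← zpow_add_one₀ hz, sub_add_cancel]
  have f9 : h ^ (-(I - 1) * N) = h ^ (-I * N) * h ^ N := by
    rw [← zpow_add₀ hh]; ring_nf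
  rw [show -2 * (I - 1) + 1 + L + (e - 1) + (I - 1) = -I + 1 + L + e by ring] at f3
  rw [show -2 * (I - 1) - N + 1 + L + (e - 1) + (I - 1) = -I - N + 1 + L + e by ring] at f7
  rw [show -(I - 1) - N + 1 + L + (e - 1) = -I - N + 1 + L + e by ring] at f6
  have n1 := hS (N + (I - 1))
  have n2 := hY (-I + 1 + L + e)
  have n3 := hY (-I - N + 1 + L + e)
  rw [baseTerm, f2, f4, f5, show -(I - 1) - N + 1 + L + (e - 1) = -I - N + 1 + L + e by ring,
    f6, f8, f9, baseTerm, f1, f3, f7, show 1 - (I - 1) - N + (e - 1) = 1 - I - N + e by ring]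
  generalize lin h S (N + (I - 1)) = D1 at *
  generalize lin h Y (-I + 1 + L + e) = D2 at *
  generalize lin h Y (-I - N + 1 + L + e) = D3 at *
  simp only [div_eq_mul_inv, mul_inv]
  have c : D1 * D1⁻¹ * (D2 * D2⁻¹) = 1 := by
    rw [mul_inv_cancel₀ n1, mul_inv_cancel₀ n2, one_mul]
  refine Eq.symm (Eq.trans ?_ ((congrArg (· * _) c).trans (one_mul _)))
  ring

/-- For `J > 0` all three products are multiples of the one at `(I, J - 1)`, which leaves a rational
identity. For `J = 0` that neighbour has coefficient zero and the product at `(I - 1, 0)` serves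
instead. -/
theorem baseTerm_threeTerm (hh : h ≠ 0) (hX0 : X ≠ 0) (hY : ∀ n, lin h X⁻¹ n ≠ 0)
    (hS0 : S ≠ 0) (hS : ∀ n, lin h S n ≠ 0) (h1 : ∀ n, n ≠ 0 → lin h 1 n ≠ 0) (hI : I ≤ L)
    (hJ : 0 ≤ J) :
    baseLhs h X S (h ^ (I + J)) (h ^ L) * baseTerm h X⁻¹ S L N I J (N - 2 * J) =
      recSnd X S (h ^ I) (h ^ J) (h ^ L) (h ^ N)
        ((h ^ (I + J) / h)⁻¹ + S * X * (h ^ (I + J) / h) ^ 2 * h / h ^ L) *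
          baseTerm h X⁻¹ S L N I (J - 1) (N - 2 * J + 1) +
      recFst X S (h ^ I) (h ^ J) (h ^ L) (h ^ N)
        ((h ^ (I + J) / h)⁻¹ + S * X * (h ^ (I + J) / h) ^ 2 * h / h ^ L) *
          baseTerm h X⁻¹ S L N (I - 1) J (N - 2 * J - 1) := by
  have nx : h ^ I ≠ 0 := zpow_ne_zero _ hh
  have ny : h ^ J ≠ 0 := zpow_ne_zero _ hh
  have na : h ^ L ≠ 0 := zpow_ne_zero _ hh
  have nb : h ^ N ≠ 0 := zpow_ne_zero _ hh
  have l1 : lin h S (I - 1 + J) = (h - h ^ I * h ^ J * S) / h := by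
    rw [lin, zpow_add₀ hh, zpow_sub_one₀ hh]; field_simp
  have l2 : lin h X⁻¹ (-2 * I - N + 1 + L + (N - 2 * J)) =
      (X * (h ^ I) ^ 2 * (h ^ J) ^ 2 - h * h ^ L) / (X * (h ^ I) ^ 2 * (h ^ J) ^ 2) := by
    rw [lin, show -2 * I - N + 1 + L + (N - 2 * J) = 1 + L - (I + I + (J + J)) by ring,
      zpow_sub₀ hh, zpow_add₀ hh, zpow_add₀ hh, zpow_add₀ hh, zpow_add₀ hh, zpow_one]
    field_simp
  have l3 : lin h X⁻¹ (-I + 1 + L + (N - 2 * J)) =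
      (X * h ^ I * (h ^ J) ^ 2 - h * h ^ L * h ^ N) / (X * h ^ I * (h ^ J) ^ 2) := by
    rw [lin, show -I + 1 + L + (N - 2 * J) = 1 + L + N - (I + (J + J)) by ring,
      zpow_sub₀ hh, zpow_add₀ hh, zpow_add₀ hh, zpow_add₀ hh, zpow_add₀ hh, zpow_one]
    field_simp
  have l4 : lin h S (N + (I - 1)) = (h - h ^ N * h ^ I * S) / h := by
    rw [lin, zpow_add₀ hh, zpow_sub_one₀ hh]; field_simp
  have l5 : lin h X⁻¹ (N - 2 * J) = (X * (h ^ J) ^ 2 - h ^ N) / (X * (h ^ J) ^ 2) := by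
    rw [lin, two_mul, zpow_sub₀ hh, zpow_add₀ hh]; field_simp
  have l6 : lin h 1 (I - L + (J - 1)) = (h * h ^ L - h ^ I * h ^ J) / (h * h ^ L) := by
    rw [lin, zpow_add₀ hh, zpow_sub₀ hh, zpow_sub_one₀ hh]; field_simp
  have l7 : lin h X⁻¹ (-2 * I + 1 + L + (N - 2 * J)) =
      (X * (h ^ I) ^ 2 * (h ^ J) ^ 2 - h * h ^ L * h ^ N) / (X * (h ^ I) ^ 2 * (h ^ J) ^ 2) := by
    rw [lin, show -2 * I + 1 + L + (N - 2 * J) = 1 + L + N - (I + I + (J + J)) by ring,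
      zpow_sub₀ hh, zpow_add₀ hh, zpow_add₀ hh, zpow_add₀ hh, zpow_add₀ hh, zpow_add₀ hh, zpow_one]
    field_simp
  have l8 : lin h (S⁻¹ * X⁻¹) (1 - I - N + (N - 2 * J)) =
      (X * h ^ I * (h ^ J) ^ 2 * S - h) / (X * h ^ I * (h ^ J) ^ 2 * S) := by
    rw [lin, show 1 - I - N + (N - 2 * J) = 1 - (I + (J + J)) by ring,
      zpow_sub₀ hh, zpow_add₀ hh, zpow_add₀ hh, zpow_one]
    field_simp
  have l9 : lin h 1 (I - 1 - L) = (h * h ^ L - h ^ I) / (h * h ^ L) := by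
    rw [lin, zpow_sub₀ hh, zpow_sub_one₀ hh]; field_simp
  have l10 : lin h 1 (I - 1 - L + J) = (h * h ^ L - h ^ I * h ^ J) / (h * h ^ L) := by
    rw [← l6]; congr 1; ring
  have num : ∀ {a b c : ℂ}, c = a / b → c ≠ 0 → a ≠ 0 := fun e hc ha => hc (by rw [e, ha, zero_div])
  have n1 := num l1 (hS _)
  have n2 := num l2 (hY _)
  have n3 := num l3 (hY _)
  have n4 := num l4 (hS _)
  have n5 : h ^ N - X * (h ^ J) ^ 2 ≠ 0 := by
    rw [← neg_ne_zero, neg_sub]; exact num l5 (hY _)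
  have n9 := num l9 (h1 _ (by omega))
  rw [zpow_add₀ hh, baseLhs, recSnd, recFst]
  rcases eq_or_ne J 0 with rfl | hJ0
  · rw [baseTerm_fst hh hY hS h1 hI le_rfl, l1, l2, l4, l7, l9, l10]
    clear l1 l2 l3 l4 l5 l6 l7 l8 l9 l10 num
    simp only [zpow_zero] at *
    generalize baseTerm h X⁻¹ S L N (I - 1) 0 (N - 2 * 0 - 1) = T
    generalize baseTerm h X⁻¹ S L N I (0 - 1) (N - 2 * 0 + 1) = T'
    generalize h ^ I = x at *
    generalize h ^ L = a at *
    generalize h ^ N = b at *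
    have c1 : S - (x * 1 / h)⁻¹ = -(h - x * 1 * S) / x := by field_simp; ring
    have c2 : 1 - X * (x * 1 / h) ^ 2 * h / a = -(X * x ^ 2 * 1 ^ 2 - h * a) / (h * a) := by
      field_simp; ring
    have c3 : 1 - X * 1 ^ 2 / b = (b - X * 1 ^ 2) / b := by field_simp
    rw [c1, c2, c3]
    generalize d1 : h - x * 1 * S = D1 at *
    generalize d2 : X * x ^ 2 * 1 ^ 2 - h * a = D2 at *
    generalize d4 : h - b * x * S = D4 at *
    generalize d5 : b - X * 1 ^ 2 = D5 at *
    generalize d9 : h * a - x = D9 at *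
    field_simp
    rw [← d4, ← d5, ← d9]
    ring
  · have hJ1 : 1 ≤ J := by omega
    rw [baseTerm_snd hh hY hS0 hS hJ1, baseTerm_snd_fst hh hY hS0 hS hJ1, l1, l2, l3, l4, l6, l7,
      l8, l9]
    clear l1 l2 l3 l4 l5 l6 l7 l8 l9 l10 num
    generalize baseTerm h X⁻¹ S L N I (J - 1) (N - 2 * J + 1) = T
    generalize h ^ I = x at *
    generalize h ^ J = y at *
    generalize h ^ L = a at *
    generalize h ^ N = b at *
    have c1 : S - (x * y / h)⁻¹ = -(h - x * y * S) / (x * y) := by field_simp; ring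
    have c2 : 1 - X * (x * y / h) ^ 2 * h / a = -(X * x ^ 2 * y ^ 2 - h * a) / (h * a) := by
      field_simp; ring
    have c3 : 1 - X * y ^ 2 / b = (b - X * y ^ 2) / b := by field_simp
    rw [c1, c2, c3]
    generalize d1 : h - x * y * S = D1 at *
    generalize d2 : X * x ^ 2 * y ^ 2 - h * a = D2 at *
    generalize d3 : X * x * y ^ 2 - h * a * b = D3 at *
    generalize d4 : h - b * x * S = D4 at *
    generalize d5 : b - X * y ^ 2 = D5 at *
    field_simp
    rw [← d3, ← d4, ← d5]
    ring

end

/-! ### The entries of the stochastic matrix -/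

section

variable {η z lam : ℂ} {L N : ℕ}

theorem qPoch_add {a h : ℂ} (hh : h ≠ 0) {m : ℤ} (hm : 0 ≤ m) (n : ℕ) :
    qPoch a h (m + n) = qPoch a h m * qPoch (h ^ m * a) h n := by
  induction n with
  | zero => rw [Nat.cast_zero, add_zero, qPoch_zero, mul_one]
  | succ n ih =>
    rw [Nat.cast_succ, ← add_assoc, qPoch_add_one _ (Or.inl (by omega)), ih,
      qPoch_add_one _ (Or.inl (by omega)), zpow_add₀ hh]
    ring

/-- The two Pochhammer symbols join into one that is symmetric in `L` and `N`; so the gauge does not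
change the vacuum entry. -/
theorem gauge_zero_zero (η X : ℂ) (L N : ℕ) :
    gauge η X L N 0 0 = (qPoch (X * (qhalf η L ^ 4 * qhalf η N ^ 4)⁻¹ * qpow η 1 ^ 2)
      (qpow η 1 ^ 2) (L + N))⁻¹ := by
  have hb := qhalf_ne_zero η N
  rw [add_comm (L : ℤ), qPoch_add (pow_ne_zero 2 (qpow_ne_zero η 1)) (Int.natCast_nonneg _),
    sq_zpow_nat, gauge]
  simp only [zpow_zero, mul_one, one_pow, sub_zero, one_div]
  rw [mul_comm (qPoch _ _ _)]
  congr 3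
  field_simp

theorem sCoeff_zero_zero (h : Generic (qpow η 1)) (hz0 : z ≠ 0) (hz : ∀ k : ℤ, z ≠ qpow η 1 ^ k)
    (hX : ∀ k : ℤ, dynX lam ≠ qpow η 1 ^ (2 * k)) (I J : ℤ) :
    sCoeff η lam z L N I J 0 0 = if I = 0 ∧ J = 0 then 1 else 0 := by
  by_cases hIJ : (0 ≤ I ∧ I ≤ L) ∧ (0 ≤ J ∧ J ≤ N)
  · rw [sCoeff, rCoeff, twistedR_tket_zero h hz0 hz, coord_tket h hIJ.1 hIJ.2]
    split_ifs with h0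
    · rw [h0.1, h0.2, gauge_zero_zero, gauge_zero_zero, one_mul, mul_comm (qhalf η L ^ 4),
        add_comm (L : ℤ)]
      have := gauge_ne_zero hX N L 0 0
      rw [gauge_zero_zero] at this
      exact div_self this
    · ring
  · rw [sCoeff_eq_zero (by omega), if_neg (by omega)]

/-- The matrix entries vanish unless the number of particles is conserved. -/
theorem sCoeff_conservation (h : Generic (qpow η 1)) (hz0 : z ≠ 0)
    (hz : ∀ k : ℤ, z ≠ qpow η 1 ^ k) (i m : ℕ) :
    ∀ lam : ℂ, (∀ k : ℤ, dynX lam ≠ qpow η 1 ^ (2 * k)) → ∀ I J : ℤ, I + J ≠ i + m →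
      sCoeff η lam z L N I J i m = 0 := by
  induction m with
  | zero =>
    induction i with
    | zero =>
      intro lam hX I J hIJ
      rw [Nat.cast_zero, sCoeff_zero_zero h hz0 hz hX, if_neg]
      rintro ⟨rfl, rfl⟩
      exact hIJ (by simp)
    | succ i ih =>
      intro lam hX I J hIJ
      push_cast at hIJ ih ⊢
      by_cases hr : (0 ≤ I ∧ I ≤ L) ∧ (0 ≤ J ∧ J ≤ N)
      · have e := sCoeff_fst (I' := i + 1) (J' := 0) h hz0 hz hX hr.1 hr.2 (i := i) (add_zero _)
        rw [ih _ (dynX_ne_shift hX) _ _ (by omega), ih _ (dynX_ne_shift hX) _ _ (by omega),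
          mul_zero, mul_zero, add_zero, mul_zero] at e
        exact (mul_eq_zero.1 e).resolve_left
          (mul_ne_zero (recFactor_ne_zero h hX _ _ _ _) (baseLhs_ne_zero h hz0 hz hX (by omega)))
      · exact sCoeff_eq_zero (by omega) _ _
  | succ m ih =>
    intro lam hX I J hIJ
    push_cast at hIJ ih ⊢
    by_cases hr : (0 ≤ I ∧ I ≤ L) ∧ (0 ≤ J ∧ J ≤ N)
    · have e := sCoeff_snd (I' := i + (m + 1)) (J' := 0) h hz0 hz hX hr.1 hr.2 (i := i) (m := m)
        (add_zero _)
      rw [ih _ (dynX_ne_shift hX) _ _ (by omega), ih _ (dynX_ne_shift hX) _ _ (by omega),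
        mul_zero, mul_zero, add_zero, mul_zero] at e
      exact (mul_eq_zero.1 e).resolve_left
        (mul_ne_zero (recFactor_ne_zero h hX _ _ _ _)
          (coefLhs_ne_zero h hz0 hz hX (Complex.exp_ne_zero _) _ _ (by omega)))
    · exact sCoeff_eq_zero (by omega) _ _

theorem recFst_one (X S y a b W : ℂ) : recFst X S 1 y a b W = 0 := by simp [recFst]

theorem recSnd_one (X S x a b W : ℂ) : recSnd X S x 1 a b W = 0 := by simp [recSnd]

theorem inv_dynX_shift (η lam : ℂ) :
    (dynX (lam - 2 * η))⁻¹ = (qpow η 1 ^ 2) ^ (-1 : ℤ) * (dynX lam)⁻¹ := by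
  rw [dynX_shift, mul_inv, _root_.zpow_neg_one, mul_comm]

theorem qp_shift_arg {h : ℂ} (hh : h ≠ 0) (Y : ℂ) (n m : ℤ) :
    qp h (h ^ (-1 : ℤ) * Y) n m = qp h Y (n - 1) m := by
  rw [qp, qp, ← mul_assoc, ← zpow_add₀ hh, sub_eq_add_neg]

theorem lin_shift_arg {h : ℂ} (hh : h ≠ 0) (Y : ℂ) (n : ℤ) :
    lin h (h ^ (-1 : ℤ) * Y) n = lin h Y (n - 1) := by
  rw [lin, lin, ← mul_assoc, ← zpow_add₀ hh, ← sub_eq_add_neg n]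

/-- The purpose of the parameter `e`: it accompanies every `Y`, so the shift `λ → λ - 2η`, which
multiplies `Y = X⁻¹` by `h⁻¹`, lowers `e` by one. -/
theorem term_shift_arg {h : ℂ} (hh : h ≠ 0) (Y S : ℂ) (L N I J M e k : ℤ) :
    term h (h ^ (-1 : ℤ) * Y) S L N I J M e k = term h Y S L N I J M (e - 1) k := by
  have e1 : S⁻¹ * (h ^ (-1 : ℤ) * Y) = h ^ (-1 : ℤ) * (S⁻¹ * Y) := by ring
  have e2 : S * (h ^ (-1 : ℤ) * Y) = h ^ (-1 : ℤ) * (S * Y) := by ring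
  simp only [term, termCore, termEdge, e1, e2, qp_shift_arg hh, lin_shift_arg hh, add_sub_assoc]

theorem baseTerm_shift_arg {h : ℂ} (hh : h ≠ 0) (Y S : ℂ) (L N I J e : ℤ) :
    baseTerm h (h ^ (-1 : ℤ) * Y) S L N I J e = baseTerm h Y S L N I J (e - 1) := by
  have e1 : S⁻¹ * (h ^ (-1 : ℤ) * Y) = h ^ (-1 : ℤ) * (S⁻¹ * Y) := by ring
  simp only [baseTerm, e1, qp_shift_arg hh, add_sub_assoc]

theorem termSum_shift_arg {h : ℂ} (hh : h ≠ 0) (Y S : ℂ) (L : ℤ) (N : ℕ) (I J M e : ℤ) :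
    termSum h (h ^ (-1 : ℤ) * Y) S L N I J M e = termSum h Y S L N I J M (e - 1) :=
  Finset.sum_congr rfl fun _ _ => term_shift_arg hh _ _ _ _ _ _ _ _ _

theorem baseTerm_zero (h Y S : ℂ) (L N e : ℤ) : baseTerm h Y S L N 0 0 e = 1 := by
  simp [baseTerm, qp_zero]

/-- Both sides satisfy the same recursion with a nonzero leading coefficient. The claim is proved
for all `λ` at once because the recursion refers to `λ - 2η`. -/
theorem sCoeff_base (h : Generic (qpow η 1)) (hz0 : z ≠ 0)
    (hz : ∀ k : ℤ, z ≠ qpow η 1 ^ k) (i : ℕ) (hi : i ≤ L) :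
    ∀ lam : ℂ, (∀ k : ℤ, dynX lam ≠ qpow η 1 ^ (2 * k)) → ∀ I J : ℤ, 0 ≤ I → 0 ≤ J → J ≤ N →
      I + J = i → sCoeff η lam z L N I J i 0 =
        baseTerm (qpow η 1 ^ 2) (dynX lam)⁻¹ (specS η z L N) L N I J (N - 2 * J) := by
  have hh : qpow η 1 ^ 2 ≠ 0 := pow_ne_zero 2 (qpow_ne_zero η 1)
  induction i with
  | zero =>
    intro lam hX I J hI hJ hJN hIJ
    obtain ⟨rfl, rfl⟩ : I = 0 ∧ J = 0 := by push_cast at hIJ; omega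
    rw [Nat.cast_zero, sCoeff_zero_zero h hz0 hz hX, if_pos ⟨rfl, rfl⟩, baseTerm_zero]
  | succ i ih =>
    intro lam hX I J hI hJ hJN hIJ
    push_cast at hIJ ⊢
    have hX0 : dynX lam ≠ 0 := Complex.exp_ne_zero _
    have e := sCoeff_fst h hz0 hz hX ⟨hI, (by omega : I ≤ L)⟩ ⟨hJ, hJN⟩ hIJ
    have e' := baseTerm_threeTerm (N := N) hh hX0 (lin_dynX_ne hX hX0) (specS_ne_zero hz0 L N)
      (lin_specS_ne hz0 hz L N) (fun n hn => lin_one_ne h hn) (by omega : I ≤ L) hJ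
    rw [fstShift_div, ← hIJ, mul_assoc] at e
    have e := mul_left_cancel₀ (recFactor_ne_zero h hX _ _ _ _) e
    rw [← hIJ]
    refine mul_left_cancel₀ (b := _) ?_ (e.trans (Eq.trans ?_ e'.symm))
    · rw [hIJ]; exact baseLhs_ne_zero h hz0 hz hX (Int.natCast_nonneg i)
    · congr 1
      -- A neighbour outside the range has coefficient zero, so the induction hypothesis is needed
      -- only inside.
      · rcases eq_or_ne J 0 with rfl | hJ0
        · rw [zpow_zero, recSnd_one, zero_mul, zero_mul]
        · rw [ih (by omega) _ (dynX_ne_shift hX) _ _ hI (by omega) (by omega) (by omega),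
            inv_dynX_shift, baseTerm_shift_arg hh, show (N : ℤ) - 2 * (J - 1) - 1 = N - 2 * J + 1 by ring]
      · rcases eq_or_ne I 0 with rfl | hI0
        · rw [zpow_zero, recFst_one, zero_mul, zero_mul]
        · rw [ih (by omega) _ (dynX_ne_shift hX) _ _ (by omega) hJ hJN (by omega),
            inv_dynX_shift, baseTerm_shift_arg hh]

theorem termSum_zero {h Y : ℂ} (hh : h ≠ 0) (hY : ∀ n, lin h Y n ≠ 0) (S : ℂ) (L : ℤ) (N : ℕ)
    (I J e : ℤ) : termSum h Y S L N I J 0 e = baseTerm h Y S L N I J e := by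
  rw [termSum, Finset.sum_range_succ', Finset.sum_eq_zero, zero_add, Nat.cast_zero,
    term_zero_zero hh hY]
  intro k _
  exact term_eq_zero hh Y le_rfl (by push_cast; omega)

theorem sCoeff_eq (h : Generic (qpow η 1)) (hz0 : z ≠ 0)
    (hz : ∀ k : ℤ, z ≠ qpow η 1 ^ k) (m : ℕ) (hm : m ≤ N) {i : ℕ} (hi : i ≤ L) :
    ∀ lam : ℂ, (∀ k : ℤ, dynX lam ≠ qpow η 1 ^ (2 * k)) → ∀ I J : ℤ, 0 ≤ I → I ≤ L → 0 ≤ J →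
      J ≤ N → I + J = i + m → sCoeff η lam z L N I J i m =
        termSum (qpow η 1 ^ 2) (dynX lam)⁻¹ (specS η z L N) L N I J m (N - 2 * J) := by
  have hh : qpow η 1 ^ 2 ≠ 0 := pow_ne_zero 2 (qpow_ne_zero η 1)
  induction m with
  | zero =>
    intro lam hX I J hI hIL hJ hJN hIJ
    rw [Nat.cast_zero, termSum_zero hh (lin_dynX_ne hX (Complex.exp_ne_zero _))]
    exact sCoeff_base h hz0 hz i hi lam hX I J hI hJ hJN (by omega)
  | succ m ih =>
    intro lam hX I J hI hIL hJ hJN hIJ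
    push_cast at hIJ ⊢
    have hX0 : dynX lam ≠ 0 := Complex.exp_ne_zero _
    have e := sCoeff_snd h hz0 hz hX ⟨hI, hIL⟩ ⟨hJ, hJN⟩ hIJ
    have e' := termSum_threeTerm (N := N) (L := L) (I := I) (m := m) hh hX0 (lin_dynX_ne hX hX0)
      (specS_ne_zero hz0 L N)
      (lin_specS_ne hz0 hz L N) (fun n hn => lin_one_ne h hn) (by omega) (by omega) hJ
    rw [sndShift_div, mul_assoc] at e
    have e := mul_left_cancel₀ (recFactor_ne_zero h hX _ _ _ _) e
    refine mul_left_cancel₀ (coefLhs_ne_zero (L := L) (N := N) h hz0 hz hX hX0 I J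
      (Int.natCast_nonneg m)) (e.trans (Eq.trans ?_ e'.symm))
    rw [add_comm]
    congr 1
    · rcases eq_or_ne I 0 with rfl | hI0
      · rw [zpow_zero, coefFst, recFst_one, zero_mul, zero_mul]
      · rw [ih (by omega) _ (dynX_ne_shift hX) _ _ (by omega) (by omega) hJ hJN (by omega),
          inv_dynX_shift, termSum_shift_arg hh, coefFst]
    · rcases eq_or_ne J 0 with rfl | hJ0
      · rw [zpow_zero, coefSnd, recSnd_one, zero_mul, zero_mul]
      · rw [ih (by omega) _ (dynX_ne_shift hX) _ _ hI hIL (by omega) (by omega) (by omega),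
          inv_dynX_shift, termSum_shift_arg hh,
          show (N : ℤ) - 2 * (J - 1) - 1 = N - 2 * J + 1 by ring, coefSnd]

end

/-! ### Comparison with the fused weights -/

section

variable {h x : ℂ}

theorem qp_add (hh : h ≠ 0) {n n' m m' k : ℤ} (hk : 0 ≤ k) (hn : n' = n + m) (hm : m' = m + k)
    (H : 0 ≤ m ∨ ∀ n, lin h x n ≠ 0) : qp h x n m' = qp h x n m * qp h x n' k := by
  subst hn hm
  obtain ⟨k, rfl⟩ := Int.eq_ofNat_of_zero_le hk
  induction k with
  | zero => simp [qp_zero]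
  | succ k ih =>
    rw [Nat.cast_succ,
      qp_succ hh (n' := n) (n := n) (m' := m + (k + 1)) (m := m + k) rfl (by ring)
        (H.imp (fun h0 => by omega) fun h0 => h0 _),
      qp_succ hh (n' := n + m) (n := n + m) (m' := (k : ℤ) + 1) (m := k) rfl rfl
        (Or.inl (Int.natCast_nonneg k)), ih (Int.natCast_nonneg k), add_assoc n]
    ring

theorem qp_one_ne_zero (hh : h ≠ 0) (h1 : ∀ n, n ≠ 0 → lin h 1 n ≠ 0) {n k : ℤ} (hk : 0 ≤ k)
    (hn : n + k ≤ 0) : qp h 1 n k ≠ 0 := by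
  obtain ⟨k, rfl⟩ := Int.eq_ofNat_of_zero_le hk
  rw [qp, qPoch_nat]
  refine Finset.prod_ne_zero_iff.2 fun j hj => ?_
  have := h1 (j + n) (by have := Finset.mem_range.1 hj; omega)
  rwa [lin, zpow_add₀ hh, zpow_natCast, mul_assoc] at this

/-- The summand of the fused weight, before cancellation of the regular factors. -/
theorem term_eq {Y S : ℂ} (hh : h ≠ 0) (hY : ∀ n, lin h Y n ≠ 0) (hS : ∀ n, lin h S n ≠ 0)
    (h1 : ∀ n, n ≠ 0 → lin h 1 n ≠ 0) {L N I J M e k : ℤ} (hk : 0 ≤ k) (hkM : k ≤ M) (hkJ : k ≤ J)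
    (hI : I ≤ L) :
    term h Y S L N I J M e k = termMonomial h S L N I J M * (qp h S N (I - M) *
      qp h 1 (I - M - L) J / (qp h S 0 (I + J) * qp h 1 1 M)) *
      (qp h Y (1 + e) J * qp h Y (M - 2 * I + 1 + L + e) (I - M) /
        (qp h Y (1 - M + e) J * qp h Y (M - I - N + 1 + L + e) J *
          qp h Y (M - 2 * I - N + L + e) M * qp h Y (2 * M - 2 * I - N + 1 + L + e) (I - M))) *
      (h ^ k * qp h Y (-M + e) k / qp h 1 1 k * (lin h Y (2 * k - M + e) / lin h Y (-M + e)) *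
        (qp h 1 (-J) k / qp h Y (1 - M + J + e) k * (qp h 1 (-M) k / qp h Y (1 + e) k *
          (qp h Y (1 - I + L + e) k / qp h 1 (I - M - L) k))) *
        (qp h Y (J - N + e) k * (qp h S⁻¹ (I - M + 1 - L) k * (qp h S (I - M + N) k *
          qp h Y (-I + e) k))) *
        (qp h 1 (I - M + 1 + k) (M - k) * qp h 1 (N - J - M + 1 + k) (M - k) *
          qp h (S * Y) (L + k - I + e) (M - k) * qp h (S⁻¹ * Y) (1 - I - N + k + e) (J - k))) := by
  have f1 := qp_add hh (x := S) (n := N) (n' := I - M + N) (m := I - M) (m' := I - M + k) hk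
    (by ring) rfl (Or.inr hS)
  have f2 := qp_add hh (x := 1) (n := I - M - L) (n' := I - M + k - L) (m := k) (m' := J)
    (k := J - k) (by omega) (by ring) (by ring) (Or.inl hk)
  have f3 := qp_add hh (x := Y) (n := M - 2 * I + 1 + L + e) (n' := 1 - I + L + e) (m := I - M)
    (m' := I - M + k) hk (by ring) rfl (Or.inr hY)
  have f4 := qp_add hh (x := Y) (n := 1 + e) (n' := k + 1 + e) (m := k) (m' := J)
    (k := J - k) (by omega) (by ring) (by ring) (Or.inl hk)
  -- `f5` and `f6` split one symbol of length `J + 1 + k` in two ways. With `f7` they trade the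
  -- symbol under the very-well-poised factor of `termCore` for `(a₁)_k`, `1 - a₁`, a denominator of
  -- the series and a prefactor.
  have f5 := qp_add hh (x := Y) (n := -M + e) (n' := k - M + e) (m := k) (m' := J + 1 + k)
    (k := J + 1) (by omega) (by ring) (by ring) (Or.inl hk)
  have f6 := qp_add hh (x := Y) (n := -M + e) (n' := 1 - M + J + e) (m := J + 1) (m' := J + 1 + k)
    hk (by ring) rfl (Or.inl (by omega))
  have f7 := qp_succ' hh (x := Y) (n' := -M + e) (n := 1 - M + e) (m := J) (m' := J + 1)
    (by ring) rfl (Or.inl (by omega))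
  -- All exponents here are negative, thanks to `I ≤ L` and `k ≤ M`.
  have n1 := qp_one_ne_zero hh h1 (n := I - M - L) hk (by omega)
  have n2 := qp_ne_zero hh hY (1 + e) k
  have n3 := hY (-M + e)
  have n4 := qp_ne_zero hh hY (1 - M + e) J
  have n5 := qp_ne_zero hh hY (1 - M + J + e) k
  have n6 := qp_ne_zero hh hY (-M + e) k
  have n7 := qp_ne_zero hh hY (k - M + e) (J + 1)
  rw [f6, f7] at f5
  have g5 : (qp h Y (k - M + e) (J + 1))⁻¹ = qp h Y (-M + e) k * ((lin h Y (-M + e))⁻¹ *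
      (qp h Y (1 - M + e) J)⁻¹ * (qp h Y (1 - M + J + e) k)⁻¹) := by
    rw [← mul_inv, ← mul_inv, f5, mul_inv, ← mul_assoc, mul_inv_cancel₀ n6, one_mul]
  rw [term, termCore, termEdge, f1, f3, div_eq_mul_inv (lin h Y (2 * k - M + e)), g5,
    f2, f4]
  have c : qp h 1 (I - M - L) k / qp h 1 (I - M - L) k * (qp h Y (1 + e) k / qp h Y (1 + e) k) = 1 := by
    rw [div_self n1, div_self n2, one_mul]
  refine Eq.symm (Eq.trans ?_ ((congrArg (· * _) c).trans (one_mul _)))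
  ring

end

/-! ### The arguments of the explicit formula, with `s = r⁻¹`, `u = S r`, `κ⁻¹ = q^e Y` and `q^L =
r²`. -/

section Arguments

variable {q Y S r : ℂ} {L e : ℤ}

theorem arg_self (q : ℂ) (n : ℤ) : qPoch q q n = qp q 1 1 n := by rw [qp, zpow_one, mul_one]

theorem arg_zpow (q : ℂ) (a n : ℤ) : qPoch (q ^ a) q n = qp q 1 a n := by rw [qp, mul_one]

theorem arg_mul (hq : q ≠ 0) (a n : ℤ) : qPoch (q ^ a * (q ^ e * Y)) q n = qp q Y (a + e) n := by
  rw [qp, zpow_add₀ hq, mul_assoc]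

theorem arg_self_mul (hq : q ≠ 0) (n : ℤ) :
    qPoch (q * (q ^ e * Y)) q n = qp q Y (1 + e) n := by
  rw [qp, zpow_add₀ hq, zpow_one, mul_assoc]

theorem arg_spin (hr : r ≠ 0) (a n : ℤ) : qPoch (r⁻¹ * (S * r) * q ^ a) q n = qp q S a n := by
  rw [qp]; congr 1; field_simp

theorem arg_spin_zero (hr : r ≠ 0) (n : ℤ) : qPoch (r⁻¹ * (S * r)) q n = qp q S 0 n := by
  rw [qp, zpow_zero]; congr 1; field_simp

theorem arg_spin' (hr : r ≠ 0) (a n : ℤ) : qPoch (S * r * r⁻¹ * q ^ a) q n = qp q S a n := by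
  rw [qp]; congr 1; field_simp

theorem arg_sq (hq : q ≠ 0) (hr : r ≠ 0) (hL : q ^ L = r * r) (a n : ℤ) :
    qPoch (r⁻¹ ^ 2 * q ^ a) q n = qp q 1 (a - L) n := by
  rw [qp, zpow_sub₀ hq, hL]; congr 1; field_simp

theorem arg_inv_sq (hq : q ≠ 0) (hL : q ^ L = r * r) (a n : ℤ) :
    qPoch (q ^ a * (r⁻¹ ^ 2)⁻¹ * (q ^ e * Y)) q n = qp q Y (a + L + e) n := by
  rw [qp, zpow_add₀ hq, zpow_add₀ hq, hL, inv_pow, inv_inv]; congr 1; ring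

theorem arg_inv_spin (hq : q ≠ 0) (hr : r ≠ 0) (hL : q ^ L = r * r) (a n : ℤ) :
    qPoch (r⁻¹ * (S * r)⁻¹ * q ^ a) q n = qp q S⁻¹ (a - L) n := by
  rw [qp, zpow_sub₀ hq, hL]; congr 1; field_simp

theorem arg_spin_mul (hq : q ≠ 0) (hL : q ^ L = r * r) (a n : ℤ) :
    qPoch (S * r * r⁻¹⁻¹ * (q ^ e * Y) * q ^ a) q n = qp q (S * Y) (a + L + e) n := by
  rw [qp, zpow_add₀ hq, zpow_add₀ hq, hL, inv_inv]; congr 1; ring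

theorem arg_inv_spin_mul (hq : q ≠ 0) (hr : r ≠ 0) (a n : ℤ) :
    qPoch (q ^ a * (S * r)⁻¹ * r⁻¹⁻¹ * (q ^ e * Y)) q n = qp q (S⁻¹ * Y) (a + e) n := by
  rw [qp, zpow_add₀ hq, inv_inv]; congr 1; field_simp

theorem arg_div (hq : q ≠ 0) (a b n : ℤ) :
    qPoch (q * (q ^ b * (q ^ e * Y)) / q ^ a) q n = qp q Y (1 + b - a + e) n := by
  rw [qp, zpow_add₀ hq, zpow_sub₀ hq, zpow_add₀ hq, zpow_one]; congr 1; ring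

theorem arg_div_kappa (hq : q ≠ 0) (hY : Y ≠ 0) (a b n : ℤ) :
    qPoch (q * (q ^ b * (q ^ e * Y)) / (q ^ a * (q ^ e * Y))) q n = qp q 1 (1 + b - a) n := by
  have n1 : q ^ e ≠ 0 := zpow_ne_zero _ hq
  have n2 : q ^ a ≠ 0 := zpow_ne_zero _ hq
  rw [qp, zpow_sub₀ hq, zpow_add₀ hq, zpow_one]; congr 1; field_simp

theorem arg_div_inv_sq (hq : q ≠ 0) (hr : r ≠ 0) (hL : q ^ L = r * r) (hY : Y ≠ 0) (a b n : ℤ) :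
    qPoch (q * (q ^ b * (q ^ e * Y)) / (q ^ a * (r⁻¹ ^ 2)⁻¹ * (q ^ e * Y))) q n =
      qp q 1 (1 + b - a - L) n := by
  have n1 : q ^ e ≠ 0 := zpow_ne_zero _ hq
  have n2 : q ^ a ≠ 0 := zpow_ne_zero _ hq
  rw [qp, zpow_sub₀ hq, zpow_sub₀ hq, zpow_add₀ hq, zpow_one, hL]; congr 1; field_simp

theorem arg_div_inv_spin (hq : q ≠ 0) (hr : r ≠ 0) (hL : q ^ L = r * r) (a b n : ℤ) :
    qPoch (q * (q ^ b * (q ^ e * Y)) / (r⁻¹ * (S * r)⁻¹ * q ^ a)) q n =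
      qp q (S * Y) (1 + b - a + L + e) n := by
  have n2 : q ^ a ≠ 0 := zpow_ne_zero _ hq
  rw [qp, zpow_add₀ hq, zpow_add₀ hq, zpow_sub₀ hq, zpow_add₀ hq, zpow_one, hL]; congr 1; field_simp

theorem arg_div_spin (hq : q ≠ 0) (hr : r ≠ 0) (a b n : ℤ) :
    qPoch (q * (q ^ b * (q ^ e * Y)) / (S * r * r⁻¹ * q ^ a)) q n =
      qp q (S⁻¹ * Y) (1 + b - a + e) n := by
  rw [qp, zpow_add₀ hq, zpow_sub₀ hq, zpow_add₀ hq, zpow_one, mul_assoc S, mul_inv_cancel₀ hr]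
  congr 1; ring

theorem arg_lin (hq : q ≠ 0) (a : ℤ) : 1 - q ^ a * (q ^ e * Y) = lin q Y (a + e) := by
  rw [lin, zpow_add₀ hq, mul_assoc]

theorem arg_lin_mul (hq : q ≠ 0) (a : ℤ) (k : ℕ) :
    1 - q ^ a * (q ^ e * Y) * q ^ (2 * k) = lin q Y (2 * k + a + e) := by
  rw [lin, zpow_add₀ hq, zpow_add₀ hq,
    show (2 : ℤ) * k = (2 * k : ℕ) by push_cast; rfl, zpow_natCast]
  ring

theorem arg_ratio (hr : r ≠ 0) (hL : q ^ L = r * r) : S * r / r⁻¹ = S * q ^ L := by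
  rw [hL]; field_simp

end Arguments

section

variable {η z lam : ℂ}

theorem exp_base (η : ℂ) :
    Complex.exp (-(4 * Real.pi * Complex.I * -η)) = qpow η 1 ^ 2 := by
  rw [qpow, ← Complex.exp_nat_mul]
  congr 1
  push_cast
  ring

theorem exp_spin (η : ℂ) (L : ℕ) :
    Complex.exp (2 * Real.pi * Complex.I * -η * L) = (qhalf η L ^ 2)⁻¹ := by
  rw [qhalf_sq, ← qpow_int, ← qpow_neg, qpow]
  congr 1
  push_cast
  ring

theorem kappa_inv (h lam : ℂ) (N j : ℕ) :
    (kappa h lam N j)⁻¹ = h ^ ((N : ℤ) - 2 * j) * (dynX lam)⁻¹ := by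
  rw [kappa, inv_inv, dynX, ← Complex.exp_neg, neg_neg]

/-- The summands agree by `term_eq` after translation of the arguments, and those with `k > min j₁
j₂` vanish. -/
theorem psi_eq (h : Generic (qpow η 1)) (hz0 : z ≠ 0)
    (hz : ∀ k : ℤ, z ≠ qpow η 1 ^ k) (hX : ∀ k : ℤ, dynX lam ≠ qpow η 1 ^ (2 * k))
    {L N i₁ j₁ i₂ j₂ : ℕ} (hi : i₁ ≤ L) (hj : j₂ ≤ N) (hc : i₁ + j₁ = i₂ + j₂) :
    psi (-η) L N (1 / (z * qpow η N)) lam i₁ j₁ i₂ j₂ =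
      termSum (qpow η 1 ^ 2) (dynX lam)⁻¹ (specS η z L N) L N i₁ j₁ j₂ (N - 2 * j₁) := by
  have h0 := qpow_ne_zero η 1
  have hh : qpow η 1 ^ 2 ≠ 0 := pow_ne_zero 2 h0
  have ha := qhalf_ne_zero η L
  have hY := lin_dynX_ne hX (Complex.exp_ne_zero _)
  have hY0 : (dynX lam)⁻¹ ≠ 0 := inv_ne_zero (Complex.exp_ne_zero _)
  have hS := lin_specS_ne hz0 hz L N
  have h1 : ∀ n, n ≠ 0 → lin (qpow η 1 ^ 2) 1 n ≠ 0 := fun n hn => lin_one_ne h hn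
  have hS0 : specS η z L N ≠ 0 := specS_ne_zero hz0 L N
  have eu : 1 / (z * qpow η N) = specS η z L N * qhalf η L ^ 2 := by
    rw [specS, qhalf_sq η N, ← qpow_int, Int.cast_natCast]
    have := qpow_ne_zero η N
    field_simp
  have e2 : qhalf η L ^ 2 * (qhalf η L ^ 2) = (qpow η 1 ^ 2) ^ (L : ℤ) := by
    rw [sq_zpow_nat]; ring
  simp only [psi]
  rw [if_pos hc, exp_base, exp_spin, kappa_inv, eu]
  generalize qpow η 1 ^ 2 = q at *
  generalize (dynX lam)⁻¹ = Y at *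
  generalize specS η z L N = S at *
  generalize hr : qhalf η L ^ 2 = r at *
  have hr0 : r ≠ 0 := by rw [← hr]; exact pow_ne_zero 2 ha
  have hrL : q ^ (L : ℤ) = r * r := e2.symm
  generalize he : (N : ℤ) - 2 * j₁ = e
  rw [Finset.mul_sum, termSum]
  have hsub : Finset.range (min j₁ j₂ + 1) ⊆ Finset.range (N + 1) :=
    Finset.range_mono (by omega)
  rw [← Finset.sum_subset hsub]
  · refine Finset.sum_congr rfl fun k hk => ?_
    have hk := Finset.mem_range.1 hk
    rw [term_eq hh hY hS h1 (Int.natCast_nonneg k) (by omega) (by omega) (by omega)]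
    simp only [List.map_cons, List.map_nil, List.prod_cons, List.prod_nil, mul_one]
    simp only [arg_self, arg_zpow, arg_mul hh, arg_self_mul hh, arg_spin hr0, arg_spin_zero hr0,
      arg_spin' hr0, arg_sq hh hr0 hrL, arg_inv_sq hh hrL, arg_inv_spin hh hr0 hrL,
      arg_spin_mul hh hrL, arg_inv_spin_mul hh hr0, arg_div hh, arg_div_inv_sq hh hr0 hrL hY0,
      arg_lin hh, arg_lin_mul hh, arg_ratio hr0 hrL, termMonomial]
    simp only [zpow_natCast]
    ring_nf
  · intro k _ hk
    rw [Finset.mem_range, not_lt] at hk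
    rcases (by omega : j₁ < k ∨ j₂ < k) with h2 | h2
    · exact term_eq_zero' hh Y (Int.natCast_nonneg _) (by exact_mod_cast h2)
    · exact term_eq_zero hh Y (Int.natCast_nonneg _) (by exact_mod_cast h2)

end

/-! ### The literal formula -/

section

variable {h x : ℂ}

theorem qp_mul_qp_neg (hh : h ≠ 0) {n m : ℤ} (hm : 0 ≤ m) (H : qp h x n m ≠ 0) :
    qp h x n m * qp h x (n + m) (-m) = 1 := by
  obtain ⟨m, rfl⟩ := Int.eq_ofNat_of_zero_le hm
  induction m generalizing n with
  | zero => simp [qp_zero]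
  | succ m ih =>
    have e1 := qp_succ' hh (x := x) (n' := n) (n := n + 1) (m' := (m : ℤ) + 1) (m := m) rfl rfl
      (Or.inl (Int.natCast_nonneg m))
    rw [Nat.cast_succ] at H ⊢
    rw [e1] at H ⊢
    have e2 := qp_succ hh (x := x) (n' := n + (m + 1)) (n := n + (m + 1)) (m' := -(m : ℤ))
      (m := -(m + 1 : ℤ)) rfl (by ring) (Or.inr (by
        rw [add_neg_cancel_right]; exact left_ne_zero_of_mul H))
    rw [add_neg_cancel_right] at e2
    have e3 := ih (Int.natCast_nonneg m) (right_ne_zero_of_mul H)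
    rw [add_right_comm, add_assoc, e2] at e3
    rw [← e3]
    ring

/-- Reversal of a terminating Pochhammer symbol. -/
theorem qp_one_reflect (hh : h ≠ 0) (a : ℤ) (M : ℕ) :
    qp h 1 a M = (-1) ^ M * h ^ ((M : ℤ) * a + M * (M - 1) / 2) * qp h 1 (1 - a - M) M := by
  induction M with
  | zero => simp [qp_zero]
  | succ M ih =>
    have e1 := qp_succ hh (x := 1) (n' := a) (n := a) (m' := (M : ℤ) + 1) (m := M) rfl rfl
      (Or.inl (Int.natCast_nonneg M))
    have e2 := qp_succ' hh (x := 1) (n' := 1 - a - (M + 1)) (n := 1 - a - M) (m' := (M : ℤ) + 1)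
      (m := M) (by ring) rfl (Or.inl (Int.natCast_nonneg M))
    have e3 : lin h 1 (a + M) = -h ^ (a + M) * lin h 1 (1 - a - (M + 1)) := by
      rw [lin, lin, show 1 - a - (M + 1 : ℤ) = -(a + M) by ring, _root_.zpow_neg]
      have := zpow_ne_zero (a + M) hh
      field_simp
      ring
    have e4 : ((M : ℤ) + 1) * a + (M + 1) * (M + 1 - 1) / 2 =
        (M * a + M * (M - 1) / 2) + (a + M) := by
      rw [show ((M : ℤ) + 1) * (M + 1 - 1) = M * (M - 1) + M * 2 by ring,
        Int.add_mul_ediv_right _ _ (by norm_num)]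
      ring
    rw [Nat.cast_succ, e1, e2, ih, e3, e4, zpow_add₀ hh _ (a + M), pow_succ]
    ring

/-- The quotient is `(h^{J-N})_M`, which is then reversed. For `M > J` the denominator has negative
length, that is, it is the reciprocal of the missing initial factors. -/
theorem qp_one_div (hh : h ≠ 0) (h1 : ∀ n, n ≠ 0 → lin h 1 n ≠ 0) {N J : ℤ} {M : ℕ} (hJ : 0 ≤ J)
    (hJN : J ≤ N) (hMN : (M : ℤ) ≤ N) : qp h 1 (M - N) J / qp h 1 (M - N) (J - M) =
      (-1) ^ M * h ^ ((M : ℤ) * (J - N) + M * (M - 1) / 2) * qp h 1 (N - J - M + 1) M := by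
  have key : qp h 1 (M - N) J / qp h 1 (M - N) (J - M) = qp h 1 (J - N) M := by
    rcases le_total (M : ℤ) J with hMJ | hMJ
    · rw [div_eq_iff (qp_one_ne_zero hh h1 (by omega) (by omega)), mul_comm]
      exact qp_add hh (Int.natCast_nonneg M) (by ring) (by ring) (Or.inl (by omega))
    · have n1 : qp h 1 (J - N) (M - J) ≠ 0 :=
        qp_one_ne_zero hh h1 (by omega) (by omega)
      have e1 := qp_mul_qp_neg hh (by omega) n1
      rw [show J - N + (M - J) = M - N by ring, neg_sub] at e1
      rw [qp_add hh (n := J - N) (n' := M - N) (m := M - J) (m' := M) hJ (by ring) (by ring)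
        (Or.inl (by omega)), div_eq_iff (right_ne_zero_of_mul (e1.symm ▸ one_ne_zero))]
      linear_combination (-qp h 1 (M - N) J) * e1
  rw [key, qp_one_reflect hh, show 1 - (J - N) - (M : ℤ) = N - J - M + 1 by ring]

/-- Splitting off the vanishing factors of a summand. -/
theorem termEdge_mul {Y S : ℂ} (hh : h ≠ 0) (h1 : ∀ n, n ≠ 0 → lin h 1 n ≠ 0)
    (hSY : ∀ n, lin h (S * Y) n ≠ 0) (hY : ∀ n, lin h (S⁻¹ * Y) n ≠ 0) {L N I J M k e : ℤ}
    (hk : 0 ≤ k) (hkM : k ≤ M) (hkJ : k ≤ J) (hMI : M ≤ I) (hJM : J + M ≤ N) :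
    qp h 1 (I - M + 1 + k) (M - k) * qp h 1 (N - J - M + 1 + k) (M - k) *
      qp h (S * Y) (L + k - I + e) (M - k) * qp h (S⁻¹ * Y) (1 - I - N + k + e) (J - k) =
    qp h 1 (I - M + 1) M * qp h 1 (N - J - M + 1) M * qp h (S * Y) (L - I + e) M *
      qp h (S⁻¹ * Y) (1 - I - N + e) J / (qp h 1 (N - J - M + 1) k * (qp h (S * Y) (L - I + e) k *
        (qp h (S⁻¹ * Y) (1 - I - N + e) k * qp h 1 (I - M + 1) k))) := by
  have pos : ∀ n : ℤ, 0 < n → qp h 1 n k ≠ 0 := fun n hn => by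
    obtain ⟨k, rfl⟩ := Int.eq_ofNat_of_zero_le hk
    rw [qp, qPoch_nat]
    refine Finset.prod_ne_zero_iff.2 fun j hj => ?_
    have := h1 (j + n) (by omega)
    rwa [lin, zpow_add₀ hh, zpow_natCast, mul_assoc] at this
  rw [eq_div_iff (mul_ne_zero (pos _ (by omega)) (mul_ne_zero (qp_ne_zero hh hSY _ _)
    (mul_ne_zero (qp_ne_zero hh hY _ _) (pos _ (by omega))))),
    qp_add hh (x := 1) (n := I - M + 1) (n' := I - M + 1 + k) (m := k) (m' := M) (k := M - k)
      (by omega) rfl (by ring) (Or.inl hk),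
    qp_add hh (x := 1) (n := N - J - M + 1) (n' := N - J - M + 1 + k) (m := k) (m' := M)
      (k := M - k) (by omega) rfl (by ring) (Or.inl hk),
    qp_add hh (x := S * Y) (n := L - I + e) (n' := L + k - I + e) (m := k) (m' := M) (k := M - k)
      (by omega) (by ring) (by ring) (Or.inl hk),
    qp_add hh (x := S⁻¹ * Y) (n := 1 - I - N + e) (n' := 1 - I - N + k + e) (m := k) (m' := J)
      (k := J - k) (by omega) (by ring) (by ring) (Or.inl hk)]
  ring

end

/-! ### The literal formula under the additional assumptions. -/

section

variable {η z lam : ℂ}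

theorem psiLiteral_eq (h : Generic (qpow η 1)) (hz0 : z ≠ 0)
    (hz : ∀ k : ℤ, z ≠ qpow η 1 ^ k) (hX : ∀ k : ℤ, dynX lam ≠ qpow η 1 ^ (2 * k))
    (hzX : ∀ k : ℤ, z * dynX lam ≠ qpow η 1 ^ k) (hzX' : ∀ k : ℤ, z ≠ dynX lam * qpow η 1 ^ k)
    {L N i₁ j₁ i₂ j₂ : ℕ} (hi : i₁ ≤ L) (hji : j₂ ≤ i₁) (hjN : j₁ + j₂ ≤ N)
    (hc : i₁ + j₁ = i₂ + j₂) :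
    psiLiteral (-η) L N (1 / (z * qpow η N)) lam i₁ j₁ i₂ j₂ =
      termSum (qpow η 1 ^ 2) (dynX lam)⁻¹ (specS η z L N) L N i₁ j₁ j₂ (N - 2 * j₁) := by
  have h0 := qpow_ne_zero η 1
  have hh : qpow η 1 ^ 2 ≠ 0 := pow_ne_zero 2 h0
  have ha := qhalf_ne_zero η L
  have hX0 : dynX lam ≠ 0 := Complex.exp_ne_zero _
  have hY := lin_dynX_ne hX hX0
  have hY0 : (dynX lam)⁻¹ ≠ 0 := inv_ne_zero hX0
  have hS := lin_specS_ne hz0 hz L N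
  have h1 : ∀ n, n ≠ 0 → lin (qpow η 1 ^ 2) 1 n ≠ 0 := fun n hn => lin_one_ne h hn
  have hS0 : specS η z L N ≠ 0 := specS_ne_zero hz0 L N
  -- A zero among the factors `1 - h^n S / X` would give `zX ∈ q^ℤ`, and one among `1 - h^n / (S X)`
  -- would give `z / X ∈ q^ℤ`. These are the denominators that `psi` had cancelled.
  have hSY : ∀ n, lin (qpow η 1 ^ 2) (specS η z L N * (dynX lam)⁻¹) n ≠ 0 := fun n e => by
    refine hzX (2 * n - L - N) ?_
    have e1 : qpow η 1 ^ (L : ℤ) ≠ 0 := zpow_ne_zero _ h0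
    have e2 : qpow η 1 ^ (N : ℤ) ≠ 0 := zpow_ne_zero _ h0
    rw [lin, sub_eq_zero, specS, qhalf_sq, qhalf_sq, sq_zpow] at e
    rw [zpow_sub₀ h0, zpow_sub₀ h0, two_mul, zpow_add₀ h0]
    field_simp at e ⊢
    linear_combination e
  have hSY' : ∀ n, lin (qpow η 1 ^ 2) ((specS η z L N)⁻¹ * (dynX lam)⁻¹) n ≠ 0 := fun n e => by
    refine hzX' (-(2 * n + L + N)) ?_
    have e1 : qpow η 1 ^ (L : ℤ) ≠ 0 := zpow_ne_zero _ h0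
    have e2 : qpow η 1 ^ (N : ℤ) ≠ 0 := zpow_ne_zero _ h0
    have e3 : qpow η 1 ^ n ≠ 0 := zpow_ne_zero _ h0
    rw [lin, sub_eq_zero, specS, qhalf_sq, qhalf_sq, sq_zpow] at e
    rw [_root_.zpow_neg, zpow_add₀ h0, zpow_add₀ h0, two_mul, zpow_add₀ h0]
    field_simp at e ⊢
    linear_combination -e
  have eu : 1 / (z * qpow η N) = specS η z L N * qhalf η L ^ 2 := by
    rw [specS, qhalf_sq η N, ← qpow_int, Int.cast_natCast]
    have := qpow_ne_zero η N
    field_simp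
  have e2 : qhalf η L ^ 2 * (qhalf η L ^ 2) = (qpow η 1 ^ 2) ^ (L : ℤ) := by
    rw [sq_zpow_nat]; ring
  simp only [psiLiteral, vwp]
  rw [if_pos hc, exp_base, exp_spin, kappa_inv, eu]
  generalize qpow η 1 ^ 2 = q at *
  generalize (dynX lam)⁻¹ = Y at *
  generalize specS η z L N = S at *
  generalize hr : qhalf η L ^ 2 = r at *
  have hr0 : r ≠ 0 := by rw [← hr]; exact pow_ne_zero 2 ha
  have hrL : q ^ (L : ℤ) = r * r := e2.symm
  generalize he : (N : ℤ) - 2 * j₁ = e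
  simp only [List.map_cons, List.map_nil, List.prod_cons, List.prod_nil, mul_one]
  simp only [arg_self, arg_zpow, arg_mul hh, arg_self_mul hh, arg_spin hr0, arg_spin_zero hr0,
    arg_spin' hr0, arg_sq hh hr0 hrL, arg_inv_sq hh hrL, arg_inv_spin hh hr0 hrL,
    arg_spin_mul hh hrL, arg_inv_spin_mul hh hr0, arg_div hh, arg_div_inv_sq hh hr0 hrL hY0,
    arg_div_kappa hh hY0, arg_div_inv_spin hh hr0 hrL, arg_div_spin hh hr0,
    arg_lin hh, arg_lin_mul hh, arg_ratio hr0 hrL]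
  -- The series terminates: `(q^{-j₁})_k` vanishes for `k > N ≥ j₁`.
  rw [tsum_eq_sum (s := Finset.range (N + 1)), Finset.mul_sum, termSum]
  · refine Finset.sum_congr rfl fun k _ => ?_
    by_cases hk : j₁ < k ∨ j₂ < k
    · have e1 : term q Y S L N i₁ j₁ j₂ e k = 0 := by
        rcases hk with hk | hk
        · exact term_eq_zero' hh Y (Int.natCast_nonneg _) (by exact_mod_cast hk)
        · exact term_eq_zero hh Y (Int.natCast_nonneg _) (by exact_mod_cast hk)
      rw [e1]
      rcases hk with hk | hk
      · simp only [qp_one_neg q hh (Int.natCast_nonneg j₁) (by exact_mod_cast hk : (j₁ : ℤ) < k),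
          zero_mul, zero_div, mul_zero]
      · simp only [qp_one_neg q hh (Int.natCast_nonneg j₂) (by exact_mod_cast hk : (j₂ : ℤ) < k),
          zero_mul, zero_div, mul_zero]
    · push Not at hk
      rw [term_eq hh hY hS h1 (Int.natCast_nonneg k) (by omega) (by omega) (by omega),
        termEdge_mul hh h1 hSY hSY' (Int.natCast_nonneg k) (by omega) (by omega) (by omega)
          (by omega), termMonomial]
      have e1 := qp_one_div hh h1 (N := N) (J := j₁) (M := j₂) (Int.natCast_nonneg _) (by omega)
        (by omega)
      simp only [zpow_natCast] at e1 ⊢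
      have split : ∀ a A b d f g B : ℂ, a * A * b * d / (f * g * B) = A / B * (a * b * d / (f * g)) :=
        fun a A b d f g B => by ring
      rw [split _ (qp q 1 (j₂ - N) j₁), e1]
      ring_nf
  · intro k hk
    rw [Finset.mem_range, not_lt] at hk
    simp only [qp_one_neg q hh (Int.natCast_nonneg j₁) (by omega : (j₁ : ℤ) < k),
      zero_mul, zero_div, mul_zero]

end

/-- The matrix entries of `S` as the terminating series of the fused weights. -/
theorem stochS_eq_termSum {η lam z : ℂ} (h : Generic (qpow η 1)) (hz0 : z ≠ 0)
    (hz : ∀ k : ℤ, z ≠ qpow η 1 ^ k) (hX : ∀ k : ℤ, dynX lam ≠ qpow η 1 ^ (2 * k)) {L N : ℕ}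
    (i₁ i₂ : Fin (L + 1)) (j₁ j₂ : Fin (N + 1)) :
    stochS η lam (spectralR η L N z) (i₁, j₁) (i₂, j₂) =
      if (i₁ : ℕ) + j₁ = i₂ + j₂ then termSum (qpow η 1 ^ 2) (dynX lam)⁻¹ (specS η z L N) L N
        (i₁ : ℕ) (j₁ : ℕ) (j₂ : ℕ) (N - 2 * (j₁ : ℕ)) else 0 := by
  rw [stochS_eq h hX]
  change sCoeff η lam z L N _ _ _ _ = _
  split_ifs with hc
  · exact sCoeff_eq h hz0 hz j₂ (by omega) (by omega) lam hX _ _ (by omega) (by omega) (by omega)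
      (by omega) (by exact_mod_cast hc)
  · exact sCoeff_conservation h hz0 hz i₂ j₂ lam hX _ _ (by exact_mod_cast hc)

end DynVertex

end

theorem proposition3p15 (η lam z : ℂ)
    (hq : ∀ n : ℕ, 0 < n → DynVertex.qpow η n ≠ 1)
    (hz0 : z ≠ 0)
    (hz : ∀ k : ℤ, z ≠ DynVertex.qpow η k)
    (hlam : ∀ k : ℤ, DynVertex.dynX lam ≠ DynVertex.qpow η (2 * k))
    (Λ J : ℕ) :
    ∃ RD : Matrix (Fin (Λ + 1) × Fin (J + 1)) (Fin (Λ + 1) × Fin (J + 1)) ℂ,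
      DynVertex.IsSpectralR η z Λ J RD ∧
      (∀ R' : Matrix (Fin (Λ + 1) × Fin (J + 1)) (Fin (Λ + 1) × Fin (J + 1)) ℂ,
        DynVertex.IsSpectralR η z Λ J R' → R' = RD) ∧
      IsUnit RD ∧
      (∀ (i₁ i₂ : Fin (Λ + 1)) (j₁ j₂ : Fin (J + 1)),
        DynVertex.stochS η lam RD (i₁, j₁) (i₂, j₂) =
          DynVertex.psi (-η) Λ J (1 / (z * DynVertex.qpow η J)) lam i₁ j₁ i₂ j₂) ∧
      ((∀ k : ℤ, z * DynVertex.dynX lam ≠ DynVertex.qpow η k) →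
        (∀ k : ℤ, z ≠ DynVertex.dynX lam * DynVertex.qpow η k) →
        ∀ (i₁ i₂ : Fin (Λ + 1)) (j₁ j₂ : Fin (J + 1)),
          (j₂ : ℕ) ≤ i₁ → (j₁ : ℕ) + j₂ ≤ J →
          DynVertex.stochS η lam RD (i₁, j₁) (i₂, j₂) =
            DynVertex.psiLiteral (-η) Λ J (1 / (z * DynVertex.qpow η J)) lam i₁ j₁ i₂ j₂) := by
  have h := DynVertex.generic_qpow hq
  have hz' : ∀ k : ℤ, z ≠ DynVertex.qpow η 1 ^ k := fun k => DynVertex.qpow_int η k ▸ hz k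
  have hX : ∀ k : ℤ, DynVertex.dynX lam ≠ DynVertex.qpow η 1 ^ (2 * k) := fun k => by
    rw [← DynVertex.qpow_int]; push_cast; exact hlam k
  have hR := DynVertex.isSpectralR_spectralR (L := Λ) (J := J) h hz0 hz'
  refine ⟨DynVertex.spectralR η Λ J z, hR, fun R' hR' => hR.eq hR' h hz0 hz',
    hR.isUnit h hz0 hz' (hR.mulVec_zero h), fun i₁ i₂ j₁ j₂ => ?_,
    fun hzX hzX' i₁ i₂ j₁ j₂ hi hj => ?_⟩ <;>
  rw [DynVertex.stochS_eq_termSum h hz0 hz' hX] <;> split_ifs with hc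
  · exact (DynVertex.psi_eq h hz0 hz' hX (by omega) (by omega) hc).symm
  · rw [DynVertex.psi, if_neg hc]
  · exact (DynVertex.psiLiteral_eq h hz0 hz' hX (fun k => DynVertex.qpow_int η k ▸ hzX k)
      (fun k => DynVertex.qpow_int η k ▸ hzX' k) (by omega) hi hj hc).symm
  · rw [DynVertex.psiLiteral, if_neg hc]
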